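/- Let $k\ge 0$ and $l\ge 1$ be integers. Let $\mathcal X,\mathcal Y,\hat{\mathcal X}_1,\dots,\hat{\mathcal X}_{k+l}$ be finite alphabets, let $(X_t,Y_t)_{t\ge1}$ be i.i.d. with law $P(x,y)$ on $\mathcal X\times\mathcal Y$, and let $d_i:\mathcal X\times\hat{\mathcal X}_i\to[0,\infty)$ and $D_i\in\mathbb R$ for $1\le i\le k+l$. Consider the network with one encoder, which observes $(X^n,Y^n)$, and Users $1,\dots,k+l$, where the side information $Y^n$ is also available to Users $1,\dots,k$ but not to Users $k+1,\dots,k+l$. The encoder sends a message $T_1$ to User $1$ and a message $T_{k+l+1}$ directly to User $k+l$, both functions of $(X^n,Y^n)$. For $1\le i<k+l$, User $i$ sends to User $i+1$ a message $T_{i+1}$, which is a function of $(T_i,Y^n)$ if $i\le k$ and of $T_i$ alone if $i>k$. For $1\le i<k+l$, User $i$ forms a reconstruction $\hat X_i^n\in\hat{\mathcal X}_i^n$ as a function of $(T_i,Y^n)$ if $i\le k$ and of $T_i$ alone if $i>k$; User $k+l$ forms $\hat X_{k+l}^n\in\hat{\mathcal X}_{k+l}^n$ as a function of $(T_{k+l},T_{k+l+1})$.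 A rate vector $(R_1,\dots,R_{k+l+1})\in\mathbb R^{k+l+1}$ is achievable if for every $\epsilon>0$ and all sufficiently large $n$ there is such a code of block length $n$ in which $T_i$ takes values in a set of at most $2^{nR_i}$ elements for $1\le i\le k+l+1$, and $\mathbb E\big[\frac1n\sum_{t=1}^n d_i(X_t,\hat X_{i,t})\big]\le D_i+\epsilon$ for $1\le i\le k+l$. The achievable region is the closure of the set of achievable rate vectors. Then the achievable region is the set of all $(R_1,\dots,R_{k+l+1})$ that satisfy, with mutual informations in bits, \begin{align*} R_i&\ge I(X;\hat X_i,\hat X_{i+1},\dots,\hat X_{k+l-1},U\mid Y), && 1\le i\le k,\\ R_j&\ge I(X,Y;\hat X_j,\dots,\hat X_{k+l-1},U), && k+1\le j\le k+l,\\ R_{k+l+1}&\ge I(X;\hat X_{k+l}\mid U) \end{align*} for some joint distribution $P(x,y)P(\hat x_1,\dots,\hat x_{k+l},u\mid x,y)$, with $U$ an auxiliary random variable on a finite alphabet $\mathcal U$, for which $\mathbb E\,d_i(X,\hat X_i)\le D_i$ for $1\le i\le k+l$ (for $j=k+l$ the second bound reads $R_{k+l}\ge I(X,Y;U)$). Moreover,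 the region is unchanged if the alphabet of $U$ is required to satisfy $$|\mathcal U|\le|\mathcal X|\,|\mathcal Y|\,|\hat{\mathcal X}_1|\cdots|\hat{\mathcal X}_{k+l}|+k+l.$$ -/

import Mathlib

noncomputable section

namespace TriangularNetwork

/-! ### Information measures on a finite probability space -/

open Classical in
/-- The probability `P(A = a)` when the finite sample space `Ω` has probability mass function `q`. -/
def prob {Ω α : Type*} [Fintype Ω] (q : Ω → ℝ) (A : Ω → α) (a : α) : ℝ :=
  ∑ ω : Ω with A ω = a, q ω

/-- The mutual information `I(A; B) = E log₂ (p(A, B) / (p(A) p(B)))`, in bits. -/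
def mutualInfo {Ω α β : Type*} [Fintype Ω] (q : Ω → ℝ) (A : Ω → α) (B : Ω → β) : ℝ :=
  ∑ ω, q ω * Real.logb 2
    (prob q (fun ω' => (A ω', B ω')) (A ω, B ω) / (prob q A (A ω) * prob q B (B ω)))

/-- The conditional mutual information
`I(A; B | C) = E log₂ (p(A, B | C) / (p(A | C) p(B | C)))`
`= E log₂ (p(A, B, C) p(C) / (p(A, C) p(B, C)))`, in bits. -/
def condMutualInfo {Ω α β γ : Type*} [Fintype Ω] (q : Ω → ℝ)
    (A : Ω → α) (B : Ω → β) (C : Ω → γ) : ℝ :=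
  ∑ ω, q ω * Real.logb 2
    (prob q (fun ω' => (A ω', B ω', C ω')) (A ω, B ω, C ω) * prob q C (C ω) /
      (prob q (fun ω' => (A ω', C ω')) (A ω, C ω) *
        prob q (fun ω' => (B ω', C ω')) (B ω, C ω)))

/-! ### Codes for the network

There are `k + l` users, numbered here from `0` to `k + l - 1`; users `0, …, k - 1` observe the side
information `Yⁿ`, users `k, …, k + l - 1` do not.  Link `i < k + l` enters user `i`; it comes from
the encoder if `i = 0` and from user `i - 1` otherwise.  Link `k + l` goes directly from the
encoder to the last user, `k + l - 1`. -/

/-- What user `i` sees of the side information sequence `y`. -/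
def sideView {σ : Type*} (k : ℕ) (y : σ) (i : ℕ) : Option σ :=
  if i < k then some y else none

/-- What user `i` out of `N` users sees of the message `t` on the direct link. -/
def directView {σ : Type*} (N : ℕ) (t : σ) (i : ℕ) : Option σ :=
  if i + 1 = N then some t else none

/-- A code of block length `n`, with the message set `Fin (M i)` on link `i`. -/
structure Code (k l n : ℕ) (𝒳 𝒴 : Type*) (𝒳h : Fin (k + l) → Type*)
    (M : Fin (k + l + 1) → ℕ) where
  /-- The message from the encoder to the first user. -/
  enc : (Fin n → 𝒳) → (Fin n → 𝒴) → Fin (M ⟨0, by omega⟩)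
  /-- The message from the encoder to the last user. -/
  direct : (Fin n → 𝒳) → (Fin n → 𝒴) → Fin (M (Fin.last (k + l)))
  /-- The message that user `i` forwards to user `i + 1`, as a function of what user `i` sees of the
  side information and of the message it received. -/
  relay : (i : ℕ) → (hi : i + 1 < k + l) →
    Option (Fin n → 𝒴) → Fin (M ⟨i, by omega⟩) → Fin (M ⟨i + 1, by omega⟩)
  /-- The reconstruction of user `i`, as a function of what it sees of the side information, of the
  message received from its predecessor, and of what it sees of the direct message. -/
  dec : (i : Fin (k + l)) → Option (Fin n → 𝒴) → Fin (M i.castSucc) →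
    Option (Fin (M (Fin.last (k + l)))) → Fin n → 𝒳h i

namespace Code

/-- The message that enters user `i` when the encoder observes `(x, y)`. -/
def msg {k l n : ℕ} {𝒳 𝒴 : Type*} {𝒳h : Fin (k + l) → Type*} {M : Fin (k + l + 1) → ℕ}
    (c : Code k l n 𝒳 𝒴 𝒳h M) (x : Fin n → 𝒳) (y : Fin n → 𝒴) :
    (i : ℕ) → (hi : i < k + l) → Fin (M ⟨i, by omega⟩)
  | 0, _ => c.enc x y
  | i + 1, hi => c.relay i hi (sideView k y i) (c.msg x y i (by omega))

/-- The reconstruction sequence of user `i`. -/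
def recon {k l n : ℕ} {𝒳 𝒴 : Type*} {𝒳h : Fin (k + l) → Type*} {M : Fin (k + l + 1) → ℕ}
    (c : Code k l n 𝒳 𝒴 𝒳h M) (x : Fin n → 𝒳) (y : Fin n → 𝒴) (i : Fin (k + l)) :
    Fin n → 𝒳h i :=
  c.dec i (sideView k y i) (c.msg x y i i.isLt) (directView (k + l) (c.direct x y) i)

/-- The expected per-letter distortion `E[(1/n) ∑ₜ dᵢ(Xₜ, X̂ᵢₜ)]` of user `i` when the pairs
`(Xₜ, Yₜ)` are i.i.d. with probability mass function `P`. -/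
def expDistortion {k l n : ℕ} {𝒳 𝒴 : Type*} [Fintype 𝒳] [Fintype 𝒴]
    {𝒳h : Fin (k + l) → Type*} {M : Fin (k + l + 1) → ℕ} (c : Code k l n 𝒳 𝒴 𝒳h M)
    (P : 𝒳 × 𝒴 → ℝ) (d : (i : Fin (k + l)) → 𝒳 → 𝒳h i → ℝ) (i : Fin (k + l)) : ℝ :=
  ∑ x : Fin n → 𝒳, ∑ y : Fin n → 𝒴,
    (∏ t, P (x t, y t)) * ((1 / (n : ℝ)) * ∑ t, d i (x t) (c.recon x y i t))

end Code

/-- The rate vector `R` is achievable at distortions `D`: for every `ε > 0` and every sufficiently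
large `n` there is a code of block length `n` with at most `2 ^ (n Rᵢ)` messages on each link `i`
and expected distortion at most `Dᵢ + ε` at each user `i`. -/
def Achievable {k l : ℕ} {𝒳 𝒴 : Type*} [Fintype 𝒳] [Fintype 𝒴] {𝒳h : Fin (k + l) → Type*}
    (P : 𝒳 × 𝒴 → ℝ) (d : (i : Fin (k + l)) → 𝒳 → 𝒳h i → ℝ) (D : Fin (k + l) → ℝ)
    (R : Fin (k + l + 1) → ℝ) : Prop :=
  ∀ ε : ℝ, 0 < ε → ∃ n₀ : ℕ, ∀ n : ℕ, n₀ ≤ n →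
    ∃ (M : Fin (k + l + 1) → ℕ) (c : Code k l n 𝒳 𝒴 𝒳h M),
      (∀ i, (M i : ℝ) ≤ (2 : ℝ) ^ ((n : ℝ) * R i)) ∧
      ∀ i, c.expDistortion P d i ≤ D i + ε

/-- The operational achievable region: the closure of the set of achievable rate vectors. -/
def achievableRegion {k l : ℕ} {𝒳 𝒴 : Type*} [Fintype 𝒳] [Fintype 𝒴]
    {𝒳h : Fin (k + l) → Type*} (P : 𝒳 × 𝒴 → ℝ) (d : (i : Fin (k + l)) → 𝒳 → 𝒳h i → ℝ)
    (D : Fin (k + l) → ℝ) : Set (Fin (k + l + 1) → ℝ) :=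
  closure {R | Achievable P d D R}

/-! ### The single-letter region -/

/-- The alphabet of `(X, Y, (X̂ᵢ)ᵢ, U)` when `U` takes `m` values. -/
abbrev Joint {N : ℕ} (𝒳 𝒴 : Type*) (𝒳h : Fin N → Type*) (m : ℕ) : Type _ :=
  𝒳 × 𝒴 × ((i : Fin N) → 𝒳h i) × Fin m

namespace Joint

/-- The source letter. -/
def X {N m : ℕ} {𝒳 𝒴 : Type*} {𝒳h : Fin N → Type*} (ω : Joint 𝒳 𝒴 𝒳h m) : 𝒳 := ω.1

/-- The side information letter. -/
def Y {N m : ℕ} {𝒳 𝒴 : Type*} {𝒳h : Fin N → Type*} (ω : Joint 𝒳 𝒴 𝒳h m) : 𝒴 := ω.2.1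

/-- The reconstruction letter of user `i`. -/
def Xhat {N m : ℕ} {𝒳 𝒴 : Type*} {𝒳h : Fin N → Type*} (i : Fin N) (ω : Joint 𝒳 𝒴 𝒳h m) : 𝒳h i :=
  ω.2.2.1 i

/-- The auxiliary letter. -/
def U {N m : ℕ} {𝒳 𝒴 : Type*} {𝒳h : Fin N → Type*} (ω : Joint 𝒳 𝒴 𝒳h m) : Fin m := ω.2.2.2

/-- The reconstruction letters of all users from user `i` on, except the last user, together with
the auxiliary letter: `(X̂ᵢ, …, X̂_{N-2}, U)` with users numbered from `0` to `N - 1`. -/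
def tailU {N m : ℕ} {𝒳 𝒴 : Type*} {𝒳h : Fin N → Type*} (i : Fin N) (ω : Joint 𝒳 𝒴 𝒳h m) :
    ((j : {j : Fin N // i ≤ j ∧ (j : ℕ) + 1 < N}) → 𝒳h j) × Fin m :=
  (fun j => Xhat j.1 ω, U ω)

end Joint

/-- The rate vectors that satisfy the single-letter bounds for some joint distribution
`P(x, y) P(x̂, u | x, y)`, given by its probability mass function `q`, with an auxiliary variable `U`
that takes values in a set of `m` elements, and with expected distortions at most `D`. -/
def infoRegion {k l : ℕ} {𝒳 𝒴 : Type*} [Fintype 𝒳] [Fintype 𝒴]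
    {𝒳h : Fin (k + l) → Type*} [∀ i, Fintype (𝒳h i)]
    (P : 𝒳 × 𝒴 → ℝ) (d : (i : Fin (k + l)) → 𝒳 → 𝒳h i → ℝ) (D : Fin (k + l) → ℝ)
    (m : ℕ) : Set (Fin (k + l + 1) → ℝ) :=
  {R | ∃ q ∈ stdSimplex ℝ (Joint 𝒳 𝒴 𝒳h m),
    (∀ x y, prob q (fun ω => (Joint.X ω, Joint.Y ω)) (x, y) = P (x, y)) ∧
    (∀ i : Fin (k + l), (i : ℕ) < k →
      condMutualInfo q Joint.X (Joint.tailU i) Joint.Y ≤ R i.castSucc) ∧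
    (∀ j : Fin (k + l), k ≤ (j : ℕ) →
      mutualInfo q (fun ω => (Joint.X ω, Joint.Y ω)) (Joint.tailU j) ≤ R j.castSucc) ∧
    (∀ j : Fin (k + l), (j : ℕ) + 1 = k + l →
      condMutualInfo q Joint.X (Joint.Xhat j) Joint.U ≤ R (Fin.last (k + l))) ∧
    (∀ i : Fin (k + l), ∑ ω, q ω * d i (Joint.X ω) (Joint.Xhat i ω) ≤ D i)}

end TriangularNetwork

end

noncomputable section

namespace TriangularNetwork

open Real Finset

/-! ### Probabilities and entropies of functions on a finite probability space -/

section Prob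

variable {Ω Ω' α β γ : Type*} [Fintype Ω] [Fintype Ω'] {q : Ω → ℝ}

open Classical in
theorem prob_eq_sum_ite (q : Ω → ℝ) (A : Ω → α) (a : α) :
    prob q A a = ∑ ω, if A ω = a then q ω else 0 := by
  rw [prob, Finset.sum_filter]

theorem prob_nonneg (hq : ∀ ω, 0 ≤ q ω) (A : Ω → α) (a : α) : 0 ≤ prob q A a :=
  Finset.sum_nonneg fun ω _ => hq ω

theorem le_prob (hq : ∀ ω, 0 ≤ q ω) (A : Ω → α) (ω : Ω) : q ω ≤ prob q A (A ω) := by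
  classical
  unfold prob
  exact Finset.single_le_sum (f := q) (fun ω' _ => hq ω') (by simp)

theorem prob_pos (hq : ∀ ω, 0 ≤ q ω) (A : Ω → α) {ω : Ω} (h : 0 < q ω) :
    0 < prob q A (A ω) := h.trans_le (le_prob hq A ω)

theorem exists_of_prob_pos {A : Ω → α} {a : α} (h : 0 < prob q A a) :
    ∃ ω, A ω = a ∧ 0 < q ω := by
  classical
  unfold prob at h
  obtain ⟨ω, hω, h⟩ := Finset.exists_lt_of_sum_lt (f := fun _ => (0 : ℝ)) (by simpa using h)
  exact ⟨ω, by simpa using hω, h⟩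

theorem prob_congr {A : Ω → α} {B : Ω → β} {a : α} {b : β} (h : ∀ ω, A ω = a ↔ B ω = b) :
    prob q A a = prob q B b := by
  classical
  simp only [prob_eq_sum_ite, h]

theorem sum_prob_mul [Fintype α] (q : Ω → ℝ) (A : Ω → α) (g : α → ℝ) :
    ∑ a, prob q A a * g a = ∑ ω, q ω * g (A ω) := by
  classical
  simp only [prob_eq_sum_ite, Finset.sum_mul]
  rw [Finset.sum_comm]
  refine Finset.sum_congr rfl fun ω _ => ?_
  simp [ite_mul]

theorem sum_prob [Fintype α] (q : Ω → ℝ) (A : Ω → α) : ∑ a, prob q A a = ∑ ω, q ω := by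
  simpa using sum_prob_mul q A (fun _ => 1)

theorem prob_prob (q : Ω → ℝ) (f : Ω → Ω') (A : Ω' → α) (a : α) :
    prob (prob q f) A a = prob q (fun ω => A (f ω)) a := by
  classical
  rw [prob_eq_sum_ite, prob_eq_sum_ite]
  have := sum_prob_mul q f (fun ω' => if A ω' = a then 1 else 0)
  simpa using this

theorem sum_prob_prod [Fintype β] (q : Ω → ℝ) (A : Ω → α) (B : Ω → β) (a : α) :
    ∑ b, prob q (fun ω => (A ω, B ω)) (a, b) = prob q A a := by
  classical
  simp only [prob_eq_sum_ite, Prod.mk.injEq]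
  rw [Finset.sum_comm]
  refine Finset.sum_congr rfl fun ω _ => ?_
  by_cases h : A ω = a <;> simp [h]

/-- The entropy of `A` in bits. -/
def entropy (q : Ω → ℝ) (A : Ω → α) : ℝ := -∑ ω, q ω * logb 2 (prob q A (A ω))

theorem entropy_congr {A : Ω → α} {B : Ω → β} (h : ∀ ω ω', A ω = A ω' ↔ B ω = B ω') :
    entropy q A = entropy q B := by
  unfold entropy
  congr 1
  exact Finset.sum_congr rfl fun ω _ => by rw [prob_congr fun ω' => h ω' ω]

theorem entropy_eq_sum [Fintype α] (q : Ω → ℝ) (A : Ω → α) :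
    entropy q A = (∑ a, negMulLog (prob q A a)) / log 2 := by
  unfold entropy
  rw [← sum_prob_mul q A fun a => logb 2 (prob q A a), ← Finset.sum_neg_distrib, Finset.sum_div]
  refine Finset.sum_congr rfl fun a _ => ?_
  rw [negMulLog, logb]; ring

theorem entropy_eq_of_prob_eq [Fintype α] {q : Ω → ℝ} {q' : Ω' → ℝ} {A : Ω → α} {B : Ω' → α}
    (h : ∀ a, prob q A a = prob q' B a) : entropy q A = entropy q' B := by
  simp only [entropy_eq_sum, h]

theorem mutualInfo_eq (hq : ∀ ω, 0 ≤ q ω) (A : Ω → α) (B : Ω → β) :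
    mutualInfo q A B = entropy q A + entropy q B - entropy q (fun ω => (A ω, B ω)) := by
  unfold mutualInfo entropy
  rw [← Finset.sum_neg_distrib, ← Finset.sum_neg_distrib, ← Finset.sum_neg_distrib,
    ← Finset.sum_add_distrib, ← Finset.sum_sub_distrib]
  refine Finset.sum_congr rfl fun ω _ => ?_
  rcases (hq ω).eq_or_lt with h | h
  · simp [← h]
  have h1 := prob_pos hq A h
  have h2 := prob_pos hq B h
  have h3 := prob_pos hq (fun ω => (A ω, B ω)) h
  rw [logb_div h3.ne' (by positivity), logb_mul h1.ne' h2.ne']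
  ring

theorem condMutualInfo_eq (hq : ∀ ω, 0 ≤ q ω) (A : Ω → α) (B : Ω → β) (C : Ω → γ) :
    condMutualInfo q A B C = entropy q (fun ω => (A ω, C ω)) + entropy q (fun ω => (B ω, C ω))
      - entropy q (fun ω => (A ω, B ω, C ω)) - entropy q C := by
  unfold condMutualInfo entropy
  rw [← Finset.sum_neg_distrib, ← Finset.sum_neg_distrib, ← Finset.sum_neg_distrib,
    ← Finset.sum_neg_distrib,
    ← Finset.sum_add_distrib, ← Finset.sum_sub_distrib, ← Finset.sum_sub_distrib]
  refine Finset.sum_congr rfl fun ω _ => ?_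
  rcases (hq ω).eq_or_lt with h | h
  · simp [← h]
  have h1 := prob_pos hq (fun ω => (A ω, C ω)) h
  have h2 := prob_pos hq (fun ω => (B ω, C ω)) h
  have h3 := prob_pos hq (fun ω => (A ω, B ω, C ω)) h
  have h4 := prob_pos hq C h
  rw [logb_div (by positivity) (by positivity), logb_mul h1.ne' h2.ne', logb_mul h3.ne' h4.ne']
  ring

theorem logb_two_le (x : ℝ) (hx : 0 < x) : logb 2 x ≤ (x - 1) / log 2 := by
  have : 0 < log 2 := log_pos (by norm_num)
  rw [logb]
  gcongr
  exact log_le_sub_one_of_pos hx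

theorem condMutualInfo_nonneg_of_fintype [Fintype α] [Fintype β] [Fintype γ]
    (hq : ∀ ω, 0 ≤ q ω) (A : Ω → α) (B : Ω → β) (C : Ω → γ) :
    0 ≤ condMutualInfo q A B C := by
  have hlog : 0 < log 2 := log_pos (by norm_num)
  set pac := prob q (fun ω => (A ω, C ω)) with hpac
  set pbc := prob q (fun ω => (B ω, C ω)) with hpbc
  set pabc := prob q (fun ω => (A ω, B ω, C ω)) with hpabc
  set pc := prob q C with hpc
  have key : ∑ ω, q ω * (pac (A ω, C ω) * pbc (B ω, C ω) / (pabc (A ω, B ω, C ω) * pc (C ω)))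
      ≤ ∑ ω, q ω := by
    rw [← sum_prob_mul q (fun ω => (A ω, B ω, C ω))
      (fun v => pac (v.1, v.2.2) * pbc (v.2.1, v.2.2) / (pabc v * pc v.2.2)), ← sum_prob q C]
    have : ∀ v : α × β × γ, prob q (fun ω => (A ω, B ω, C ω)) v *
        (pac (v.1, v.2.2) * pbc (v.2.1, v.2.2) / (pabc v * pc v.2.2)) ≤
        pac (v.1, v.2.2) * pbc (v.2.1, v.2.2) / pc v.2.2 := by
      intro v
      have h0 : 0 ≤ pac (v.1, v.2.2) * pbc (v.2.1, v.2.2) / pc v.2.2 :=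
        div_nonneg (mul_nonneg (prob_nonneg hq _ _) (prob_nonneg hq _ _)) (prob_nonneg hq _ _)
      by_cases h : pabc v = 0
      · rw [← hpabc, h]; simpa using h0
      · apply le_of_eq
        rw [← hpabc]
        by_cases h' : pc v.2.2 = 0
        · simp [h']
        · field_simp
    refine (Finset.sum_le_sum fun v _ => this v).trans ?_
    rw [Fintype.sum_prod_type]
    simp_rw [Fintype.sum_prod_type]
    have e1 : ∀ c, ∑ a, pac (a, c) = pc c := fun c => by
      rw [hpc, ← sum_prob_prod q C A c]
      exact Finset.sum_congr rfl fun a _ => prob_congr fun ω => by simp [and_comm]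
    have e2 : ∀ c, ∑ b, pbc (b, c) = pc c := fun c => by
      rw [hpc, ← sum_prob_prod q C B c]
      exact Finset.sum_congr rfl fun a _ => prob_congr fun ω => by simp [and_comm]
    calc ∑ a, ∑ b, ∑ c, pac (a, c) * pbc (b, c) / pc c
        = ∑ c, (∑ a, pac (a, c)) * (∑ b, pbc (b, c)) / pc c := by
          simp_rw [Finset.sum_mul_sum, Finset.sum_div]
          rw [Finset.sum_comm' (t' := univ) (s' := fun _ => univ) (by simp)]
          rw [Finset.sum_comm' (t' := univ) (s' := fun _ => univ) (by simp)]
          rw [Finset.sum_comm]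
          refine (Finset.sum_congr rfl fun b _ => Finset.sum_comm).trans ?_
          rw [Finset.sum_comm]
          rw [Finset.sum_comm]
          rw [Finset.sum_comm]
          refine Finset.sum_congr rfl fun c _ => ?_
          rw [Finset.sum_comm]
      _ ≤ ∑ c, pc c := by
          refine Finset.sum_le_sum fun c _ => ?_
          rw [e1, e2]
          by_cases h' : pc c = 0
          · simp [h']
          · rw [mul_div_assoc, div_self h', mul_one]
  have hneg : -condMutualInfo q A B C ≤ 0 := by
    calc -condMutualInfo q A B C
        ≤ ∑ ω, q ω * ((pac (A ω, C ω) * pbc (B ω, C ω) / (pabc (A ω, B ω, C ω) * pc (C ω)) - 1)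
            / log 2) := by
          unfold condMutualInfo
          rw [← Finset.sum_neg_distrib]
          refine Finset.sum_le_sum fun ω _ => ?_
          rcases (hq ω).eq_or_lt with h | h
          · simp [← h]
          have h1 := prob_pos hq (fun ω => (A ω, C ω)) h
          have h2 := prob_pos hq (fun ω => (B ω, C ω)) h
          have h3 := prob_pos hq (fun ω => (A ω, B ω, C ω)) h
          have h4 := prob_pos hq C h
          rw [← mul_neg, ← logb_inv, inv_div]
          exact mul_le_mul_of_nonneg_left (logb_two_le _ (by positivity)) h.le
      _ = (∑ ω, q ω * (pac (A ω, C ω) * pbc (B ω, C ω) /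
            (pabc (A ω, B ω, C ω) * pc (C ω))) - ∑ ω, q ω) / log 2 := by
          rw [← Finset.sum_sub_distrib, Finset.sum_div]
          exact Finset.sum_congr rfl fun ω _ => by ring
      _ ≤ 0 := div_nonpos_of_nonpos_of_nonneg (by linarith) hlog.le
  linarith

/-- Submodularity of entropy. -/
theorem entropy_submodular (hq : ∀ ω, 0 ≤ q ω) (A : Ω → α) (B : Ω → β) (C : Ω → γ) :
    entropy q (fun ω => (A ω, B ω, C ω)) + entropy q C ≤
      entropy q (fun ω => (A ω, C ω)) + entropy q (fun ω => (B ω, C ω)) := by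
  classical
  let A' := Set.rangeFactorization A
  let B' := Set.rangeFactorization B
  let C' := Set.rangeFactorization C
  have := condMutualInfo_nonneg_of_fintype hq A' B' C'
  rw [condMutualInfo_eq hq] at this
  have hA : ∀ ω ω', A' ω = A' ω' ↔ A ω = A ω' := fun ω ω' => Subtype.ext_iff
  have hB : ∀ ω ω', B' ω = B' ω' ↔ B ω = B ω' := fun ω ω' => Subtype.ext_iff
  have hC : ∀ ω ω', C' ω = C' ω' ↔ C ω = C ω' := fun ω ω' => Subtype.ext_iff
  rw [entropy_congr (B := fun ω => (A ω, C ω)) (by simp [hA, hC]),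
    entropy_congr (A := fun ω => (B' ω, C' ω)) (B := fun ω => (B ω, C ω)) (by simp [hB, hC]),
    entropy_congr (A := fun ω => (A' ω, B' ω, C' ω)) (B := fun ω => (A ω, B ω, C ω))
      (by simp [hA, hB, hC]),
    entropy_congr (A := C') (B := C) hC] at this
  linarith

/-- Conditioning on more reduces entropy. -/
theorem entropy_sub_le_of_factor (hq : ∀ ω, 0 ≤ q ω) (A : Ω → α) {B : Ω → β} {C : Ω → γ}
    (h : ∀ ω ω', B ω = B ω' → C ω = C ω') :
    entropy q (fun ω => (A ω, B ω)) - entropy q B ≤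
      entropy q (fun ω => (A ω, C ω)) - entropy q C := by
  have := entropy_submodular hq A B C
  rw [entropy_congr (A := fun ω => (A ω, B ω, C ω)) (B := fun ω => (A ω, B ω)),
    entropy_congr (A := fun ω => (B ω, C ω)) (B := B)] at this
  · linarith
  · intro ω ω'; simpa using h ω ω'
  · intro ω ω'; simpa using fun _ => h ω ω'

theorem entropy_const (hq1 : ∑ ω, q ω = 1) (c : γ) : entropy q (fun _ : Ω => c) = 0 := by
  simp [entropy, prob, hq1]

theorem entropy_prod_le (hq : ∀ ω, 0 ≤ q ω) (hq1 : ∑ ω, q ω = 1) (A : Ω → α) (B : Ω → β) :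
    entropy q (fun ω => (A ω, B ω)) ≤ entropy q A + entropy q B := by
  have := entropy_sub_le_of_factor hq A (B := B) (C := fun _ => ()) (fun _ _ _ => rfl)
  rw [entropy_const hq1, entropy_congr (A := fun ω => (A ω, ())) (B := A) (by simp)] at this
  linarith

theorem entropy_le_logb_card (hq : ∀ ω, 0 ≤ q ω) (hq1 : ∑ ω, q ω = 1) {M : ℕ}
    (A : Ω → Fin M) : entropy q A ≤ logb 2 M := by
  have hlog : 0 < log 2 := log_pos (by norm_num)
  have hM : 0 < M := by
    rcases Nat.eq_zero_or_pos M with h | h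
    · subst h
      have : IsEmpty Ω := ⟨fun ω => (A ω).elim0⟩
      simp at hq1
    · exact h
  have hM' : (0 : ℝ) < M := by exact_mod_cast hM
  have h1 : entropy q A - logb 2 M = ∑ ω, q ω * logb 2 (1 / (M * prob q A (A ω))) := by
    have : logb 2 M = ∑ ω, q ω * logb 2 M := by rw [← Finset.sum_mul, hq1, one_mul]
    rw [this, entropy, ← Finset.sum_neg_distrib, ← Finset.sum_sub_distrib]
    refine Finset.sum_congr rfl fun ω _ => ?_
    rcases (hq ω).eq_or_lt with h' | h'
    · simp [← h']
    rw [one_div, logb_inv, logb_mul hM'.ne' (prob_pos hq A h').ne']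
    ring
  have h2 : ∑ ω, q ω * logb 2 (1 / (M * prob q A (A ω))) ≤
      ∑ ω, q ω * ((1 / (M * prob q A (A ω)) - 1) / log 2) := by
    refine Finset.sum_le_sum fun ω _ => ?_
    rcases (hq ω).eq_or_lt with h' | h'
    · simp [← h']
    have := prob_pos hq A h'
    exact mul_le_mul_of_nonneg_left (logb_two_le _ (by positivity)) h'.le
  have h3 : ∑ ω, q ω * (1 / (M * prob q A (A ω))) ≤ 1 := by
    rw [← sum_prob_mul q A (fun a => 1 / (M * prob q A a))]
    calc ∑ a, prob q A a * (1 / (M * prob q A a)) ≤ ∑ _a : Fin M, (1 : ℝ) / M := by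
          refine Finset.sum_le_sum fun a _ => ?_
          by_cases h : prob q A a = 0
          · simp [h]
          · apply le_of_eq; field_simp
      _ = 1 := by simp [hM'.ne']
  have h4 : ∑ ω, q ω * ((1 / (M * prob q A (A ω)) - 1) / log 2) =
      (∑ ω, q ω * (1 / (M * prob q A (A ω))) - ∑ ω, q ω) / log 2 := by
    rw [← Finset.sum_sub_distrib, Finset.sum_div]
    exact Finset.sum_congr rfl fun ω _ => by ring
  have h5 : (∑ ω, q ω * (1 / (M * prob q A (A ω))) - ∑ ω, q ω) / log 2 ≤ 0 :=
    div_nonpos_of_nonpos_of_nonneg (by linarith) hlog.le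
  linarith

theorem mutualInfo_prob (q : Ω → ℝ) (f : Ω → Ω') (A : Ω' → α) (B : Ω' → β) :
    mutualInfo (prob q f) A B = mutualInfo q (fun ω => A (f ω)) (fun ω => B (f ω)) := by
  unfold mutualInfo
  rw [sum_prob_mul q f fun ω => logb 2 (prob (prob q f) (fun ω' => (A ω', B ω')) (A ω, B ω) /
    (prob (prob q f) A (A ω) * prob (prob q f) B (B ω)))]
  simp only [prob_prob]

theorem condMutualInfo_prob (q : Ω → ℝ) (f : Ω → Ω') (A : Ω' → α) (B : Ω' → β) (C : Ω' → γ) :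
    condMutualInfo (prob q f) A B C =
      condMutualInfo q (fun ω => A (f ω)) (fun ω => B (f ω)) (fun ω => C (f ω)) := by
  unfold condMutualInfo
  rw [sum_prob_mul q f fun ω => logb 2 (prob (prob q f) (fun ω' => (A ω', B ω', C ω'))
      (A ω, B ω, C ω) * prob (prob q f) C (C ω) /
      (prob (prob q f) (fun ω' => (A ω', C ω')) (A ω, C ω) *
        prob (prob q f) (fun ω' => (B ω', C ω')) (B ω, C ω)))]
  simp only [prob_prob]

theorem mutualInfo_congr {α' β' : Type*} (q : Ω → ℝ) {A : Ω → α} {A' : Ω → α'} {B : Ω → β}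
    {B' : Ω → β'}
    (hA : ∀ ω ω', A ω = A ω' ↔ A' ω = A' ω') (hB : ∀ ω ω', B ω = B ω' ↔ B' ω = B' ω') :
    mutualInfo q A B = mutualInfo q A' B' := by
  unfold mutualInfo
  refine Finset.sum_congr rfl fun ω _ => ?_
  rw [prob_congr (fun ω' => hA ω' ω), prob_congr (fun ω' => hB ω' ω),
    prob_congr (B := fun ω' => (A' ω', B' ω')) (b := (A' ω, B' ω))
      (fun ω' => by simp [hA ω' ω, hB ω' ω])]

theorem condMutualInfo_congr {α' β' γ' : Type*} (q : Ω → ℝ) {A : Ω → α} {A' : Ω → α'} {B : Ω → β}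
    {B' : Ω → β'} {C : Ω → γ} {C' : Ω → γ'}
    (hA : ∀ ω ω', A ω = A ω' ↔ A' ω = A' ω') (hB : ∀ ω ω', B ω = B ω' ↔ B' ω = B' ω')
    (hC : ∀ ω ω', C ω = C ω' ↔ C' ω = C' ω') :
    condMutualInfo q A B C = condMutualInfo q A' B' C' := by
  unfold condMutualInfo
  refine Finset.sum_congr rfl fun ω _ => ?_
  rw [prob_congr (fun ω' => hC ω' ω),
    prob_congr (A := fun ω' => (A ω', B ω', C ω')) (a := (A ω, B ω, C ω))
      (B := fun ω' => (A' ω', B' ω', C' ω')) (b := (A' ω, B' ω, C' ω))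
      (fun ω' => by simp [hA ω' ω, hB ω' ω, hC ω' ω]),
    prob_congr (A := fun ω' => (A ω', C ω')) (a := (A ω, C ω))
      (B := fun ω' => (A' ω', C' ω')) (b := (A' ω, C' ω))
      (fun ω' => by simp [hA ω' ω, hC ω' ω]),
    prob_congr (A := fun ω' => (B ω', C ω')) (a := (B ω, C ω))
      (B := fun ω' => (B' ω', C' ω')) (b := (B' ω, C' ω))
      (fun ω' => by simp [hB ω' ω, hC ω' ω])]

theorem continuous_entropy [Fintype α] (A : Ω → α) : Continuous fun q : Ω → ℝ => entropy q A := by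
  simp only [entropy_eq_sum]
  refine Continuous.div_const (continuous_finsetSum _ fun a _ => continuous_negMulLog.comp ?_) _
  unfold prob
  fun_prop

end Prob

/-! ### Membership in the single-letter region -/

section Membership

variable {Ω 𝒰 : Type*} {N : ℕ} {𝒳h : Fin N → Type*}

/-- The reconstruction letters of all users from user `i` on, except the last one, together
with `U`. -/
def tailOf (Xh : (i : Fin N) → Ω → 𝒳h i) (U : Ω → 𝒰) (i : Fin N) (ω : Ω) :
    ((j : {j : Fin N // i ≤ j ∧ (j : ℕ) + 1 < N}) → 𝒳h j) × 𝒰 :=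
  (fun j => Xh j.1 ω, U ω)

theorem mem_infoRegion_of_pmf {k l : ℕ} {𝒳 𝒴 : Type*} [Fintype 𝒳] [Fintype 𝒴]
    {𝒳h : Fin (k + l) → Type*} [∀ i, Fintype (𝒳h i)] [Fintype Ω] [Fintype 𝒰]
    {P : 𝒳 × 𝒴 → ℝ} {d : (i : Fin (k + l)) → 𝒳 → 𝒳h i → ℝ} {D : Fin (k + l) → ℝ}
    {R : Fin (k + l + 1) → ℝ} {q : Ω → ℝ} (hq : ∀ ω, 0 ≤ q ω) (hq1 : ∑ ω, q ω = 1)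
    (X : Ω → 𝒳) (Y : Ω → 𝒴) (Xh : (i : Fin (k + l)) → Ω → 𝒳h i) (U : Ω → 𝒰)
    (hXY : ∀ x y, prob q (fun ω => (X ω, Y ω)) (x, y) = P (x, y))
    (h1 : ∀ i : Fin (k + l), (i : ℕ) < k →
      condMutualInfo q X (tailOf Xh U i) Y ≤ R i.castSucc)
    (h2 : ∀ j : Fin (k + l), k ≤ (j : ℕ) →
      mutualInfo q (fun ω => (X ω, Y ω)) (tailOf Xh U j) ≤ R j.castSucc)
    (h3 : ∀ j : Fin (k + l), (j : ℕ) + 1 = k + l →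
      condMutualInfo q X (Xh j) U ≤ R (Fin.last (k + l)))
    (h4 : ∀ i : Fin (k + l), ∑ ω, q ω * d i (X ω) (Xh i ω) ≤ D i) :
    R ∈ infoRegion P d D (Fintype.card 𝒰) := by
  let f : Ω → Joint 𝒳 𝒴 𝒳h (Fintype.card 𝒰) := fun ω =>
    (X ω, Y ω, fun i => Xh i ω, Fintype.equivFin 𝒰 (U ω))
  refine ⟨prob q f, ⟨prob_nonneg hq f, (sum_prob q f).trans hq1⟩, ?_, ?_, ?_, ?_, ?_⟩
  · intro x y
    rw [prob_prob]
    exact hXY x y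
  · intro i hi
    rw [condMutualInfo_prob]
    refine (h1 i hi).trans' (le_of_eq ?_)
    refine condMutualInfo_congr q (fun _ _ => Iff.rfl) (fun ω ω' => ?_) (fun _ _ => Iff.rfl)
    simp [Joint.tailU, tailOf, f, Joint.Xhat, Joint.U]
  · intro i hi
    rw [mutualInfo_prob]
    refine (h2 i hi).trans' (le_of_eq ?_)
    refine mutualInfo_congr q (fun _ _ => Iff.rfl) (fun ω ω' => ?_)
    simp [Joint.tailU, tailOf, f, Joint.Xhat, Joint.U]
  · intro i hi
    rw [condMutualInfo_prob]
    refine (h3 i hi).trans' (le_of_eq ?_)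
    refine condMutualInfo_congr q (fun _ _ => Iff.rfl) (fun ω ω' => Iff.rfl) (fun _ _ => ?_)
    simp [f, Joint.U]
  · intro i
    rw [sum_prob_mul q f fun ω => d i (Joint.X ω) (Joint.Xhat i ω)]
    exact h4 i

end Membership

/-! ### Closedness of the single-letter region -/

theorem continuous_condMutualInfo {Ω α β γ : Type*} [Fintype Ω] [Fintype α] [Fintype β] [Fintype γ]
    (A : Ω → α) (B : Ω → β) (C : Ω → γ) :
    Continuous fun q : stdSimplex ℝ Ω => condMutualInfo q.1 A B C := by
  simp only [fun q : stdSimplex ℝ Ω => condMutualInfo_eq q.2.1 A B C]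
  have h1 := (continuous_entropy fun ω => (A ω, C ω)).comp
    (continuous_subtype_val (p := fun q => q ∈ stdSimplex ℝ Ω))
  have h2 := (continuous_entropy fun ω => (B ω, C ω)).comp
    (continuous_subtype_val (p := fun q => q ∈ stdSimplex ℝ Ω))
  have h3 := (continuous_entropy fun ω => (A ω, B ω, C ω)).comp
    (continuous_subtype_val (p := fun q => q ∈ stdSimplex ℝ Ω))
  have h4 := (continuous_entropy C).comp
    (continuous_subtype_val (p := fun q => q ∈ stdSimplex ℝ Ω))
  exact ((h1.add h2).sub h3).sub h4

theorem continuous_mutualInfo {Ω α β : Type*} [Fintype Ω] [Fintype α] [Fintype β]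
    (A : Ω → α) (B : Ω → β) :
    Continuous fun q : stdSimplex ℝ Ω => mutualInfo q.1 A B := by
  simp only [fun q : stdSimplex ℝ Ω => mutualInfo_eq q.2.1 A B]
  have h1 := (continuous_entropy A).comp
    (continuous_subtype_val (p := fun q => q ∈ stdSimplex ℝ Ω))
  have h2 := (continuous_entropy B).comp
    (continuous_subtype_val (p := fun q => q ∈ stdSimplex ℝ Ω))
  have h3 := (continuous_entropy fun ω => (A ω, B ω)).comp
    (continuous_subtype_val (p := fun q => q ∈ stdSimplex ℝ Ω))
  exact (h1.add h2).sub h3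

section Closed

variable {k l : ℕ} {𝒳 𝒴 : Type*} [Fintype 𝒳] [Fintype 𝒴]
    {𝒳h : Fin (k + l) → Type*} [∀ i, Fintype (𝒳h i)]

theorem isClosed_infoRegion_graph (P : 𝒳 × 𝒴 → ℝ) (d : (i : Fin (k + l)) → 𝒳 → 𝒳h i → ℝ)
    (m : ℕ) : IsClosed {z : (Fin (k + l + 1) → ℝ) × (Fin (k + l) → ℝ) |
      z.1 ∈ infoRegion P d z.2 m} := by
  classical
  let K := stdSimplex ℝ (Joint 𝒳 𝒴 𝒳h m)
  have : CompactSpace K := isCompact_iff_compactSpace.1 (isCompact_stdSimplex ℝ _)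
  let Z : Set (K × ((Fin (k + l + 1) → ℝ) × (Fin (k + l) → ℝ))) := {z |
    (∀ x y, prob z.1.1 (fun ω => (Joint.X ω, Joint.Y ω)) (x, y) = P (x, y)) ∧
    (∀ i : Fin (k + l), (i : ℕ) < k →
      condMutualInfo z.1.1 Joint.X (Joint.tailU i) Joint.Y ≤ z.2.1 i.castSucc) ∧
    (∀ j : Fin (k + l), k ≤ (j : ℕ) →
      mutualInfo z.1.1 (fun ω => (Joint.X ω, Joint.Y ω)) (Joint.tailU j) ≤ z.2.1 j.castSucc) ∧
    (∀ j : Fin (k + l), (j : ℕ) + 1 = k + l →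
      condMutualInfo z.1.1 Joint.X (Joint.Xhat j) Joint.U ≤ z.2.1 (Fin.last (k + l))) ∧
    (∀ i : Fin (k + l), ∑ ω, z.1.1 ω * d i (Joint.X ω) (Joint.Xhat i ω) ≤ z.2.2 i)}
  have hZ : IsClosed Z := by
    have hp : ∀ x y, Continuous fun z : K × ((Fin (k + l + 1) → ℝ) × (Fin (k + l) → ℝ)) =>
        prob z.1.1 (fun ω => (Joint.X ω, Joint.Y ω)) (x, y) := fun x y => by
      unfold prob
      fun_prop
    simp only [Z, Set.ofPred_and, Set.ofPred_forall]
    refine (isClosed_iInter fun x => isClosed_iInter fun y => isClosed_eq (hp x y)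
      continuous_const).inter <| (isClosed_iInter fun i => isClosed_iInter fun _ => isClosed_le
      ((continuous_condMutualInfo _ _ _).comp continuous_fst) (by fun_prop)).inter <|
      (isClosed_iInter fun i => isClosed_iInter fun _ => isClosed_le
      ((continuous_mutualInfo _ _).comp continuous_fst) (by fun_prop)).inter <|
      (isClosed_iInter fun i => isClosed_iInter fun _ => isClosed_le
      ((continuous_condMutualInfo _ _ _).comp continuous_fst) (by fun_prop)).inter <|
      isClosed_iInter fun i => isClosed_le (continuous_finsetSum _ fun ω _ =>
        ((continuous_apply ω).comp (continuous_subtype_val.comp continuous_fst)).mul_const _)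
        (by fun_prop)
  have : {z : (Fin (k + l + 1) → ℝ) × (Fin (k + l) → ℝ) | z.1 ∈ infoRegion P d z.2 m} =
      Prod.snd '' Z := by
    ext z
    constructor
    · rintro ⟨q, hq, h⟩
      exact ⟨(⟨q, hq⟩, z), h, rfl⟩
    · rintro ⟨⟨q, z'⟩, h, rfl⟩
      exact ⟨q.1, q.2, h⟩
  rw [this]
  exact isClosedMap_snd_of_compactSpace _ hZ

end Closed

/-! ### Bounding the alphabet of the auxiliary variable -/

theorem sum_subtype_of_support {κ : Type*} [Fintype κ] {p : κ → Prop} [DecidablePred p]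
    {f : κ → ℝ} (h : ∀ u, ¬ p u → f u = 0) : ∑ u : {u // p u}, f u = ∑ u, f u := by
  rw [← Fintype.sum_subtype_add_sum_subtype p f,
    Finset.sum_eq_zero (s := (univ : Finset {u // ¬ p u})) (fun u _ => h u u.2), add_zero]

theorem exists_sparse_weights {ι κ : Type*} [Fintype ι] [Fintype κ] (a : ι → κ → ℝ)
    (φ σ : κ → ℝ) (hσ : ∀ u, 0 ≤ σ u)
    (hspan : ∀ c : κ → ℝ, (∀ i, ∑ u, c u * a i u = 0) → ∑ u, c u * σ u = 0)
    (ha : ∀ i u, σ u = 0 → a i u = 0) (hφ : ∀ u, σ u = 0 → φ u = 0) :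
    ∃ w : κ → ℝ, (∀ u, 0 ≤ w u) ∧ (∀ i, ∑ u, w u * a i u = ∑ u, a i u) ∧
      ∑ u, w u * φ u ≤ ∑ u, φ u ∧ Fintype.card {u // w u ≠ 0} ≤ Fintype.card ι := by
  classical
  suffices H : ∀ n : ℕ, ∀ w : κ → ℝ, (∀ u, 0 ≤ w u) → (∀ u, w u ≠ 0 → 0 < σ u) →
      (∀ i, ∑ u, w u * a i u = ∑ u, a i u) → ∑ u, w u * φ u ≤ ∑ u, φ u →
      Fintype.card {u // w u ≠ 0} = n →
      ∃ w : κ → ℝ, (∀ u, 0 ≤ w u) ∧ (∀ i, ∑ u, w u * a i u = ∑ u, a i u) ∧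
      ∑ u, w u * φ u ≤ ∑ u, φ u ∧ Fintype.card {u // w u ≠ 0} ≤ Fintype.card ι by
    refine H _ (fun u => if σ u = 0 then 0 else 1) (fun u => ?_) (fun u hu => ?_) (fun i => ?_)
      (le_of_eq ?_) rfl
    · split_ifs <;> norm_num
    · refine (hσ u).lt_of_ne' fun h => hu (by simp [h])
    · refine Finset.sum_congr rfl fun u _ => ?_
      by_cases h : σ u = 0 <;> simp [h, ha]
    · refine Finset.sum_congr rfl fun u _ => ?_
      by_cases h : σ u = 0 <;> simp [h, hφ]
  intro n
  induction n using Nat.strong_induction_on with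
  | _ n ih =>
  intro w hw hwσ hwa hwφ hn
  by_cases hcard : Fintype.card {u // w u ≠ 0} ≤ Fintype.card ι
  · exact ⟨w, hw, hwa, hwφ, hcard⟩
  push Not at hcard
  obtain ⟨c, hc0, hcs, hca⟩ : ∃ c : κ → ℝ, c ≠ 0 ∧ (∀ u, w u = 0 → c u = 0) ∧
      ∀ i, ∑ u, c u * a i u = 0 := by
    let L : ({u // w u ≠ 0} → ℝ) →ₗ[ℝ] (ι → ℝ) :=
      { toFun := fun c i => ∑ u, c u * a i u.1
        map_add' := fun c c' => by ext i; simp [add_mul, Finset.sum_add_distrib]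
        map_smul' := fun r c => by ext i; simp [Finset.mul_sum, mul_assoc] }
    have hker := LinearMap.ker_ne_bot_of_finrank_lt (f := L) (by simpa using hcard)
    obtain ⟨c, hc, hc0⟩ := (Submodule.ne_bot_iff _).1 hker
    refine ⟨fun u => if h : w u ≠ 0 then c ⟨u, h⟩ else 0, fun h => hc0 ?_, fun u hu => by simp [hu],
      fun i => ?_⟩
    · ext u
      have := congrFun h u.1
      simpa [u.2] using this
    · have := congrFun (LinearMap.mem_ker.1 hc) i
      simp only [L, LinearMap.coe_mk, AddHom.coe_mk, Pi.zero_apply] at this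
      refine Eq.trans ?_ this
      rw [← sum_subtype_of_support (p := fun u => w u ≠ 0) fun u hu => by simp [hu]]
      refine Finset.sum_congr rfl fun u _ => ?_
      change (if h : w u.1 ≠ 0 then c ⟨u, h⟩ else 0) * _ = _
      rw [dif_pos u.2]
  obtain ⟨c, hc0, hcs, hca, hcφ⟩ : ∃ c : κ → ℝ, c ≠ 0 ∧ (∀ u, w u = 0 → c u = 0) ∧
      (∀ i, ∑ u, c u * a i u = 0) ∧ ∑ u, c u * φ u ≤ 0 := by
    rcases le_total (∑ u, c u * φ u) 0 with h | h
    · exact ⟨c, hc0, hcs, hca, h⟩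
    · refine ⟨-c, by simpa using hc0, fun u hu => by simp [hcs u hu], fun i => ?_, ?_⟩
      · simpa [Finset.sum_neg_distrib] using hca i
      · simpa [Finset.sum_neg_distrib] using h
  have hneg : (univ.filter fun u => c u < 0).Nonempty := by
    by_contra hne
    rw [Finset.not_nonempty_iff_eq_empty, Finset.filter_eq_empty_iff] at hne
    have hnn : ∀ u, 0 ≤ c u := fun u => not_lt.1 (hne (mem_univ u))
    have h0 := hspan c hca
    rw [Finset.sum_eq_zero_iff_of_nonneg fun u _ => mul_nonneg (hnn u) (hσ u)] at h0
    refine hc0 (funext fun u => ?_)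
    by_cases hu : w u = 0
    · exact hcs u hu
    · exact (mul_eq_zero.1 (h0 u (mem_univ u))).resolve_right (hwσ u hu).ne'
  obtain ⟨v, hv, hmin⟩ := Finset.exists_min_image _ (fun u => w u / -c u) hneg
  have hcv : c v < 0 := by simpa using hv
  have hwv : w v ≠ 0 := fun h => hcv.ne (hcs v h)
  set t := w v / -c v with ht
  have ht0 : 0 ≤ t := div_nonneg (hw v) (by linarith)
  refine ih (Fintype.card {u // w u + t * c u ≠ 0}) ?_ (fun u => w u + t * c u) (fun u => ?_)
    (fun u hu => hwσ u fun h => hu (by simp [h, hcs u h])) (fun i => ?_) ?_ rfl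
  · rw [← hn]
    rw [Fintype.card_subtype, Fintype.card_subtype]
    refine Finset.card_lt_card ⟨fun u => ?_, fun h => ?_⟩
    · simp only [Finset.mem_filter, Finset.mem_univ, true_and]
      exact fun hu h => hu (by simp [h, hcs u h])
    · have := h (by simpa using hwv : v ∈ univ.filter fun u => w u ≠ 0)
      simp only [Finset.mem_filter, Finset.mem_univ, true_and] at this
      refine this ?_
      rw [ht]
      field_simp [hcv.ne]
      ring
  · by_cases hu : c u < 0
    · have := hmin u (by simpa using hu)
      rw [le_div_iff₀ (by linarith)] at this
      linarith
    · have := mul_nonneg ht0 (not_lt.1 hu)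
      have := hw u
      linarith
  · simp only [add_mul, Finset.sum_add_distrib, mul_assoc, ← Finset.mul_sum, hca, hwa]
    simp
  · simp only [add_mul, Finset.sum_add_distrib, mul_assoc, ← Finset.mul_sum]
    have := mul_nonpos_of_nonneg_of_nonpos ht0 hcφ
    linarith

/-! ### Reweighting the auxiliary variable -/

section Reweight

variable {Ω α β γ κ : Type*} [Fintype Ω] {q : Ω → ℝ} {U : Ω → κ}
  {w : κ → ℝ}

theorem prob_reweight_of_factor {A : Ω → α} {a : α} {u : κ} (h : ∀ ω, A ω = a → U ω = u) :
    prob (fun ω => w (U ω) * q ω) A a = w u * prob q A a := by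
  classical
  unfold prob
  rw [Finset.mul_sum]
  refine Finset.sum_congr rfl fun ω hω => ?_
  simp only [h ω (by simpa using hω)]

theorem sum_reweight [Fintype κ] [DecidableEq κ] (f : Ω → ℝ) :
    ∑ ω, w (U ω) * q ω * f ω = ∑ u, w u * ∑ ω, if U ω = u then q ω * f ω else 0 := by
  classical
  simp only [Finset.mul_sum]
  rw [Finset.sum_comm]
  refine Finset.sum_congr rfl fun ω _ => ?_
  simp [mul_assoc]

/-- `mutualInfo` as an expectation of a fixed function, after reweighting. -/
theorem mutualInfo_reweight {A : Ω → α} {B : Ω → β}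
    (hA : ∀ a, prob (fun ω => w (U ω) * q ω) A a = prob q A a)
    (hB : ∀ ω ω', B ω = B ω' → U ω = U ω') :
    mutualInfo (fun ω => w (U ω) * q ω) A B = ∑ ω, w (U ω) * q ω * logb 2
      (prob q (fun ω' => (A ω', B ω')) (A ω, B ω) / (prob q A (A ω) * prob q B (B ω))) := by
  unfold mutualInfo
  refine Finset.sum_congr rfl fun ω _ => ?_
  by_cases hw : w (U ω) = 0
  · simp [hw]
  congr 2
  rw [hA, prob_reweight_of_factor (A := B) (u := U ω) fun ω' h => hB _ _ h,
    prob_reweight_of_factor (A := fun ω' => (A ω', B ω')) (u := U ω)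
      fun ω' h => hB _ _ (Prod.mk.inj h).2, mul_left_comm, mul_div_mul_left _ _ hw]

theorem condMutualInfo_reweight {A : Ω → α} {B : Ω → β} {C : Ω → γ}
    (hAC : ∀ a, prob (fun ω => w (U ω) * q ω) (fun ω => (A ω, C ω)) a =
      prob q (fun ω => (A ω, C ω)) a)
    (hC : ∀ a, prob (fun ω => w (U ω) * q ω) C a = prob q C a)
    (hB : ∀ ω ω', B ω = B ω' → U ω = U ω') :
    condMutualInfo (fun ω => w (U ω) * q ω) A B C = ∑ ω, w (U ω) * q ω * logb 2
      (prob q (fun ω' => (A ω', B ω', C ω')) (A ω, B ω, C ω) * prob q C (C ω) /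
      (prob q (fun ω' => (A ω', C ω')) (A ω, C ω) *
        prob q (fun ω' => (B ω', C ω')) (B ω, C ω))) := by
  unfold condMutualInfo
  refine Finset.sum_congr rfl fun ω _ => ?_
  by_cases hw : w (U ω) = 0
  · simp [hw]
  congr 2
  rw [hAC, hC, prob_reweight_of_factor (A := fun ω' => (B ω', C ω')) (u := U ω)
      fun ω' h => hB _ _ (Prod.mk.inj h).1,
    prob_reweight_of_factor (A := fun ω' => (A ω', B ω', C ω')) (u := U ω)
      fun ω' h => hB _ _ (Prod.mk.inj (Prod.mk.inj h).2).1, mul_left_comm, mul_assoc,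
      mul_div_mul_left _ _ hw]

theorem condMutualInfo_reweight_of_factor {A : Ω → α} {B : Ω → β} :
    condMutualInfo (fun ω => w (U ω) * q ω) A B U = ∑ ω, w (U ω) * q ω * logb 2
      (prob q (fun ω' => (A ω', B ω', U ω')) (A ω, B ω, U ω) * prob q U (U ω) /
      (prob q (fun ω' => (A ω', U ω')) (A ω, U ω) *
        prob q (fun ω' => (B ω', U ω')) (B ω, U ω))) := by
  unfold condMutualInfo
  refine Finset.sum_congr rfl fun ω _ => ?_
  by_cases hw : w (U ω) = 0
  · simp [hw]
  congr 2
  rw [prob_reweight_of_factor (A := fun ω' => (B ω', U ω')) (u := U ω)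
      fun ω' h => (Prod.mk.inj h).2,
    prob_reweight_of_factor (A := fun ω' => (A ω', U ω')) (u := U ω)
      fun ω' h => (Prod.mk.inj h).2,
    prob_reweight_of_factor (A := U) (u := U ω) fun ω' h => h,
    prob_reweight_of_factor (A := fun ω' => (A ω', B ω', U ω')) (u := U ω)
      fun ω' h => (Prod.mk.inj (Prod.mk.inj h).2).2, mul_assoc, mul_assoc,
      mul_div_mul_left _ _ hw, mul_left_comm, mul_left_comm _ (w (U ω)),
      mul_div_mul_left _ _ hw]

theorem prob_comp_congr [Fintype α] {q q' : Ω → ℝ} {T : Ω → α}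
    (h : ∀ v, prob q T v = prob q' T v) (g : α → β) (b : β) :
    prob q (fun ω => g (T ω)) b = prob q' (fun ω => g (T ω)) b := by
  rw [← prob_prob q T g, ← prob_prob q' T g, show prob q T = prob q' T from funext h]

end Reweight

section Cardinality

variable {k l : ℕ} {𝒳 𝒴 : Type*} [Fintype 𝒳] [Fintype 𝒴]
    {𝒳h : Fin (k + l) → Type*} [∀ i, Fintype (𝒳h i)]
    {P : 𝒳 × 𝒴 → ℝ} {d : (i : Fin (k + l)) → 𝒳 → 𝒳h i → ℝ} {D : Fin (k + l) → ℝ}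
    {R : Fin (k + l + 1) → ℝ}

/-- Values of the auxiliary variable that have weight zero can be dropped. -/
theorem mem_infoRegion_of_support {m : ℕ} {p : Fin m → Prop} [DecidablePred p]
    {q : Joint 𝒳 𝒴 𝒳h m → ℝ} (hq : ∀ ω, 0 ≤ q ω) (hq1 : ∑ ω, q ω = 1)
    (hp : ∀ ω, ¬ p (Joint.U ω) → q ω = 0)
    (hXY : ∀ x y, prob q (fun ω => (Joint.X ω, Joint.Y ω)) (x, y) = P (x, y))
    (h1 : ∀ i : Fin (k + l), (i : ℕ) < k →
      condMutualInfo q Joint.X (Joint.tailU i) Joint.Y ≤ R i.castSucc)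
    (h2 : ∀ j : Fin (k + l), k ≤ (j : ℕ) →
      mutualInfo q (fun ω => (Joint.X ω, Joint.Y ω)) (Joint.tailU j) ≤ R j.castSucc)
    (h3 : ∀ j : Fin (k + l), (j : ℕ) + 1 = k + l →
      condMutualInfo q Joint.X (Joint.Xhat j) Joint.U ≤ R (Fin.last (k + l)))
    (h4 : ∀ i : Fin (k + l), ∑ ω, q ω * d i (Joint.X ω) (Joint.Xhat i ω) ≤ D i) :
    R ∈ infoRegion P d D (Fintype.card {u // p u}) := by
  classical
  let Ω := {ω : Joint 𝒳 𝒴 𝒳h m // p (Joint.U ω)}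
  let q' : Ω → ℝ := fun ω => q ω.1
  have hq' : prob q' Subtype.val = q := by
    ext ω
    by_cases h : p (Joint.U ω)
    · rw [prob_eq_sum_ite, Finset.sum_eq_single ⟨ω, h⟩]
      · simp [q']
      · intro ω' _ hne
        rw [if_neg fun h => hne (Subtype.ext h)]
      · simp
    · rw [hp ω h, prob_eq_sum_ite]
      refine Finset.sum_eq_zero fun ω' _ => if_neg ?_
      rintro rfl
      exact h ω'.2
  refine mem_infoRegion_of_pmf (q := q') (fun ω => hq _)
    ((sum_subtype_of_support (f := q) hp).trans hq1)
    (fun ω => Joint.X ω.1) (fun ω => Joint.Y ω.1) (fun i ω => Joint.Xhat i ω.1)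
    (fun ω => (⟨Joint.U ω.1, ω.2⟩ : {u // p u})) ?_ ?_ ?_ ?_ ?_
  · intro x y
    rw [← hXY, ← hq', prob_prob]
  · intro i hi
    refine (h1 i hi).trans' (le_of_eq ?_)
    rw [← hq', condMutualInfo_prob]
    refine condMutualInfo_congr _ (fun _ _ => Iff.rfl) (fun ω ω' => ?_) (fun _ _ => Iff.rfl)
    simp [Joint.tailU, tailOf]
  · intro i hi
    refine (h2 i hi).trans' (le_of_eq ?_)
    rw [← hq', mutualInfo_prob]
    refine mutualInfo_congr _ (fun _ _ => Iff.rfl) (fun ω ω' => ?_)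
    simp [Joint.tailU, tailOf]
  · intro i hi
    refine (h3 i hi).trans' (le_of_eq ?_)
    rw [← hq', condMutualInfo_prob]
    refine condMutualInfo_congr _ (fun _ _ => Iff.rfl) (fun ω ω' => Iff.rfl) (fun _ _ => ?_)
    simp
  · intro i
    refine (h4 i).trans' (le_of_eq ?_)
    rw [← hq', sum_prob_mul q' _ fun ω => d i (Joint.X ω) (Joint.Xhat i ω)]

/-- The number of values of the auxiliary variable can be bounded. -/
theorem exists_mem_infoRegion_le (hl : 1 ≤ l) {m : ℕ} (h : R ∈ infoRegion P d D m) :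
    ∃ m' ≤ Fintype.card 𝒳 * Fintype.card 𝒴 * (∏ i, Fintype.card (𝒳h i)) + (k + l),
      R ∈ infoRegion P d D m' := by
  classical
  obtain ⟨q, ⟨hq, hq1⟩, hXY, h1, h2, h3, h4⟩ := h
  let e : Fin (k + l) := ⟨k + l - 1, by omega⟩
  let ψ : Fin (k + l) → Joint 𝒳 𝒴 𝒳h m → ℝ := fun i ω =>
    if (i : ℕ) < k then logb 2
      (prob q (fun ω' => (Joint.X ω', Joint.tailU i ω', Joint.Y ω'))
        (Joint.X ω, Joint.tailU i ω, Joint.Y ω) * prob q Joint.Y (Joint.Y ω) /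
      (prob q (fun ω' => (Joint.X ω', Joint.Y ω')) (Joint.X ω, Joint.Y ω) *
        prob q (fun ω' => (Joint.tailU i ω', Joint.Y ω')) (Joint.tailU i ω, Joint.Y ω)))
    else logb 2
      (prob q (fun ω' => ((Joint.X ω', Joint.Y ω'), Joint.tailU i ω'))
        ((Joint.X ω, Joint.Y ω), Joint.tailU i ω) /
        (prob q (fun ω' => (Joint.X ω', Joint.Y ω')) (Joint.X ω, Joint.Y ω) *
          prob q (Joint.tailU i) (Joint.tailU i ω)))
  let χ : Joint 𝒳 𝒴 𝒳h m → ℝ := fun ω => logb 2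
      (prob q (fun ω' => (Joint.X ω', Joint.Xhat e ω', Joint.U ω'))
        (Joint.X ω, Joint.Xhat e ω, Joint.U ω) * prob q Joint.U (Joint.U ω) /
      (prob q (fun ω' => (Joint.X ω', Joint.U ω')) (Joint.X ω, Joint.U ω) *
        prob q (fun ω' => (Joint.Xhat e ω', Joint.U ω')) (Joint.Xhat e ω, Joint.U ω)))
  let S : (Joint 𝒳 𝒴 𝒳h m → ℝ) → Fin m → ℝ := fun f u =>
    ∑ ω, if Joint.U ω = u then q ω * f ω else 0
  let T : Joint 𝒳 𝒴 𝒳h m → 𝒳 × 𝒴 × ((i : Fin (k + l)) → 𝒳h i) := fun ω =>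
    (ω.1, ω.2.1, ω.2.2.1)
  let a : (𝒳 × 𝒴 × ((i : Fin (k + l)) → 𝒳h i)) ⊕ Fin (k + l) → Fin m → ℝ :=
    Sum.elim (fun v => S fun ω => if T ω = v then 1 else 0) (fun i => S (ψ i))
  have hS0 : ∀ f u, prob q Joint.U u = 0 → S f u = 0 := by
    intro f u hu
    refine Finset.sum_eq_zero fun ω _ => ?_
    split_ifs with h
    · have := le_prob hq Joint.U ω
      rw [h, hu] at this
      simp [le_antisymm this (hq ω)]
    · rfl
  have hspan : ∀ c : Fin m → ℝ, (∀ i, ∑ u, c u * a i u = 0) →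
      ∑ u, c u * prob q Joint.U u = 0 := by
    intro c hc
    have : ∀ u, prob q Joint.U u = ∑ v, a (Sum.inl v) u := by
      intro u
      simp only [a, S, Sum.elim_inl]
      rw [Finset.sum_comm, prob_eq_sum_ite]
      refine Finset.sum_congr rfl fun ω _ => ?_
      split_ifs <;> simp
    simp only [this, Finset.mul_sum]
    rw [Finset.sum_comm]
    exact Finset.sum_eq_zero fun v _ => hc (Sum.inl v)
  have ha0 : ∀ i u, prob q Joint.U u = 0 → a i u = 0 := by
    rintro (v | i) u hu
    · exact hS0 _ u hu
    · exact hS0 _ u hu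
  obtain ⟨w, hw, hwa, hwφ, hcard⟩ := exists_sparse_weights a (S χ) (prob q Joint.U)
    (prob_nonneg hq _) hspan ha0 (hS0 χ)
  have hsum : ∀ f : Joint 𝒳 𝒴 𝒳h m → ℝ,
      ∑ ω, w (Joint.U ω) * q ω * f ω = ∑ u, w u * S f u := fun f => sum_reweight f
  have hsum1 : ∀ f : Joint 𝒳 𝒴 𝒳h m → ℝ, ∑ ω, q ω * f ω = ∑ u, S f u := fun f => by
    simpa using sum_reweight (w := fun _ : Fin m => 1) (q := q) (U := Joint.U) f
  have hT : ∀ v, prob (fun ω => w (Joint.U ω) * q ω) T v = prob q T v := by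
    intro v
    have h := hwa (Sum.inl v)
    simp only [a, Sum.elim_inl] at h
    rw [← hsum, ← hsum1] at h
    simp only [mul_ite, mul_one, mul_zero] at h
    rw [prob_eq_sum_ite, prob_eq_sum_ite]
    convert h
  have hsumT : ∀ g : 𝒳 × 𝒴 × ((i : Fin (k + l)) → 𝒳h i) → ℝ,
      ∑ ω, w (Joint.U ω) * q ω * g (T ω) = ∑ ω, q ω * g (T ω) := by
    intro g
    rw [← sum_prob_mul (fun ω => w (Joint.U ω) * q ω) T g, ← sum_prob_mul q T g]
    simp only [hT]
  have hUtail : ∀ i : Fin (k + l), ∀ ω ω' : Joint 𝒳 𝒴 𝒳h m,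
      Joint.tailU i ω = Joint.tailU i ω' → Joint.U ω = Joint.U ω' :=
    fun i ω ω' h => (Prod.mk.inj h).2
  refine ⟨_, hcard.trans (le_of_eq ?_), mem_infoRegion_of_support (p := fun u => w u ≠ 0)
    (q := fun ω => w (Joint.U ω) * q ω) (fun ω => mul_nonneg (hw _) (hq _)) ?_ ?_ ?_ ?_ ?_ ?_ ?_⟩
  · simp [mul_assoc]
  · simpa [hq1] using hsumT fun _ => 1
  · intro ω h
    simp only [not_not] at h
    simp [h]
  · intro x y
    rw [← hXY]
    exact prob_comp_congr hT (fun v => (v.1, v.2.1)) (x, y)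
  · intro i hi
    refine (h1 i hi).trans' (le_of_eq ?_)
    rw [condMutualInfo_reweight (A := Joint.X) (C := Joint.Y)
      (prob_comp_congr hT fun v => (v.1, v.2.1)) (prob_comp_congr hT fun v => v.2.1) (hUtail i)]
    have := hwa (Sum.inr i)
    simp only [a, Sum.elim_inr] at this
    rw [← hsum, ← hsum1] at this
    simp only [ψ, if_pos hi] at this
    exact this
  · intro i hi
    refine (h2 i hi).trans' (le_of_eq ?_)
    rw [mutualInfo_reweight (A := fun ω => (Joint.X ω, Joint.Y ω))
      (prob_comp_congr hT fun v => (v.1, v.2.1)) (hUtail i)]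
    have := hwa (Sum.inr i)
    simp only [a, Sum.elim_inr] at this
    rw [← hsum, ← hsum1] at this
    simp only [ψ, if_neg hi.not_gt] at this
    exact this
  · intro i hi
    obtain rfl : i = e := Fin.ext (by simp only [e]; omega)
    refine (h3 e hi).trans' ?_
    rw [condMutualInfo_reweight_of_factor]
    rw [← hsum, ← hsum1] at hwφ
    exact hwφ
  · intro i
    refine (h4 i).trans' (le_of_eq ?_)
    exact hsumT fun v => d i v.1 (v.2.2 i)

end Cardinality

theorem prob_self {Ω : Type*} [Fintype Ω] (q : Ω → ℝ) (a : Ω) : prob q (fun ω => ω) a = q a := by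
  classical
  rw [prob_eq_sum_ite]
  simp

theorem entropy_pair_self {Ω σ : Type*} [Fintype Ω] (q : Ω → ℝ) (S : Ω → σ) :
    entropy q (fun ω => (S ω, ω)) = entropy q (fun ω => ω) :=
  entropy_congr fun w w' => by
    simp only [Prod.mk.injEq, and_iff_right_iff_imp]
    rintro rfl; rfl

/-! ### Product distributions -/

section Product

variable {Ω α : Type*} [Fintype Ω] {q : Ω → ℝ} {n : ℕ}

theorem sum_pi_prod (f : Fin n → Ω → ℝ) :
    ∑ ω : Fin n → Ω, ∏ t, f t (ω t) = ∏ t, ∑ a, f t a := by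
  classical
  rw [Finset.prod_univ_sum, Fintype.piFinset_univ]

theorem sum_pi_prod_eq_one (hq1 : ∑ ω, q ω = 1) : ∑ ω : Fin n → Ω, ∏ t, q (ω t) = 1 := by
  rw [sum_pi_prod (fun _ => q)]
  simp [hq1]

theorem prob_pi (A : Ω → α) (a : Fin n → α) :
    prob (fun ω : Fin n → Ω => ∏ t, q (ω t)) (fun ω t => A (ω t)) a = ∏ t, prob q A (a t) := by
  classical
  simp only [prob_eq_sum_ite]
  rw [← sum_pi_prod (fun t ω => if A ω = a t then q ω else 0)]
  refine Finset.sum_congr rfl fun ω _ => ?_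
  by_cases h : (fun t => A (ω t)) = a
  · rw [if_pos h]
    refine Finset.prod_congr rfl fun t _ => ?_
    rw [if_pos (congrFun h t)]
  · rw [if_neg h]
    obtain ⟨t, ht⟩ := Function.ne_iff.1 h
    exact (Finset.prod_eq_zero (mem_univ t) (if_neg ht)).symm

theorem sum_pi_mul_apply (hq1 : ∑ ω, q ω = 1) (t : Fin n) (f : Ω → ℝ) :
    ∑ ω : Fin n → Ω, (∏ s, q (ω s)) * f (ω t) = ∑ a, q a * f a := by
  classical
  have : ∀ ω : Fin n → Ω, (∏ s, q (ω s)) * f (ω t) =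
      ∏ s, q (ω s) * (if s = t then f (ω s) else 1) := by
    intro ω
    rw [Finset.prod_mul_distrib]
    simp
  simp only [this]
  rw [sum_pi_prod (fun s a => q a * (if s = t then f a else 1))]
  rw [Finset.prod_eq_single t]
  · simp
  · intro s _ hs
    simp [hs, hq1]
  · simp

theorem prob_pi_apply (hq1 : ∑ ω, q ω = 1) (t : Fin n) (A : Ω → α) (a : α) :
    prob (fun ω : Fin n → Ω => ∏ t, q (ω t)) (fun ω => A (ω t)) a = prob q A a := by
  classical
  rw [prob_eq_sum_ite, prob_eq_sum_ite]
  simpa using sum_pi_mul_apply hq1 t fun ω => if A ω = a then 1 else 0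

theorem entropy_pi (hq : ∀ ω, 0 ≤ q ω) (hq1 : ∑ ω, q ω = 1) (A : Ω → α) :
    entropy (fun ω : Fin n → Ω => ∏ t, q (ω t)) (fun ω t => A (ω t)) = n * entropy q A := by
  have h : entropy (fun ω : Fin n → Ω => ∏ t, q (ω t)) (fun ω t => A (ω t)) =
      -∑ ω : Fin n → Ω, ∑ t, (∏ t, q (ω t)) * logb 2 (prob q A (A (ω t))) := by
    unfold entropy
    congr 1
    refine Finset.sum_congr rfl fun ω _ => ?_
    rw [← Finset.mul_sum]
    by_cases h0 : ∏ t, q (ω t) = 0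
    · simp [h0]
    congr 1
    rw [prob_pi, logb, log_prod]
    · simp [logb, Finset.sum_div]
    · intro t _
      have : q (ω t) ≠ 0 := fun h => h0 (Finset.prod_eq_zero (mem_univ t) h)
      exact (prob_pos hq A ((hq _).lt_of_ne' this)).ne'
  rw [h, Finset.sum_comm]
  have := fun t : Fin n => sum_pi_mul_apply hq1 t fun a => logb 2 (prob q A (A a))
  simp only [this]
  simp [entropy]

end Product

/-! ### Sampling a uniform time index -/

section TimeSharing

variable {Ω α : Type*} [Fintype Ω] {Q : Ω → ℝ} {n : ℕ}

theorem entropy_timeSharing (hn : 0 < n) (hQ : ∀ ω, 0 ≤ Q ω) (hQ1 : ∑ ω, Q ω = 1)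
    (A : Fin n × Ω → α)
    (hA : ∀ z z', A z = A z' → z.1 = z'.1) :
    entropy (fun z : Fin n × Ω => (1 / (n : ℝ)) * Q z.2) A =
      logb 2 n + 1 / (n : ℝ) * ∑ t, entropy Q (fun ω => A (t, ω)) := by
  classical
  have hn' : (0 : ℝ) < n := by exact_mod_cast hn
  have hp : ∀ t ω, prob (fun z : Fin n × Ω => (1 / (n : ℝ)) * Q z.2) A (A (t, ω)) =
      1 / (n : ℝ) * prob Q (fun ω => A (t, ω)) (A (t, ω)) := by
    intro t ω
    rw [prob_eq_sum_ite, prob_eq_sum_ite, Fintype.sum_prod_type, Finset.sum_eq_single t]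
    · rw [Finset.mul_sum]
      simp
    · intro s _ hs
      refine Finset.sum_eq_zero fun ω' _ => if_neg fun h => hs (hA _ _ h)
    · simp
  unfold entropy
  rw [Fintype.sum_prod_type]
  have : ∀ t : Fin n, ∑ ω, (1 / (n : ℝ)) * Q ω * logb 2
      (prob (fun z : Fin n × Ω => (1 / (n : ℝ)) * Q z.2) A (A (t, ω))) =
      1 / (n : ℝ) * (∑ ω, Q ω * logb 2 (prob Q (fun ω => A (t, ω)) (A (t, ω))) - logb 2 n) := by
    intro t
    have : logb 2 n = ∑ ω, Q ω * logb 2 n := by rw [← Finset.sum_mul, hQ1, one_mul]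
    rw [this, ← Finset.sum_sub_distrib, Finset.mul_sum]
    refine Finset.sum_congr rfl fun ω _ => ?_
    rcases (hQ ω).eq_or_lt with h | h
    · simp [← h]
    have := prob_pos hQ (fun ω => A (t, ω)) h
    rw [hp, logb_mul (by positivity) this.ne', one_div, logb_inv]
    ring
  simp only [this]
  rw [← Finset.mul_sum, Finset.sum_sub_distrib, Finset.sum_neg_distrib]
  simp
  field_simp
  ring

theorem prob_timeSharing (hn : 0 < n) (A : Fin n × Ω → α) (a : α) (p : ℝ)
    (h : ∀ t, prob Q (fun ω => A (t, ω)) a = p) :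
    prob (fun z : Fin n × Ω => (1 / (n : ℝ)) * Q z.2) A a = p := by
  classical
  have hn' : (0 : ℝ) < n := by exact_mod_cast hn
  simp only [prob_eq_sum_ite] at h ⊢
  rw [Fintype.sum_prod_type]
  have : ∀ t : Fin n, (∑ ω, if A (t, ω) = a then 1 / (n : ℝ) * Q ω else 0) = 1 / (n : ℝ) * p := by
    intro t
    rw [← h t, Finset.mul_sum]
    simp
  simp only [this]
  simp
  field_simp

end TimeSharing

/-! ### The chain rule along a sequence -/

section Chain

variable {σ 𝒲 : Type*} {n : ℕ}

/-- The first `t` letters of a sequence. -/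
def past (t : ℕ) (w : Fin n → 𝒲) (s : Fin n) : Option 𝒲 := if (s : ℕ) < t then some (w s) else none

theorem past_eq_iff {t : ℕ} {w w' : Fin n → 𝒲} :
    past t w = past t w' ↔ ∀ s : Fin n, (s : ℕ) < t → w s = w' s := by
  rw [funext_iff]
  refine forall_congr' fun s => ?_
  by_cases h : (s : ℕ) < t <;> simp [past, h]

theorem sum_entropy_past [Fintype 𝒲] (Q : (Fin n → 𝒲) → ℝ) (S : (Fin n → 𝒲) → σ) :
    ∑ t : Fin n, (entropy Q (fun w => (w t, S w, past t w)) - entropy Q fun w => (S w, past t w)) =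
      entropy Q (fun w => (S w, w)) - entropy Q S := by
  have h : ∀ t : Fin n, entropy Q (fun w => (w t, S w, past t w)) =
      entropy Q fun w => (S w, past (t + 1) w) := by
    intro t
    refine entropy_congr fun w w' => ?_
    simp only [Prod.mk.injEq, past_eq_iff]
    constructor
    · rintro ⟨h1, h2, h3⟩
      refine ⟨h2, fun s hs => ?_⟩
      rcases Nat.lt_succ_iff_lt_or_eq.1 hs with h | h
      · exact h3 s h
      · rw [Fin.ext h]; exact h1
    · rintro ⟨h1, h2⟩
      exact ⟨h2 t (by omega), h1, fun s hs => h2 s (by omega)⟩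
  simp only [h]
  rw [Fin.sum_univ_eq_sum_range (fun t => entropy Q (fun w => (S w, past (t + 1) w)) -
    entropy Q fun w => (S w, past t w)) n,
    Finset.sum_range_sub (fun t => entropy Q fun w => (S w, past t w))]
  congr 1
  · refine entropy_congr fun w w' => ?_
    simp only [Prod.mk.injEq, past_eq_iff]
    refine and_congr_right fun _ => ⟨fun h => funext fun s => h s s.2, fun h s _ => congrFun h s⟩
  · refine entropy_congr fun w w' => ?_
    simp [past_eq_iff]

end Chain

/-! ### The converse -/

section Converse

variable {k l n : ℕ} {𝒳 𝒴 : Type*} {𝒳h : Fin (k + l) → Type*}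
    {P : 𝒳 × 𝒴 → ℝ} {d : (i : Fin (k + l)) → 𝒳 → 𝒳h i → ℝ} {D : Fin (k + l) → ℝ}
    {R : Fin (k + l + 1) → ℝ} {M : Fin (k + l + 1) → ℕ}

theorem sideView_congr {σ : Type*} {y y' : σ} {i j : ℕ} (hij : j ≤ i) (hy : j < k → y = y') :
    sideView k y i = sideView k y' i := by
  unfold sideView
  split_ifs with h
  · rw [hy (by omega)]
  · rfl

theorem Code.msg_congr (c : Code k l n 𝒳 𝒴 𝒳h M) {x x' : Fin n → 𝒳} {y y' : Fin n → 𝒴} {j : ℕ}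
    (hj : j < k + l) (hy : j < k → y = y') (hm : c.msg x y j hj = c.msg x' y' j hj) {i : ℕ}
    (hji : j ≤ i) (hi : i < k + l) : c.msg x y i hi = c.msg x' y' i hi := by
  induction i, hji using Nat.le_induction with
  | base => exact hm
  | succ i hji ih => rw [Code.msg, Code.msg, ih (by omega), sideView_congr hji hy]

theorem Code.recon_congr (c : Code k l n 𝒳 𝒴 𝒳h M) {x x' : Fin n → 𝒳} {y y' : Fin n → 𝒴} {j : ℕ}
    (hj : j < k + l) (hy : j < k → y = y') (hm : c.msg x y j hj = c.msg x' y' j hj)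
    {i : Fin (k + l)} (hji : j ≤ i)
    (hd : (i : ℕ) + 1 = k + l → c.direct x y = c.direct x' y') :
    c.recon x y i = c.recon x' y' i := by
  unfold Code.recon
  rw [c.msg_congr hj hy hm hji, sideView_congr hji hy]
  congr 1
  unfold directView
  split_ifs with h
  · rw [hd h]
  · rfl

variable [Fintype 𝒳] [Fintype 𝒴]

theorem sum_sum_eq_sum_pair (f : (Fin n → 𝒳) → (Fin n → 𝒴) → ℝ) :
    ∑ x, ∑ y, f x y = ∑ w : Fin n → 𝒳 × 𝒴, f (fun t => (w t).1) (fun t => (w t).2) := by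
  rw [← Fintype.sum_prod_type']
  exact (Fintype.sum_equiv (Equiv.arrowProdEquivProdArrow (Fin n) (fun _ => 𝒳) (fun _ => 𝒴)) _ _
    fun w => rfl).symm

/-- Every code gives a point of the single-letter region. -/
theorem Code.exists_mem_infoRegion [∀ i, Fintype (𝒳h i)] (hP : P ∈ stdSimplex ℝ (𝒳 × 𝒴))
    (hl : 1 ≤ l) (hn : 0 < n)
    (c : Code k l n 𝒳 𝒴 𝒳h M) (hM : ∀ i, (M i : ℝ) ≤ (2 : ℝ) ^ ((n : ℝ) * R i))
    (hc : ∀ i, c.expDistortion P d i ≤ D i) : ∃ m, R ∈ infoRegion P d D m := by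
  have hn' : (0 : ℝ) < n := by exact_mod_cast hn
  have he : k + l - 1 < k + l := by omega
  let e : Fin (k + l) := ⟨k + l - 1, he⟩
  let W := Fin n → 𝒳 × 𝒴
  let Q : W → ℝ := fun w => ∏ t, P (w t)
  have hQ : ∀ w, 0 ≤ Q w := fun w => Finset.prod_nonneg fun t _ => hP.1 _
  have hQ1 : ∑ w, Q w = 1 := sum_pi_prod_eq_one hP.2
  let T : (i : ℕ) → (hi : i < k + l) → W → Fin (M ⟨i, by omega⟩) := fun i hi w =>
    c.msg (fun t => (w t).1) (fun t => (w t).2) i hi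
  let T' : W → Fin (M (Fin.last (k + l))) := fun w =>
    c.direct (fun t => (w t).1) (fun t => (w t).2)
  let Yn : W → Fin n → 𝒴 := fun w t => (w t).2
  let q : Fin n × W → ℝ := fun z => (1 / (n : ℝ)) * Q z.2
  let X : Fin n × W → 𝒳 := fun z => (z.2 z.1).1
  let Y : Fin n × W → 𝒴 := fun z => (z.2 z.1).2
  let Xh : (i : Fin (k + l)) → Fin n × W → 𝒳h i := fun i z =>
    c.recon (fun t => (z.2 t).1) (fun t => (z.2 t).2) i z.1
  let U : Fin n × W → Fin n × Fin (M ⟨k + l - 1, by omega⟩) × (Fin n → Option (𝒳 × 𝒴)) :=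
    fun z => (z.1, T _ he z.2, past z.1 z.2)
  have hq : ∀ z, 0 ≤ q z := fun z => mul_nonneg (by positivity) (hQ _)
  have hq1 : ∑ z, q z = 1 := by
    simp only [q, Fintype.sum_prod_type, ← Finset.mul_sum, hQ1]
    simp [hn'.ne']
  have hXY : ∀ x y, prob q (fun z => (X z, Y z)) (x, y) = P (x, y) := by
    intro x y
    refine prob_timeSharing hn _ _ _ fun t => ?_
    exact (prob_pi_apply hP.2 t (fun a => a) (x, y)).trans (prob_self P (x, y))
  have hY : ∀ y, prob q Y y = prob P Prod.snd y := by
    intro y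
    exact prob_timeSharing hn _ _ _ fun t => prob_pi_apply hP.2 t Prod.snd y
  have hHXY : entropy q (fun z => (X z, Y z)) = entropy P (fun a => a) :=
    entropy_eq_of_prob_eq fun a => (hXY a.1 a.2).trans (prob_self P a).symm
  have hHY : entropy q Y = entropy P Prod.snd := entropy_eq_of_prob_eq hY
  have hHW : entropy Q (fun w => w) = n * entropy P (fun a => a) := entropy_pi hP.1 hP.2 fun a => a
  have hHYn : entropy Q Yn = n * entropy P Prod.snd := entropy_pi hP.1 hP.2 Prod.snd
  have hinv : ∀ a : ℝ, a = n * (1 / (n : ℝ) * a) := fun a => by field_simp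
  have hnonempty : Nonempty W := by
    by_contra h
    rw [not_nonempty_iff] at h
    simp at hQ1
  obtain ⟨w₀⟩ := hnonempty
  have hrate : ∀ i, Fin (M i) → logb 2 (M i) ≤ n * R i := by
    intro i z
    have : (0 : ℝ) < M i := by exact_mod_cast z.pos
    rw [logb_le_iff_le_rpow (by norm_num) this]
    exact hM i
  have hU : ∀ z z', U z = U z' → z.1 = z'.1 := fun z z' h => (Prod.mk.inj h).1
  have htail : ∀ i z z', tailOf Xh U i z = tailOf Xh U i z' → z.1 = z'.1 :=
    fun i z z' h => hU z z' (Prod.mk.inj h).2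
  have htailT : ∀ (i : Fin (k + l)) (t : Fin n) (w w' : W), T i i.2 w = T i i.2 w' →
      ((i : ℕ) < k → Yn w = Yn w') → past t w = past t w' →
      tailOf Xh U i (t, w) = tailOf Xh U i (t, w') := by
    intro i t w w' hT hYn hpast
    refine Prod.ext (funext fun j => ?_) ?_
    · exact congrFun (c.recon_congr i.2 hYn hT j.2.1 fun h => absurd h j.2.2.ne) t
    · refine Prod.ext rfl (Prod.ext ?_ hpast)
      exact c.msg_congr i.2 hYn hT (by omega) he
  refine ⟨_, mem_infoRegion_of_pmf hq hq1 X Y Xh U hXY ?_ ?_ ?_ ?_⟩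
  · intro i hi
    rw [condMutualInfo_eq hq, hHXY, hHY,
      entropy_timeSharing hn hQ hQ1 _ fun z z' h => htail i z z' (Prod.mk.inj h).1,
      entropy_timeSharing hn hQ hQ1 _ fun z z' h => htail i z z' (Prod.mk.inj (Prod.mk.inj h).2).1]
    have h1 := sum_entropy_past Q fun w => (T i i.2 w, Yn w)
    have h2 : ∀ t : Fin n, entropy Q (fun w => (w t, (T i i.2 w, Yn w), past t w)) -
        entropy Q (fun w => ((T i i.2 w, Yn w), past t w)) ≤
        entropy Q (fun w => (X (t, w), tailOf Xh U i (t, w), Y (t, w))) -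
        entropy Q (fun w => (tailOf Xh U i (t, w), Y (t, w))) := by
      intro t
      refine le_trans (le_of_eq ?_) (entropy_sub_le_of_factor hQ (fun w => X (t, w))
        (B := fun w => ((T i i.2 w, Yn w), past t w)) ?_)
      · congr 1
        refine entropy_congr fun w w' => ?_
        simp only [Prod.ext_iff, X]
        constructor
        · rintro ⟨⟨h1, h2⟩, h⟩; exact ⟨h1, h⟩
        · rintro ⟨h1, h⟩; exact ⟨⟨h1, congrFun h.1.2 t⟩, h⟩
      · intro w w' h
        simp only [Prod.mk.injEq] at h
        exact Prod.ext (htailT i t w w' h.1.1 (fun _ => h.1.2) h.2) (congrFun h.1.2 t)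
    have h3 := Finset.sum_le_sum fun t (_ : t ∈ univ) => h2 t
    rw [h1, Finset.sum_sub_distrib] at h3
    have h4 := entropy_prod_le hQ hQ1 (T i i.2) Yn
    have h5 := entropy_le_logb_card hQ hQ1 (T i i.2)
    have h6 := h5.trans (hrate i.castSucc (T i i.2 w₀))
    rw [entropy_pair_self, hHW] at h3
    refine le_of_mul_le_mul_left ?_ hn'
    simp only [mul_sub, mul_add, ← hinv]
    linarith
  · intro i hi
    rw [mutualInfo_eq hq, hHXY, entropy_timeSharing hn hQ hQ1 _ (htail i),
      entropy_timeSharing hn hQ hQ1 _ fun z z' h => htail i z z' (Prod.mk.inj h).2]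
    have h1 := sum_entropy_past Q (T i i.2)
    have h2 : ∀ t : Fin n, entropy Q (fun w => (w t, T i i.2 w, past t w)) -
        entropy Q (fun w => (T i i.2 w, past t w)) ≤
        entropy Q (fun w => ((X (t, w), Y (t, w)), tailOf Xh U i (t, w))) -
        entropy Q (fun w => tailOf Xh U i (t, w)) := by
      intro t
      refine entropy_sub_le_of_factor hQ (fun w => w t)
        (B := fun w => (T i i.2 w, past t w)) ?_
      intro w w' h
      simp only [Prod.mk.injEq] at h
      exact htailT i t w w' h.1 (fun h => absurd h hi.not_gt) h.2
    have h3 := Finset.sum_le_sum fun t (_ : t ∈ univ) => h2 t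
    rw [h1, Finset.sum_sub_distrib] at h3
    have h5 := entropy_le_logb_card hQ hQ1 (T i i.2)
    have h6 := h5.trans (hrate i.castSucc (T i i.2 w₀))
    rw [entropy_pair_self, hHW] at h3
    refine le_of_mul_le_mul_left ?_ hn'
    simp only [mul_sub, mul_add, ← hinv]
    linarith
  · intro i hi
    obtain rfl : i = e := Fin.ext (by simp only [e]; omega)
    rw [condMutualInfo_eq hq, entropy_timeSharing hn hQ hQ1 _ hU,
      entropy_timeSharing hn hQ hQ1 _ fun z z' h => hU z z' (Prod.mk.inj h).2,
      entropy_timeSharing hn hQ hQ1 _ fun z z' h => hU z z' (Prod.mk.inj h).2,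
      entropy_timeSharing hn hQ hQ1 _ fun z z' h => hU z z' (Prod.mk.inj (Prod.mk.inj h).2).2]
    have h1 := sum_entropy_past Q (T e e.2)
    have h1' := sum_entropy_past Q fun w => (T e e.2 w, T' w)
    have hU2 : ∀ t : Fin n, entropy Q (fun w => U (t, w)) =
        entropy Q (fun w => (T e e.2 w, past t w)) := fun t =>
      entropy_congr fun w w' => by simp [U, e]
    have hU3 : ∀ t : Fin n, entropy Q (fun w => (w t, U (t, w))) =
        entropy Q (fun w => (w t, T e e.2 w, past t w)) := fun t =>
      entropy_congr fun w w' => by simp [U, e]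
    have h2 : ∀ t : Fin n, entropy Q (fun w => (w t, (T e e.2 w, T' w), past t w)) -
        entropy Q (fun w => ((T e e.2 w, T' w), past t w)) ≤
        entropy Q (fun w => (w t, Xh e (t, w), U (t, w))) -
        entropy Q (fun w => (Xh e (t, w), U (t, w))) := by
      intro t
      refine entropy_sub_le_of_factor hQ (fun w => w t)
        (B := fun w => ((T e e.2 w, T' w), past t w)) ?_
      intro w w' h
      simp only [Prod.mk.injEq] at h
      refine Prod.ext (congrFun (c.recon_congr e.2 (fun h => ?_) h.1.1 le_rfl fun _ => h.1.2) t) ?_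
      · simp only [e] at h; omega
      · exact Prod.ext rfl (Prod.ext h.1.1 h.2)
    have h2' : ∀ t : Fin n, entropy Q (fun w => (w t, Xh e (t, w), U (t, w))) -
        entropy Q (fun w => (X (t, w), Xh e (t, w), U (t, w))) ≤
        entropy Q (fun w => (w t, U (t, w))) - entropy Q (fun w => (X (t, w), U (t, w))) := by
      intro t
      refine le_trans (le_of_eq ?_) ((entropy_sub_le_of_factor hQ (fun w => Y (t, w))
        (B := fun w => (X (t, w), Xh e (t, w), U (t, w))) (C := fun w => (X (t, w), U (t, w)))
        ?_).trans (le_of_eq ?_))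
      · congr 1
        refine entropy_congr fun w w' => ?_
        simp only [Prod.ext_iff, X, Y]
        tauto
      · intro w w' h
        simp only [Prod.mk.injEq] at h
        exact Prod.ext h.1 h.2.2
      · congr 1
        refine entropy_congr fun w w' => ?_
        simp only [Prod.ext_iff, X, Y]
        tauto
    have h3 := Finset.sum_le_sum fun t (_ : t ∈ univ) => h2 t
    have h3' := Finset.sum_le_sum fun t (_ : t ∈ univ) => h2' t
    simp only [hU2, hU3] at h3' ⊢
    rw [h1', Finset.sum_sub_distrib] at h3
    rw [Finset.sum_sub_distrib] at h1
    rw [Finset.sum_sub_distrib, Finset.sum_sub_distrib] at h3'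
    have h4 := entropy_prod_le hQ hQ1 (T e e.2) T'
    have h5 := entropy_le_logb_card hQ hQ1 T'
    have h6 := hrate (Fin.last (k + l)) (T' w₀)
    rw [entropy_pair_self] at h1 h3
    refine le_of_mul_le_mul_left ?_ hn'
    simp only [mul_sub, mul_add, ← hinv]
    linarith
  · intro i
    refine (hc i).trans' (le_of_eq ?_)
    unfold Code.expDistortion
    rw [sum_sum_eq_sum_pair]
    simp only [q, Fintype.sum_prod_type]
    rw [Finset.sum_comm]
    refine Finset.sum_congr rfl fun w _ => ?_
    simp only [Finset.mul_sum]
    refine Finset.sum_congr rfl fun t _ => ?_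
    simp only [Q, X, Xh]
    ring

end Converse

/-! ### Covering by codebooks -/

section Covering

open Classical in
/-- A codebook that hits every set of a family of sets of probability at least `p`, and that has few
words in each set of a second family of sets of probability at most `r`. -/
theorem exists_codebook {B ι κ : Type*} [Fintype B] [Fintype ι] [Fintype κ] {μ : B → ℝ}
    (hμ : ∀ b, 0 ≤ μ b) (hμ1 : ∑ b, μ b = 1) (G : ι → B → Prop) (p : ℝ)
    (hG : ∀ w, p ≤ ∑ b, if G w b then μ b else 0) (L : κ → B → Prop) {r : ℝ}
    (hL : ∀ y, (∑ b, if L y b then μ b else 0) ≤ r) (M : ℕ) (K : ℝ)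
    (h : Fintype.card ι * (1 - p) ^ M + Fintype.card κ * exp (2 * r * M - K) < 1) :
    ∃ c : Fin M → B, (∀ w, ∃ m, G w (c m)) ∧
      ∀ y, ((univ.filter fun m => L y (c m)).card : ℝ) ≤ K := by
  by_contra hcon
  push Not at hcon
  have h1 : ∀ c : Fin M → B, 1 ≤ ∑ w, ∏ m, (if G w (c m) then (0 : ℝ) else 1) +
      ∑ y, exp (-K) * ∏ m, exp (if L y (c m) then 1 else 0) := by
    intro c
    have n1 : ∀ w ∈ univ, 0 ≤ ∏ m, (if G w (c m) then (0 : ℝ) else 1) := fun w _ =>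
      Finset.prod_nonneg fun m _ => by split_ifs <;> norm_num
    have n2 : ∀ y ∈ univ, 0 ≤ exp (-K) * ∏ m, exp (if L y (c m) then 1 else 0) := fun y _ =>
      mul_nonneg (exp_pos _).le (Finset.prod_nonneg fun m _ => (exp_pos _).le)
    by_cases hc : ∀ w, ∃ m, G w (c m)
    · obtain ⟨y, hy⟩ := hcon c hc
      have := Finset.single_le_sum n2 (mem_univ y)
      have h2 : 1 ≤ exp (-K) * ∏ m, exp (if L y (c m) then 1 else 0) := by
        rw [← exp_sum, ← exp_add, Finset.sum_boole]
        exact one_le_exp (by linarith)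
      have := Finset.sum_nonneg n1
      linarith
    · push Not at hc
      obtain ⟨w, hw⟩ := hc
      have := Finset.single_le_sum n1 (mem_univ w)
      have h2 : ∏ m, (if G w (c m) then (0 : ℝ) else 1) = 1 :=
        Finset.prod_eq_one fun m _ => if_neg (hw m)
      have := Finset.sum_nonneg n2
      linarith
  have h2 : (1 : ℝ) ≤ ∑ c : Fin M → B, (∏ m, μ (c m)) *
      (∑ w, ∏ m, (if G w (c m) then (0 : ℝ) else 1) +
      ∑ y, exp (-K) * ∏ m, exp (if L y (c m) then 1 else 0)) := by
    refine (sum_pi_prod_eq_one (n := M) hμ1).symm.trans_le ?_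
    exact Finset.sum_le_sum fun c _ =>
      le_mul_of_one_le_right (Finset.prod_nonneg fun m _ => hμ _) (h1 c)
  have h3 : ∑ c : Fin M → B, (∏ m, μ (c m)) *
      (∑ w, ∏ m, (if G w (c m) then (0 : ℝ) else 1) +
      ∑ y, exp (-K) * ∏ m, exp (if L y (c m) then 1 else 0)) =
      ∑ w, (∑ b, μ b * (if G w b then (0 : ℝ) else 1)) ^ M +
      ∑ y, exp (-K) * (∑ b, μ b * exp (if L y b then 1 else 0)) ^ M := by
    have e : ∀ f : B → ℝ, (∑ b, μ b * f b) ^ M =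
        ∑ c : Fin M → B, (∏ m, μ (c m)) * ∏ m, f (c m) := by
      intro f
      simp only [← Finset.prod_mul_distrib]
      rw [sum_pi_prod fun _ b => μ b * f b]
      simp
    simp only [e, mul_add, Finset.sum_add_distrib, Finset.mul_sum]
    congr 1
    · rw [Finset.sum_comm]
    · rw [Finset.sum_comm]
      refine Finset.sum_congr rfl fun y _ => Finset.sum_congr rfl fun c _ => by ring
  have h4 : ∑ w, (∑ b, μ b * (if G w b then (0 : ℝ) else 1)) ^ M ≤
      Fintype.card ι * (1 - p) ^ M := by
    rw [← nsmul_eq_mul]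
    refine Finset.sum_le_card_nsmul _ _ _ fun w _ => ?_
    refine pow_le_pow_left₀ (Finset.sum_nonneg fun b _ =>
      mul_nonneg (hμ b) (by split_ifs <;> norm_num)) ?_ _
    have : ∑ b, μ b * (if G w b then (0 : ℝ) else 1) =
        1 - ∑ b, if G w b then μ b else 0 := by
      refine eq_sub_of_add_eq ?_
      rw [← Finset.sum_add_distrib]
      refine Eq.trans ?_ hμ1
      refine Finset.sum_congr rfl fun b _ => ?_
      by_cases hb : G w b <;> simp [hb]
    rw [this]
    linarith [hG w]
  have h5 : ∑ y, exp (-K) * (∑ b, μ b * exp (if L y b then 1 else 0)) ^ M ≤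
      Fintype.card κ * exp (2 * r * M - K) := by
    rw [← nsmul_eq_mul]
    refine Finset.sum_le_card_nsmul _ _ _ fun y _ => ?_
    have e1 : ∑ b, μ b * exp (if L y b then 1 else 0) ≤ exp (2 * r) := by
      have : ∑ b, μ b * exp (if L y b then 1 else 0) =
          1 + (exp 1 - 1) * ∑ b, if L y b then μ b else 0 := by
        refine Eq.trans ?_ (congrArg (· + _) hμ1)
        rw [Finset.mul_sum, ← Finset.sum_add_distrib]
        refine Finset.sum_congr rfl fun b _ => ?_
        split_ifs
        · ring
        · simp
      rw [this]
      have e2 : exp 1 - 1 ≤ 2 := by linarith [exp_one_lt_three]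
      have e3 : 0 ≤ exp 1 - 1 := by linarith [one_le_exp (zero_le_one' ℝ)]
      have := mul_le_mul e2 (hL y) (Finset.sum_nonneg fun b _ => by
        split_ifs
        exacts [hμ b, le_rfl]) zero_le_two
      linarith [add_one_le_exp (2 * r)]
    calc exp (-K) * (∑ b, μ b * exp (if L y b then 1 else 0)) ^ M
        ≤ exp (-K) * exp (2 * r) ^ M := by
          refine mul_le_mul_of_nonneg_left (pow_le_pow_left₀ (Finset.sum_nonneg fun b _ =>
            mul_nonneg (hμ b) (exp_pos _).le) e1 _) (exp_pos _).le
      _ = exp (2 * r * M - K) := by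
          rw [← exp_nat_mul, ← exp_add]; congr 1; ring
  linarith

open Classical in
theorem sum_fiber_prob {Ω α β β' : Type*} [Fintype Ω] [Fintype β] (q : Ω → ℝ) (A : Ω → α)
    {V : Ω → β} {V' : Ω → β'} {ρ : β → β'} (hρ : ∀ ω, ρ (V ω) = V' ω) (a : α) (v' : β') :
    (∑ v, if ρ v = v' then prob q (fun ω => (A ω, V ω)) (a, v) else 0) =
      prob q (fun ω => (A ω, V' ω)) (a, v') := by
  simp only [prob_eq_sum_ite, Prod.mk.injEq]
  simp only [← Finset.sum_filter]
  rw [Finset.sum_comm' (t' := univ.filter fun ω => A ω = a ∧ V' ω = v')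
    (s' := fun ω => {V ω})]
  · simp
  · intro v ω
    simp only [mem_univ, mem_filter, true_and, mem_singleton]
    constructor
    · rintro ⟨rfl, rfl, rfl⟩
      exact ⟨rfl, rfl, (hρ ω).symm⟩
    · rintro ⟨rfl, rfl, rfl⟩
      exact ⟨hρ ω, rfl, rfl⟩

variable {Ω 𝒲 σ β β' : Type*} [Fintype Ω]

/-- The word `v` extends `v'` and is compatible with the side information `y`. -/
def Compatible (Q : Ω → ℝ) (Y : Ω → σ) (V : Ω → β) (V' : Ω → β')
    (ρ : β → β') (b : ℝ) (y : σ) (v' : β') (v : β) : Prop :=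
  ρ v = v' ∧ 0 < prob Q V v ∧ 0 < prob Q (fun ω => (Y ω, V' ω)) (y, v') ∧
    b * prob Q V v * prob Q (fun ω => (Y ω, V' ω)) (y, v') ≤
      prob Q V' v' * prob Q (fun ω => (Y ω, V ω)) (y, v)

open Classical in
/-- Given that the source block is `w` and that the word is `v`, the probability that `T` fails is
at most `δ`. -/
def Likely (Q : Ω → ℝ) (W : Ω → 𝒲) (V : Ω → β) (T : Ω → Prop) (δ : ℝ) (w : 𝒲) (v : β) : Prop :=
  0 < prob Q (fun ω => (W ω, V ω)) (w, v) ∧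
    prob (fun ω => if T ω then 0 else Q ω) (fun ω => (W ω, V ω)) (w, v) ≤
      δ * prob Q (fun ω => (W ω, V ω)) (w, v)

theorem Likely.exists {Q : Ω → ℝ} {W : Ω → 𝒲} {V : Ω → β} {T : Ω → Prop} {δ : ℝ} {w : 𝒲} {v : β}
    (hδ : δ < 1) (h : Likely Q W V T δ w v) : ∃ ω, T ω ∧ 0 < Q ω ∧ W ω = w ∧ V ω = v := by
  classical
  have h1 : 0 < prob (fun ω => if T ω then Q ω else 0) (fun ω => (W ω, V ω)) (w, v) := by
    have e : prob Q (fun ω => (W ω, V ω)) (w, v) =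
        prob (fun ω => if T ω then Q ω else 0) (fun ω => (W ω, V ω)) (w, v) +
        prob (fun ω => if T ω then 0 else Q ω) (fun ω => (W ω, V ω)) (w, v) := by
      unfold prob
      rw [← Finset.sum_add_distrib]
      exact Finset.sum_congr rfl fun ω _ => by split_ifs <;> simp
    obtain ⟨h0, h2⟩ := h
    nlinarith
  obtain ⟨ω, h2, h3⟩ := exists_of_prob_pos h1
  by_cases hT : T ω
  · exact ⟨ω, hT, by simpa [hT] using h3, (Prod.mk.inj h2).1, (Prod.mk.inj h2).2⟩
  · simp [hT] at h3

open Classical in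
/-- One layer of a superposition code. -/
theorem exists_layer [Fintype 𝒲] [Fintype σ] [Fintype β] [Nonempty β] {Q : Ω → ℝ}
    (hQ : ∀ ω, 0 ≤ Q ω) (W : Ω → 𝒲) (Y : 𝒲 → σ) {V : Ω → β} {V' : Ω → β'} {ρ : β → β'}
    (hρ : ∀ ω, ρ (V ω) = V' ω) (T : Ω → Prop) {a b : ℝ} (ha : 0 < a) (hb : 0 < b)
    (h1 : ∀ ω, T ω → prob Q (fun ω => (W ω, V ω)) (W ω, V ω) * prob Q V' (V' ω) ≤
      a * prob Q V (V ω) * prob Q (fun ω => (W ω, V' ω)) (W ω, V' ω))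
    (h2 : ∀ ω, T ω → b * prob Q V (V ω) * prob Q (fun ω => (Y (W ω), V' ω)) (Y (W ω), V' ω) ≤
      prob Q V' (V' ω) * prob Q (fun ω => (Y (W ω), V ω)) (Y (W ω), V ω))
    {M : ℕ} {K : ℝ} (hK : 0 ≤ K)
    (hMK : Fintype.card 𝒲 * (1 - 1 / (2 * a)) ^ M + Fintype.card σ * exp (2 * (1 / b) * M - K) < 1)
    (ha1 : 1 ≤ 2 * a) {δ : ℝ} (hδ : 0 < δ) (hδ1 : 2 * δ < 1) (v' : β') :
    ∃ c : Fin M → β,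
      (∀ w, Likely Q W V' T δ w v' → ∃ m, Likely Q W V T (2 * δ) w (c m) ∧
        Compatible Q (fun ω => Y (W ω)) V V' ρ b (Y w) v' (c m)) ∧
      ∀ y, ((univ.filter fun m => Compatible Q (fun ω => Y (W ω)) V V' ρ b y v' (c m)).card : ℝ)
        ≤ K := by
  have hρ0 : (∑ v, if ρ v = v' then prob Q V v else 0) = prob Q V' v' := by
    have := sum_fiber_prob Q (fun _ => ()) hρ () v'
    rw [prob_congr (B := V') (b := v') (by simp)] at this
    rw [← this]
    refine Finset.sum_congr rfl fun v _ => ?_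
    rw [prob_congr (A := V) (a := v) (B := fun ω => ((), V ω)) (b := ((), v)) (by simp)]
  by_cases hv' : prob Q V' v' = 0
  · refine ⟨fun _ => Classical.arbitrary β, fun w hw => ?_, fun y => ?_⟩
    · exfalso
      obtain ⟨ω, hω, hpos⟩ := exists_of_prob_pos hw.1
      have := prob_pos hQ V' hpos
      rw [(Prod.mk.inj hω).2] at this
      exact this.ne' hv'
    · rw [Finset.filter_false_of_mem]
      · simpa using hK
      · rintro m _ ⟨hm, hpos, -⟩
        obtain ⟨ω, hω, hpos⟩ := exists_of_prob_pos hpos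
        have := prob_pos hQ V' hpos
        rw [← hρ, hω, hm] at this
        exact this.ne' hv'
  have hv'0 : 0 < prob Q V' v' := (prob_nonneg hQ _ _).lt_of_ne' hv'
  let μ : β → ℝ := fun v => if ρ v = v' then prob Q V v / prob Q V' v' else 0
  have hμ : ∀ v, 0 ≤ μ v := fun v => by
    simp only [μ]
    split_ifs
    exacts [div_nonneg (prob_nonneg hQ _ _) hv'0.le, le_rfl]
  have hμ1 : ∑ v, μ v = 1 := by
    rw [← div_self hv', ← hρ0, Finset.sum_div]
    exact Finset.sum_congr rfl fun v _ => by simp only [μ]; split_ifs <;> simp [hρ0]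
  have hhit : ∀ w : {w // Likely Q W V' T δ w v'}, 1 / (2 * a) ≤
      ∑ v, if Likely Q W V T (2 * δ) w.1 v ∧
        Compatible Q (fun ω => Y (W ω)) V V' ρ b (Y w.1) v' v then μ v else 0 := by
    rintro ⟨w, hw⟩
    obtain ⟨hw1, hw2⟩ := hw
    set F := prob Q (fun ω => (W ω, V ω)) with hF
    set F' := prob Q (fun ω => (W ω, V' ω)) with hF'
    set E := prob (fun ω => if T ω then 0 else Q ω) (fun ω => (W ω, V ω)) with hE
    set E' := prob (fun ω => if T ω then 0 else Q ω) (fun ω => (W ω, V' ω)) with hE'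
    have hE0 : ∀ z, 0 ≤ E z := prob_nonneg (fun ω => by split_ifs; exacts [le_rfl, hQ ω]) _
    have hF0 : ∀ z, 0 ≤ F z := prob_nonneg hQ _
    have key : ∀ v, (if ρ v = v' then F (w, v) else 0) / (a * F' (w, v')) ≤
        (if Likely Q W V T (2 * δ) w v ∧
          Compatible Q (fun ω => Y (W ω)) V V' ρ b (Y w) v' v then μ v else 0) +
        (if ρ v = v' then E (w, v) else 0) / (2 * δ * (a * F' (w, v'))) := by
      intro v
      by_cases hv : ρ v = v'
      swap
      · simp only [if_neg hv, zero_div, add_zero]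
        split_ifs
        exacts [hμ v, le_rfl]
      simp only [if_pos hv]
      by_cases hL : Likely Q W V T (2 * δ) w v
      · obtain ⟨ω, hω, hpos, rfl, rfl⟩ := hL.exists hδ1
        have hVω : V' ω = v' := by rw [← hv, hρ]
        have hC : Compatible Q (fun ω => Y (W ω)) V V' ρ b (Y (W ω)) v' (V ω) := by
          refine ⟨hv, prob_pos hQ V hpos, ?_, ?_⟩
          · rw [← hVω]; exact prob_pos hQ (fun ω => (Y (W ω), V' ω)) hpos
          · rw [← hVω]; exact h2 ω hω
        rw [if_pos ⟨hL, hC⟩]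
        have h3 := h1 ω hω
        rw [hVω] at h3
        have h4 : F (W ω, V ω) / (a * F' (W ω, v')) ≤ μ (V ω) := by
          simp only [μ, if_pos hv]
          rw [div_le_div_iff₀ (by positivity) hv'0]
          linarith
        have h5 : 0 ≤ E (W ω, V ω) / (2 * δ * (a * F' (W ω, v'))) :=
          div_nonneg (hE0 _) (by positivity)
        linarith
      · have h3 : F (w, v) ≤ E (w, v) / (2 * δ) := by
          rcases (hF0 (w, v)).eq_or_lt with h | h
          · rw [← h]; exact div_nonneg (hE0 _) (by positivity)
          · rw [le_div_iff₀ (by positivity)]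
            by_contra hcon
            exact hL ⟨h, by rw [← hE, ← hF]; linarith⟩
        have h4 : F (w, v) / (a * F' (w, v')) ≤ E (w, v) / (2 * δ) / (a * F' (w, v')) := by gcongr
        rw [div_div] at h4
        rw [if_neg fun h => hL h.1]
        linarith
    have hsum := Finset.sum_le_sum fun v (_ : v ∈ univ) => key v
    rw [Finset.sum_add_distrib, ← Finset.sum_div, ← Finset.sum_div,
      hF, hE, sum_fiber_prob Q W hρ, sum_fiber_prob _ W hρ, ← hF', ← hE'] at hsum
    have h3 : F' (w, v') / (a * F' (w, v')) = 1 / a := by field_simp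
    have h4 : E' (w, v') / (2 * δ * (a * F' (w, v'))) ≤ 1 / (2 * a) := by
      rw [div_le_div_iff₀ (by positivity) (by positivity)]
      nlinarith [mul_le_mul_of_nonneg_left hw2 ha.le]
    have h5 : 1 / a = 1 / (2 * a) + 1 / (2 * a) := by field_simp; norm_num
    linarith
  have hlist : ∀ y, (∑ v, if Compatible Q (fun ω => Y (W ω)) V V' ρ b y v' v then μ v else 0) ≤
      1 / b := by
    intro y
    set G := prob Q (fun ω => (Y (W ω), V ω)) with hG
    set G' := prob Q (fun ω => (Y (W ω), V' ω)) with hG'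
    have hG0 : ∀ z, 0 ≤ G z := prob_nonneg hQ _
    by_cases hy : 0 < G' (y, v')
    swap
    · refine le_trans (le_of_eq (Finset.sum_eq_zero fun v _ => if_neg fun h => hy h.2.2.1)) ?_
      positivity
    have key : ∀ v, (if Compatible Q (fun ω => Y (W ω)) V V' ρ b y v' v then μ v else 0) ≤
        (if ρ v = v' then G (y, v) else 0) / (b * G' (y, v')) := by
      intro v
      by_cases hC : Compatible Q (fun ω => Y (W ω)) V V' ρ b y v' v
      · obtain ⟨e1, e2, e3, e4⟩ := hC
        rw [if_pos ⟨e1, e2, e3, e4⟩, if_pos e1]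
        simp only [μ, if_pos e1]
        rw [div_le_div_iff₀ hv'0 (by positivity)]
        linarith
      · rw [if_neg hC]
        split_ifs
        · exact div_nonneg (hG0 _) (by positivity)
        · simp
    have hsum := Finset.sum_le_sum fun v (_ : v ∈ univ) => key v
    rw [← Finset.sum_div, hG, sum_fiber_prob Q (fun ω => Y (W ω)) hρ, ← hG'] at hsum
    refine hsum.trans (le_of_eq ?_)
    field_simp
  have hcard : Fintype.card {w // Likely Q W V' T δ w v'} * (1 - 1 / (2 * a)) ^ M +
      Fintype.card σ * exp (2 * (1 / b) * M - K) < 1 := by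
    refine lt_of_le_of_lt ?_ hMK
    have : (Fintype.card {w // Likely Q W V' T δ w v'} : ℝ) ≤ Fintype.card 𝒲 := by
      exact_mod_cast Fintype.card_subtype_le _
    have h0 : 0 ≤ 1 - 1 / (2 * a) := by
      rw [sub_nonneg, div_le_one (by linarith)]; exact ha1
    gcongr
  obtain ⟨c, hc1, hc2⟩ := exists_codebook hμ hμ1
    (fun (w : {w // Likely Q W V' T δ w v'}) v => Likely Q W V T (2 * δ) w.1 v ∧
        Compatible Q (fun ω => Y (W ω)) V V' ρ b (Y w.1) v' v) (1 / (2 * a))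
    (fun w => by convert hhit w)
    (fun y v => Compatible Q (fun ω => Y (W ω)) V V' ρ b y v' v) hlist M K hcard
  exact ⟨c, fun w hw => hc1 ⟨w, hw⟩, hc2⟩

end Covering

/-! ### Superposition codes -/

section Tree

variable {Ω 𝒲 σ β : Type*} [Fintype Ω]

/-- A tree of code words, one generation for each layer, such that the words compatible with a given
side information sequence are few. -/
theorem exists_tree [Fintype 𝒲] [Fintype σ] [Fintype β] {Q : Ω → ℝ}
    (hQ : ∀ ω, 0 ≤ Q ω) (W : Ω → 𝒲) (Y : 𝒲 → σ) {V : ℕ → Ω → β} {ρ : ℕ → β → β}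
    (hρ : ∀ s ω, ρ s (V (s + 1) ω) = V s ω) (T : Ω → Prop) (S : ℕ) {a b : ℕ → ℝ}
    (ha : ∀ s, 1 ≤ 2 * a s) (hb : ∀ s, 0 < b s)
    (h1 : ∀ s < S, ∀ ω, T ω →
      prob Q (fun ω => (W ω, V (s + 1) ω)) (W ω, V (s + 1) ω) * prob Q (V s) (V s ω) ≤
      a s * prob Q (V (s + 1)) (V (s + 1) ω) * prob Q (fun ω => (W ω, V s ω)) (W ω, V s ω))
    (h2 : ∀ s < S, ∀ ω, T ω → b s * prob Q (V (s + 1)) (V (s + 1) ω) *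
        prob Q (fun ω => (Y (W ω), V s ω)) (Y (W ω), V s ω) ≤
      prob Q (V s) (V s ω) *
        prob Q (fun ω => (Y (W ω), V (s + 1) ω)) (Y (W ω), V (s + 1) ω))
    {M : ℕ → ℕ} {K : ℕ → ℝ} (hK : ∀ s, 0 ≤ K s)
    (hMK : ∀ s < S, Fintype.card 𝒲 * (1 - 1 / (2 * a s)) ^ M s +
      Fintype.card σ * exp (2 * (1 / b s) * M s - K s) < 1)
    {δ : ℝ} (hδ : 0 < δ) (hδ1 : 2 ^ S * δ < 1) (v₀ : β) :
    ∃ (C : ℕ → Finset β) (L : ℕ → σ → Finset β),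
      (∀ s, (C s).card ≤ ∏ r ∈ range s, M r) ∧
      (∀ s ≤ S, ∀ y, ((L s y).card : ℝ) ≤ ∏ r ∈ range s, K r) ∧
      (∀ s, ∀ v ∈ C (s + 1), ρ s v ∈ C s) ∧ (∀ s < S, ∀ y, ∀ v ∈ L (s + 1) y, ρ s v ∈ L s y) ∧
      ∀ w, Likely Q W (V 0) T δ w v₀ →
        ∃ v, v ∈ C S ∧ v ∈ L S (Y w) ∧ Likely Q W (V S) T (2 ^ S * δ) w v := by
  classical
  have : Nonempty β := ⟨v₀⟩
  have hlayer : ∀ s, ∃ c : β → Fin (M s) → β, s < S → ∀ v',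
      (∀ w, Likely Q W (V s) T (2 ^ s * δ) w v' → ∃ m,
        Likely Q W (V (s + 1)) T (2 * (2 ^ s * δ)) w (c v' m) ∧
        Compatible Q (fun ω => Y (W ω)) (V (s + 1)) (V s) (ρ s) (b s) (Y w) v' (c v' m)) ∧
      ∀ y, ((univ.filter fun m =>
      Compatible Q (fun ω => Y (W ω)) (V (s + 1)) (V s) (ρ s) (b s) y v'
        (c v' m)).card : ℝ) ≤ K s := by
    intro s
    by_cases hs : s < S
    · have hδs : 2 * (2 ^ s * δ) < 1 := by
        refine lt_of_le_of_lt ?_ hδ1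
        rw [← mul_assoc, ← pow_succ']
        have : (2 : ℝ) ^ (s + 1) ≤ 2 ^ S := pow_le_pow_right₀ (by norm_num) hs
        gcongr
      choose c hc using fun v' => exists_layer hQ W Y (hρ s) T (by linarith [ha s]) (hb s) (h1 s hs)
        (h2 s hs) (hK s) (hMK s hs) (ha s) (by positivity : 0 < 2 ^ s * δ) hδs v'
      exact ⟨c, fun _ => hc⟩
    · exact ⟨fun _ _ => v₀, fun h => absurd h hs⟩
  choose c hc using hlayer
  let stepC : ℕ → Finset β → Finset β := fun s Cs =>
    (Cs.biUnion fun v' => univ.image (c s v')).filter fun v => ρ s v ∈ Cs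
  let C : ℕ → Finset β := fun s => Nat.rec {v₀} stepC s
  let L : ℕ → σ → Finset β := fun s y => Nat.rec {v₀} (fun s Ls =>
    Ls.biUnion fun v' => (univ.filter fun m =>
      Compatible Q (fun ω => Y (W ω)) (V (s + 1)) (V s)
      (ρ s) (b s) y v' (c s v' m)).image (c s v')) s
  have hC : ∀ (s : ℕ) (v : β), v ∈ C (s + 1) ↔
      v ∈ ((C s).biUnion fun v' => univ.image (c s v')) ∧ ρ s v ∈ C s := by
    intro s v
    change v ∈ stepC s (C s) ↔ _
    simp only [stepC, Finset.mem_filter]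
  have hL : ∀ (s : ℕ) (y : σ), L (s + 1) y =
    (L s y).biUnion fun v' => (univ.filter fun m =>
      Compatible Q (fun ω => Y (W ω)) (V (s + 1)) (V s)
      (ρ s) (b s) y v' (c s v' m)).image (c s v') := fun s y => rfl
  refine ⟨C, L, fun s => ?_, fun s hs y => ?_, fun s v hv => ?_, fun s hs y v hv => ?_,
    fun w hw => ?_⟩
  · induction s with
    | zero => simp [C]
    | succ s ih =>
      rw [Finset.prod_range_succ]
      have hsub : C (s + 1) ⊆ (C s).biUnion fun v' => univ.image (c s v') :=
        fun v hv => ((hC s v).1 hv).1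
      refine (Finset.card_le_card hsub).trans ((Finset.card_biUnion_le_card_mul _ _ (M s)
        fun v' _ => ?_).trans (Nat.mul_le_mul_right _ ih))
      exact Finset.card_image_le.trans (by simp)
  · induction s with
    | zero => simp [L]
    | succ s ih =>
      rw [hL, Finset.prod_range_succ]
      calc ((((L s y).biUnion fun v' => _).card : ℕ) : ℝ)
          ≤ ∑ v' ∈ L s y, (((univ.filter fun m =>
      Compatible Q (fun ω => Y (W ω)) (V (s + 1)) (V s)
              (ρ s) (b s) y v' (c s v' m)).image (c s v')).card : ℝ) := by
            exact_mod_cast Finset.card_biUnion_le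
        _ ≤ ∑ v' ∈ L s y, K s := by
            refine Finset.sum_le_sum fun v' _ => ?_
            exact (Nat.cast_le.2 Finset.card_image_le).trans ((hc s (by omega) v').2 y)
        _ = (L s y).card * K s := by simp
        _ ≤ _ := mul_le_mul_of_nonneg_right (ih (by omega)) (hK s)
  · exact ((hC s v).1 hv).2
  · rw [hL] at hv
    simp only [mem_biUnion, mem_image, mem_filter, mem_univ, true_and] at hv
    obtain ⟨v', hv', m, hm, rfl⟩ := hv
    rw [hm.1]
    exact hv'
  · suffices H : ∀ s ≤ S, ∃ v, v ∈ C s ∧ v ∈ L s (Y w) ∧ Likely Q W (V s) T (2 ^ s * δ) w v from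
      H S le_rfl
    intro s hs
    induction s with
    | zero => exact ⟨v₀, by simp [C], by simp [L], by simpa using hw⟩
    | succ s ih =>
      obtain ⟨v', h1, h2, h3⟩ := ih (by omega)
      obtain ⟨m, hm1, hm2⟩ := (hc s (by omega) v').1 w h3
      refine ⟨c s v' m, ?_, ?_, ?_⟩
      · rw [hC, hm2.1]
        refine ⟨?_, h1⟩
        simp only [mem_biUnion, mem_image, mem_univ, true_and]
        exact ⟨v', h1, m, rfl⟩
      · rw [hL]
        simp only [mem_biUnion, mem_image, mem_filter, mem_univ, true_and]
        exact ⟨v', h2, m, hm2, rfl⟩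
      · rw [pow_succ', mul_assoc]
        exact hm1

end Tree

/-! ### Codes from sets of code words -/

section Words

theorem exists_enc_dec {β : Type*} [Nonempty β] {M : ℕ} (S : Finset β) (hS : S.card ≤ M)
    (hM : 0 < M) : ∃ (e : β → Fin M) (f : Fin M → β), ∀ v ∈ S, f (e v) = v := by
  classical
  obtain ⟨φ⟩ := Function.Embedding.nonempty_of_card_le (α := S) (β := Fin M) (by simpa using hS)
  refine ⟨fun v => if h : v ∈ S then φ ⟨v, h⟩ else ⟨0, hM⟩, fun m =>
    if h : ∃ v : S, φ v = m then h.choose else Classical.arbitrary β, fun v hv => ?_⟩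
  have h : ∃ u : S, φ u = φ ⟨v, hv⟩ := ⟨_, rfl⟩
  simp only [dif_pos hv, dif_pos h]
  exact congrArg Subtype.val (φ.injective h.choose_spec)

/-- A code in which user `i` receives the word `g i x y`, taken from the set `Z i`, which may depend
on the side information if user `i` sees it. -/
theorem exists_code {k l n : ℕ} {𝒳 𝒴 : Type*} {𝒳h : Fin (k + l) → Type*}
    {M : Fin (k + l + 1) → ℕ} (hM : ∀ i, 0 < M i) (hkl : 0 < k + l) {β : Type*} [Nonempty β]
    (Z : Fin (k + l) → Option (Fin n → 𝒴) → Finset β) (hZ : ∀ i y, (Z i y).card ≤ M i.castSucc)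
    (ρ : ℕ → β → β) (g : ℕ → (Fin n → 𝒳) → (Fin n → 𝒴) → β)
    (hg : ∀ i x y, g (i + 1) x y = ρ i (g i x y))
    (sel : (Fin n → 𝒳) → (Fin n → 𝒴) → Fin (M (Fin.last (k + l))))
    (rec : (i : Fin (k + l)) → β → Option (Fin (M (Fin.last (k + l)))) → Fin n → 𝒳h i) :
    ∃ c : Code k l n 𝒳 𝒴 𝒳h M, ∀ x y, (∀ i : Fin (k + l), g i x y ∈ Z i (sideView k y i)) →
      ∀ i, c.recon x y i = rec i (g i x y) (directView (k + l) (sel x y) i) := by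
  choose e f hef using fun i y => exists_enc_dec (Z i y) (hZ i y) (hM _)
  let c : Code k l n 𝒳 𝒴 𝒳h M :=
    { enc := fun x y => e ⟨0, hkl⟩ (sideView k y 0) (g 0 x y)
      direct := sel
      relay := fun i hi v m => e ⟨i + 1, hi⟩ (if i + 1 < k then v else none)
        (ρ i (f ⟨i, by omega⟩ v m))
      dec := fun i v m t => rec i (f i v m) t }
  refine ⟨c, fun x y h => ?_⟩
  have key : ∀ (i : ℕ) (hi : i < k + l),
      c.msg x y i hi = e ⟨i, hi⟩ (sideView k y i) (g i x y) := by
    intro i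
    induction i with
    | zero => exact fun _ => rfl
    | succ i ih =>
      intro hi
      rw [Code.msg, ih (by omega), hg]
      change e _ _ _ = _
      rw [hef ⟨i, by omega⟩ _ _ (h ⟨i, by omega⟩)]
      congr 1
      unfold sideView
      split_ifs <;> first | rfl | omega
  intro i
  rw [Code.recon, key]
  change rec i (f i _ _) _ = _
  rw [hef i _ _ (h i)]

end Words

/-! ### Laws of large numbers -/

section LLN

variable {Ω : Type*} [Fintype Ω]

open Classical in
/-- The probability of an event. -/
def mass (Q : Ω → ℝ) (E : Ω → Prop) : ℝ := ∑ ω, if E ω then Q ω else 0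

theorem mass_nonneg {Q : Ω → ℝ} (hQ : ∀ ω, 0 ≤ Q ω) (E : Ω → Prop) : 0 ≤ mass Q E := by
  classical
  exact Finset.sum_nonneg fun ω _ => by split_ifs; exacts [hQ ω, le_rfl]

theorem mass_mono {Q : Ω → ℝ} (hQ : ∀ ω, 0 ≤ Q ω) {E F : Ω → Prop} (h : ∀ ω, 0 < Q ω → E ω → F ω) :
    mass Q E ≤ mass Q F := by
  classical
  refine Finset.sum_le_sum fun ω _ => ?_
  rcases (hQ ω).eq_or_lt with h0 | h0
  · simp [← h0]
  by_cases hE : E ω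
  · simp [hE, h ω h0 hE]
  · rw [if_neg hE]; split_ifs; exacts [hQ ω, le_rfl]

theorem mass_or_le {Q : Ω → ℝ} (hQ : ∀ ω, 0 ≤ Q ω) (E F : Ω → Prop) :
    mass Q (fun ω => E ω ∨ F ω) ≤ mass Q E + mass Q F := by
  classical
  unfold mass
  rw [← Finset.sum_add_distrib]
  refine Finset.sum_le_sum fun ω _ => ?_
  have := hQ ω
  by_cases hE : E ω <;> by_cases hF : F ω <;> simp [hE, hF, this]

theorem mass_exists_le {ι : Type*} [Fintype ι] {Q : Ω → ℝ} (hQ : ∀ ω, 0 ≤ Q ω)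
    (E : ι → Ω → Prop) : mass Q (fun ω => ∃ i, E i ω) ≤ ∑ i, mass Q (E i) := by
  classical
  unfold mass
  rw [Finset.sum_comm]
  refine Finset.sum_le_sum fun ω _ => ?_
  have hnn : ∀ i ∈ univ, 0 ≤ if E i ω then Q ω else 0 := fun i _ => by
    split_ifs; exacts [hQ ω, le_rfl]
  split_ifs with h
  · obtain ⟨i, hi⟩ := h
    refine le_trans ?_ (Finset.single_le_sum hnn (mem_univ i))
    simp [hi]
  · exact Finset.sum_nonneg hnn

/-- Markov's inequality for conditional probabilities. -/
theorem mass_not_likely_le {𝒲 β : Type*} [Fintype 𝒲] [Fintype β] {Q : Ω → ℝ} (hQ : ∀ ω, 0 ≤ Q ω)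
    (W : Ω → 𝒲) (V : Ω → β) (T : Ω → Prop) {δ : ℝ} (hδ : 0 < δ) :
    mass Q (fun ω => ¬ Likely Q W V T δ (W ω) (V ω)) ≤ mass Q (fun ω => ¬ T ω) / δ := by
  classical
  have h1 := sum_prob_mul Q (fun ω => (W ω, V ω))
    fun z => if ¬ Likely Q W V T δ z.1 z.2 then 1 else 0
  have h2 := sum_prob (fun ω => if T ω then 0 else Q ω) (fun ω => (W ω, V ω))
  have h3 : mass Q (fun ω => ¬ Likely Q W V T δ (W ω) (V ω)) =
      ∑ ω, Q ω * if ¬ Likely Q W V T δ (W ω) (V ω) then 1 else 0 := by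
    unfold mass
    exact Finset.sum_congr rfl fun ω _ => by split_ifs <;> simp
  have h4 : mass Q (fun ω => ¬ T ω) = ∑ ω, if T ω then 0 else Q ω := by
    unfold mass
    exact Finset.sum_congr rfl fun ω _ => by split_ifs <;> simp_all
  rw [h3, ← h1, h4, ← h2, Finset.sum_div]
  refine Finset.sum_le_sum fun z _ => ?_
  have hE0 : 0 ≤ prob (fun ω => if T ω then 0 else Q ω) (fun ω => (W ω, V ω)) z :=
    prob_nonneg (fun ω => by split_ifs; exacts [le_rfl, hQ ω]) _ _
  by_cases h : Likely Q W V T δ z.1 z.2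
  · simp only [h, not_true_eq_false, if_false, mul_zero]
    positivity
  · simp only [h, not_false_eq_true, if_true, mul_one]
    rw [le_div_iff₀ hδ]
    by_contra hcon
    refine h ⟨?_, by linarith⟩
    by_contra h0
    have h0 : prob Q (fun ω => (W ω, V ω)) z = 0 :=
      le_antisymm (not_lt.1 h0) (prob_nonneg hQ _ _)
    rw [h0] at hcon
    linarith

theorem exists_exp_moment_lt_one {q : Ω → ℝ} (hq : ∀ ω, 0 ≤ q ω) (hq1 : ∑ ω, q ω = 1) (f : Ω → ℝ)
    (hf : ∑ ω, q ω * f ω < 0) : ∃ t : ℝ, 0 < t ∧ ∑ ω, q ω * exp (t * f ω) < 1 := by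
  set η := -∑ ω, q ω * f ω with hη
  have hη0 : 0 < η := by linarith
  obtain ⟨B, hB⟩ : ∃ B : ℝ, ∀ ω, |f ω| ≤ B := ⟨∑ ω, |f ω|, fun ω =>
    Finset.single_le_sum (f := fun ω => |f ω|) (fun _ _ => abs_nonneg _) (mem_univ ω)⟩
  set A := max B (max η 1) with hA
  have hA1 : 1 ≤ A := (le_max_right _ _).trans (le_max_right _ _)
  have hAη : η ≤ A := (le_max_left _ _).trans (le_max_right _ _)
  have hAB : ∀ ω, |f ω| ≤ A := fun ω => (hB ω).trans (le_max_left _ _)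
  set t := η / (2 * A ^ 2) with ht
  have ht0 : 0 < t := by positivity
  have htA : t * A ≤ 1 := by
    rw [ht, div_mul_eq_mul_div, div_le_one (by positivity)]
    nlinarith
  have h1 : ∀ ω, exp (t * f ω) ≤ 1 + t * f ω + t ^ 2 * A ^ 2 := by
    intro ω
    have h2 : |t * f ω| ≤ 1 := by
      rw [abs_mul, abs_of_pos ht0]
      exact (mul_le_mul_of_nonneg_left (hAB ω) ht0.le).trans htA
    have h3 := (abs_le.1 (abs_exp_sub_one_sub_id_le h2)).2
    have h4 : (t * f ω) ^ 2 ≤ t ^ 2 * A ^ 2 := by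
      rw [mul_pow]
      exact mul_le_mul_of_nonneg_left (sq_le_sq' (abs_le.1 (hAB ω)).1 (abs_le.1 (hAB ω)).2)
        (sq_nonneg t)
    linarith
  refine ⟨t, ht0, ?_⟩
  calc ∑ ω, q ω * exp (t * f ω) ≤ ∑ ω, q ω * (1 + t * f ω + t ^ 2 * A ^ 2) :=
        Finset.sum_le_sum fun ω _ => mul_le_mul_of_nonneg_left (h1 ω) (hq ω)
    _ = (∑ ω, q ω) * (1 + t ^ 2 * A ^ 2) + t * ∑ ω, q ω * f ω := by
        rw [Finset.sum_mul, Finset.mul_sum, ← Finset.sum_add_distrib]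
        exact Finset.sum_congr rfl fun ω _ => by ring
    _ = 1 - (t * η - t ^ 2 * A ^ 2) := by rw [hq1, hη]; ring
    _ < 1 := by
        have : t ^ 2 * A ^ 2 = t * η / 2 := by
          rw [sq t, ht]; field_simp
        have : 0 < t * η := by positivity
        linarith

open Filter Topology in
/-- The weak law of large numbers, as an upper bound. -/
theorem tendsto_mass_lt_sum {q : Ω → ℝ} (hq : ∀ ω, 0 ≤ q ω) (hq1 : ∑ ω, q ω = 1) (f : Ω → ℝ)
    {c : ℝ} (hc : ∑ ω, q ω * f ω < c) :
    Tendsto (fun n : ℕ => mass (fun ω : Fin n → Ω => ∏ t, q (ω t))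
      (fun ω => (n : ℝ) * c < ∑ t, f (ω t))) atTop (𝓝 0) := by
  classical
  obtain ⟨t, ht0, ht⟩ := exists_exp_moment_lt_one hq hq1 (fun ω => f ω - c) (by
    simp only [mul_sub, Finset.sum_sub_distrib, ← Finset.sum_mul, hq1]; linarith)
  set r := ∑ ω, q ω * exp (t * (f ω - c)) with hr
  have hr0 : 0 ≤ r := Finset.sum_nonneg fun ω _ => mul_nonneg (hq ω) (exp_pos _).le
  refine squeeze_zero (fun n => mass_nonneg (fun ω => Finset.prod_nonneg fun t _ => hq _) _)
    (fun n => ?_) (tendsto_pow_atTop_nhds_zero_of_lt_one hr0 ht)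
  have h1 : r ^ n = ∑ ω : Fin n → Ω, (∏ s, q (ω s)) * exp (t * (∑ s, f (ω s) - n * c)) := by
    have := sum_pi_prod (n := n) fun _ ω => q ω * exp (t * (f ω - c))
    rw [Finset.prod_const, Finset.card_univ, Fintype.card_fin, ← hr] at this
    rw [← this]
    refine Finset.sum_congr rfl fun ω _ => ?_
    rw [Finset.prod_mul_distrib, ← exp_sum, ← Finset.mul_sum, Finset.sum_sub_distrib]
    simp
  rw [h1]
  refine Finset.sum_le_sum fun ω _ => ?_
  have hQ : 0 ≤ ∏ s, q (ω s) := Finset.prod_nonneg fun t _ => hq _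
  split_ifs with h
  · refine le_mul_of_one_le_right hQ (one_le_exp ?_)
    have : 0 < ∑ s, f (ω s) - n * c := by linarith
    positivity
  · positivity

end LLN

open Filter Topology

/-! ### Information densities of blocks -/

section Density

variable {Ω α β γ : Type*} {q : Ω → ℝ} {n : ℕ}

theorem pos_of_prod_pos (hq : ∀ ω, 0 ≤ q ω) {ω : Fin n → Ω} (h : 0 < ∏ t, q (ω t)) (t : Fin n) :
    0 < q (ω t) :=
  (hq _).lt_of_ne' fun h0 => h.ne' (Finset.prod_eq_zero (mem_univ t) h0)

variable [Fintype Ω]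

/-- The integrand of `mutualInfo`. -/
def infoDensity (q : Ω → ℝ) (A : Ω → α) (B : Ω → β) (ω : Ω) : ℝ :=
  logb 2 (prob q (fun ω' => (A ω', B ω')) (A ω, B ω) / (prob q A (A ω) * prob q B (B ω)))

theorem prob_unit_prod (q : Ω → ℝ) (V : Ω → β) (v : β) :
    prob q (fun ω => ((), V ω)) ((), v) = prob q V v :=
  prob_congr fun ω => by simp

theorem prob_pi_pair (A : Ω → α) (B : Ω → β) (a : Fin n → α) (b : Fin n → β) :
    prob (fun ω : Fin n → Ω => ∏ t, q (ω t)) (fun ω => ((fun t => A (ω t)), fun t => B (ω t)))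
      (a, b) = ∏ t, prob q (fun ω => (A ω, B ω)) (a t, b t) := by
  rw [← prob_pi (fun ω => (A ω, B ω)) fun t => (a t, b t)]
  refine prob_congr fun ω => ?_
  simp only [Prod.mk.injEq, funext_iff, forall_and]

theorem prob_pi_pair_eq (hq : ∀ ω, 0 ≤ q ω) (A : Ω → α) (B : Ω → β) {ω : Fin n → Ω}
    (h : 0 < ∏ t, q (ω t)) :
    prob (fun ω : Fin n → Ω => ∏ t, q (ω t)) (fun ω => ((fun t => A (ω t)), fun t => B (ω t)))
      ((fun t => A (ω t)), fun t => B (ω t)) =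
    prob (fun ω : Fin n → Ω => ∏ t, q (ω t)) (fun ω t => A (ω t)) (fun t => A (ω t)) *
    prob (fun ω : Fin n → Ω => ∏ t, q (ω t)) (fun ω t => B (ω t)) (fun t => B (ω t)) *
      (2 : ℝ) ^ ∑ t, infoDensity q A B (ω t) := by
  rw [prob_pi_pair, prob_pi, prob_pi, rpow_sum_of_pos (by norm_num), ← Finset.prod_mul_distrib,
    ← Finset.prod_mul_distrib]
  refine Finset.prod_congr rfl fun t _ => ?_
  have hp := pos_of_prod_pos hq h t
  have h1 := prob_pos hq A hp
  have h2 := prob_pos hq B hp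
  have h3 := prob_pos hq (fun ω => (A ω, B ω)) hp
  rw [infoDensity, rpow_logb (by norm_num) (by norm_num) (by positivity)]
  field_simp

/-- The integrand of `condMutualInfo`. -/
def condInfoDensity (q : Ω → ℝ) (A : Ω → α) (B : Ω → β) (C : Ω → γ) (ω : Ω) : ℝ :=
  logb 2
    (prob q (fun ω' => (A ω', B ω', C ω')) (A ω, B ω, C ω) * prob q C (C ω) /
      (prob q (fun ω' => (A ω', C ω')) (A ω, C ω) *
        prob q (fun ω' => (B ω', C ω')) (B ω, C ω)))

theorem prob_pi_triple_eq (hq : ∀ ω, 0 ≤ q ω) (A : Ω → α) (B : Ω → β) (C : Ω → γ)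
    {ω : Fin n → Ω} (h : 0 < ∏ t, q (ω t)) :
    prob (fun ω : Fin n → Ω => ∏ t, q (ω t))
      (fun ω => ((fun t => A (ω t)), fun t => (B (ω t), C (ω t))))
      ((fun t => A (ω t)), fun t => (B (ω t), C (ω t))) *
    prob (fun ω : Fin n → Ω => ∏ t, q (ω t)) (fun ω t => C (ω t)) (fun t => C (ω t)) =
      (2 : ℝ) ^ (∑ t, condInfoDensity q A B C (ω t)) *
      prob (fun ω : Fin n → Ω => ∏ t, q (ω t)) (fun ω t => (B (ω t), C (ω t)))
        (fun t => (B (ω t), C (ω t))) *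
      prob (fun ω : Fin n → Ω => ∏ t, q (ω t)) (fun ω => ((fun t => A (ω t)), fun t => C (ω t)))
        ((fun t => A (ω t)), fun t => C (ω t)) := by
  rw [prob_pi_pair (B := fun ω => (B ω, C ω)), prob_pi, prob_pi (fun ω => (B ω, C ω)),
    prob_pi_pair, rpow_sum_of_pos (by norm_num),
    ← Finset.prod_mul_distrib, ← Finset.prod_mul_distrib, ← Finset.prod_mul_distrib]
  refine Finset.prod_congr rfl fun t _ => ?_
  have hp := pos_of_prod_pos hq h t
  have h1 := prob_pos hq (fun ω => (A ω, C ω)) hp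
  have h2 := prob_pos hq (fun ω => (B ω, C ω)) hp
  have h3 := prob_pos hq (fun ω => (A ω, B ω, C ω)) hp
  have h4 := prob_pos hq C hp
  rw [condInfoDensity, rpow_logb (by norm_num) (by norm_num) (by positivity)]
  field_simp

end Density

/-! ### Asymptotics -/

section Asymptotics

theorem tendsto_pow_mul_exp_neg_two_rpow (C : ℝ) (hC : 0 ≤ C) {c η : ℝ} (hc : 0 < c) (hη : 0 < η) :
    Tendsto (fun n : ℕ => C ^ n * exp (-(c * (2 : ℝ) ^ ((n : ℝ) * η)))) atTop (𝓝 0) := by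
  have hlog : 0 < log 2 := log_pos (by norm_num)
  set κ := η * log 2 with hκ
  have hκ0 : 0 < κ := by positivity
  have h1 : ∀ n : ℕ, C ^ n * exp (-(c * (2 : ℝ) ^ ((n : ℝ) * η))) ≤
      exp ((n : ℝ) * (C + -(c * κ ^ 2 / 2) * n)) := by
    intro n
    have e1 : C ^ n ≤ exp (n * C) := by
      rw [exp_nat_mul]
      exact pow_le_pow_left₀ hC (by linarith [add_one_le_exp C]) n
    have e2 : (n * κ) ^ 2 / 2 ≤ (2 : ℝ) ^ ((n : ℝ) * η) := by
      rw [rpow_def_of_pos (by norm_num)]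
      have := quadratic_le_exp_of_nonneg (x := n * κ) (by positivity)
      have e3 : log 2 * ((n : ℝ) * η) = n * κ := by rw [hκ]; ring
      rw [e3]
      have : 0 ≤ n * κ := by positivity
      linarith
    calc C ^ n * exp (-(c * (2 : ℝ) ^ ((n : ℝ) * η)))
        ≤ exp (n * C) * exp (-(c * ((n * κ) ^ 2 / 2))) := by gcongr
      _ = exp ((n : ℝ) * (C + -(c * κ ^ 2 / 2) * n)) := by rw [← exp_add]; congr 1; ring
  refine squeeze_zero (fun n => by positivity) h1 (tendsto_exp_atBot.comp ?_)
  have h2 : Tendsto (fun n : ℕ => C + -(c * κ ^ 2 / 2) * (n : ℝ)) atTop atBot := by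
    refine tendsto_atBot_add_const_left _ _ ?_
    exact tendsto_natCast_atTop_atTop.const_mul_atTop_of_neg (by
      have : 0 < c * κ ^ 2 / 2 := by positivity
      linarith)
  exact tendsto_natCast_atTop_atTop.atTop_mul_atBot₀ h2

theorem eventually_two_le_rpow {η : ℝ} (hη : 0 < η) :
    ∀ᶠ n : ℕ in atTop, (2 : ℝ) ≤ (2 : ℝ) ^ ((n : ℝ) * η) := by
  have : Tendsto (fun n : ℕ => (n : ℝ) * η) atTop atTop :=
    tendsto_natCast_atTop_atTop.atTop_mul_const hη
  filter_upwards [this.eventually_ge_atTop 1] with n hn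
  calc (2 : ℝ) = 2 ^ (1 : ℝ) := (rpow_one 2).symm
    _ ≤ _ := rpow_le_rpow_of_exponent_le (by norm_num) hn

theorem natCeil_le_two_mul {x : ℝ} (hx : 1 ≤ x) : (⌈x⌉₊ : ℝ) ≤ 2 * x := by
  have := (Nat.ceil_lt_add_one (by linarith : 0 ≤ x)).le
  linarith

theorem one_sub_pow_le_exp {a x : ℝ} (ha : 1 ≤ 2 * a) {M : ℕ} (hM : a * x ≤ M) :
    (1 - 1 / (2 * a)) ^ M ≤ exp (-(1 / 2 * x)) := by
  have ha0 : 0 < a := by linarith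
  have h0 : 0 ≤ 1 - 1 / (2 * a) := by
    rw [sub_nonneg, div_le_one (by linarith)]; exact ha
  calc (1 - 1 / (2 * a)) ^ M ≤ exp (-(1 / (2 * a))) ^ M :=
        pow_le_pow_left₀ h0 (one_sub_le_exp_neg _) _
    _ = exp (-(M / (2 * a))) := by rw [← exp_nat_mul]; congr 1; ring
    _ ≤ exp (-(1 / 2 * x)) := by
        rw [exp_le_exp, neg_le_neg_iff, le_div_iff₀ (by positivity)]
        linarith

variable {Ω : Type*} [Fintype Ω] {q : Ω → ℝ}

theorem tendsto_mass_abs_sum (hq : ∀ ω, 0 ≤ q ω) (hq1 : ∑ ω, q ω = 1) (f : Ω → ℝ)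
    {η : ℝ} (hη : 0 < η) :
    Tendsto (fun n : ℕ => mass (fun ω : Fin n → Ω => ∏ t, q (ω t))
      (fun ω => ¬ |∑ t, f (ω t) - n * ∑ ω, q ω * f ω| ≤ n * η)) atTop (𝓝 0) := by
  have hQ : ∀ n, ∀ ω : Fin n → Ω, 0 ≤ ∏ t, q (ω t) := fun n ω =>
    Finset.prod_nonneg fun t _ => hq _
  have h1 := tendsto_mass_lt_sum hq hq1 f (c := ∑ ω, q ω * f ω + η) (by linarith)
  have h2 := tendsto_mass_lt_sum hq hq1 (fun ω => -f ω) (c := -∑ ω, q ω * f ω + η) (by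
    simp only [mul_neg, Finset.sum_neg_distrib]; linarith)
  have h3 := h1.add h2
  rw [add_zero] at h3
  refine squeeze_zero (fun n => mass_nonneg (hQ n) _) (fun n => ?_) h3
  refine (mass_mono (hQ n) fun ω _ h => ?_).trans (mass_or_le (hQ n) _ _)
  rw [abs_le] at h
  rw [Finset.sum_neg_distrib]
  by_contra hcon
  push Not at hcon
  exact h ⟨by linarith, by linarith⟩

theorem tendsto_mass_or (hq : ∀ ω, 0 ≤ q ω) {E F : (n : ℕ) → (Fin n → Ω) → Prop}
    (hE : Tendsto (fun n => mass (fun ω : Fin n → Ω => ∏ t, q (ω t)) (E n)) atTop (𝓝 0))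
    (hF : Tendsto (fun n => mass (fun ω : Fin n → Ω => ∏ t, q (ω t)) (F n)) atTop (𝓝 0)) :
    Tendsto (fun n => mass (fun ω : Fin n → Ω => ∏ t, q (ω t)) (fun ω => E n ω ∨ F n ω))
      atTop (𝓝 0) := by
  have hQ : ∀ n, ∀ ω : Fin n → Ω, 0 ≤ ∏ t, q (ω t) := fun n ω =>
    Finset.prod_nonneg fun t _ => hq _
  have h3 := hE.add hF
  rw [add_zero] at h3
  exact squeeze_zero (fun n => mass_nonneg (hQ n) _) (fun n => mass_or_le (hQ n) _ _) h3

theorem tendsto_mass_exists {ι : Type*} [Fintype ι] (hq : ∀ ω, 0 ≤ q ω)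
    {E : ι → (n : ℕ) → (Fin n → Ω) → Prop}
    (hE : ∀ i, Tendsto (fun n => mass (fun ω : Fin n → Ω => ∏ t, q (ω t)) (E i n)) atTop (𝓝 0)) :
    Tendsto (fun n => mass (fun ω : Fin n → Ω => ∏ t, q (ω t)) (fun ω => ∃ i, E i n ω))
      atTop (𝓝 0) := by
  have hQ : ∀ n, ∀ ω : Fin n → Ω, 0 ≤ ∏ t, q (ω t) := fun n ω =>
    Finset.prod_nonneg fun t _ => hq _
  have h3 := tendsto_finsetSum univ fun i _ => hE i
  rw [Finset.sum_const_zero] at h3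
  exact squeeze_zero (fun n => mass_nonneg (hQ n) _)
    (fun n => mass_exists_le (hQ n) fun i => E i n) h3

theorem tendsto_mass_mono (hq : ∀ ω, 0 ≤ q ω) {E F : (n : ℕ) → (Fin n → Ω) → Prop}
    (h : ∀ n ω, 0 < ∏ t, q (ω t) → E n ω → F n ω)
    (hF : Tendsto (fun n => mass (fun ω : Fin n → Ω => ∏ t, q (ω t)) (F n)) atTop (𝓝 0)) :
    Tendsto (fun n => mass (fun ω : Fin n → Ω => ∏ t, q (ω t)) (E n)) atTop (𝓝 0) := by
  have hQ : ∀ n, ∀ ω : Fin n → Ω, 0 ≤ ∏ t, q (ω t) := fun n ω =>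
    Finset.prod_nonneg fun t _ => hq _
  exact squeeze_zero (fun n => mass_nonneg (hQ n) _) (fun n => mass_mono (hQ n) (h n)) hF

/-- For long blocks there are codebooks for `B` given the block of `C` that meet the distortion
constraint whenever the block of `A` is conditionally typical. -/
theorem exists_conditional_codebooks {α β γ : Type*} [Fintype α] [Fintype β] [Fintype γ]
    (hq : ∀ ω, 0 ≤ q ω) (hq1 : ∑ ω, q ω = 1) (A : Ω → α) (B : Ω → β) (C : Ω → γ)
    (f : α → β → ℝ) {D η : ℝ} (hf : ∑ ω, q ω * f (A ω) (B ω) ≤ D) (hη : 0 < η) :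
    ∃ E : (n : ℕ) → (Fin n → α) → (Fin n → γ) → Prop,
      Tendsto (fun n => mass (fun ω : Fin n → Ω => ∏ t, q (ω t))
        (fun ω => ¬ E n (fun t => A (ω t)) (fun t => C (ω t)))) atTop (𝓝 0) ∧
      ∀ᶠ n : ℕ in atTop, ∀ M : ℕ, (2 : ℝ) ^ ((n : ℝ) * (condMutualInfo q A B C + 2 * η)) ≤ M →
        ∀ u, ∃ c : Fin M → Fin n → β, ∀ x, E n x u → ∃ m, ∑ t, f (x t) (c m t) ≤ n * (D + η) := by
  classical
  set I := condMutualInfo q A B C with hI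
  have hI' : ∑ ω, q ω * condInfoDensity q A B C ω = I := rfl
  have hI0 : 0 ≤ I := condMutualInfo_nonneg_of_fintype hq A B C
  let T : (n : ℕ) → (Fin n → Ω) → Prop := fun n ω => 0 < ∏ t, q (ω t) ∧
    ∑ t, condInfoDensity q A B C (ω t) ≤ n * (I + η) ∧
    ∑ t, f (A (ω t)) (B (ω t)) ≤ n * (D + η)
  have hQ : ∀ n, ∀ ω : Fin n → Ω, 0 ≤ ∏ t, q (ω t) := fun n ω =>
    Finset.prod_nonneg fun t _ => hq _
  have hT : Tendsto (fun n => mass (fun ω : Fin n → Ω => ∏ t, q (ω t)) fun ω => ¬ T n ω)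
      atTop (𝓝 0) := by
    refine tendsto_mass_mono hq (fun n ω hpos h => ?_) (tendsto_mass_or hq
      (tendsto_mass_lt_sum hq hq1 (condInfoDensity q A B C) (c := I + η) (by linarith))
      (tendsto_mass_lt_sum hq hq1 (fun ω => f (A ω) (B ω)) (c := D + η) (by linarith)))
    by_contra hcon
    push Not at hcon
    exact h ⟨hpos, hcon.1, hcon.2⟩
  refine ⟨fun n x u => Likely (fun ω : Fin n → Ω => ∏ t, q (ω t)) (fun ω t => A (ω t))
    (fun ω t => C (ω t)) (T n) (1 / 4) x u, ?_, ?_⟩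
  · have h4 := hT.div_const (1 / 4)
    rw [zero_div] at h4
    exact squeeze_zero (fun n => mass_nonneg (hQ n) _)
      (fun n => mass_not_likely_le (hQ n) _ _ (T n) (by norm_num)) h4
  · have h5 := tendsto_pow_mul_exp_neg_two_rpow (Fintype.card α) (by positivity)
      (c := 1 / 2) (by norm_num) hη
    filter_upwards [h5.eventually_lt_const (by norm_num : (0 : ℝ) < 1 / 2)] with n hn M hM u
    set Q : (Fin n → Ω) → ℝ := fun ω => ∏ t, q (ω t) with hQdef
    have hne : Nonempty Ω := by
      by_contra h
      rw [not_nonempty_iff] at h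
      simp at hq1
    have hβ : Nonempty (Fin n → β × γ) := hne.map fun ω _ => (B ω, C ω)
    set a : ℝ := (2 : ℝ) ^ ((n : ℝ) * (I + η)) with ha
    have ha1 : 1 ≤ a := one_le_rpow (by norm_num) (by positivity)
    obtain ⟨c, hc, -⟩ := exists_layer (σ := Unit) (hQ n) (fun ω t => A (ω t)) (fun _ => ())
      (V := fun ω t => (B (ω t), C (ω t))) (V' := fun ω t => C (ω t)) (ρ := fun v t => (v t).2)
      (fun _ => rfl) (T n) (a := a) (b := 1) (by positivity) one_pos
      (fun ω hω => by
        rw [prob_pi_triple_eq hq A B C hω.1]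
        have h6 : (2 : ℝ) ^ (∑ t, condInfoDensity q A B C (ω t)) ≤ a :=
          rpow_le_rpow_of_exponent_le (by norm_num) hω.2.1
        have h7 := prob_nonneg (hQ n) (fun ω t => (B (ω t), C (ω t)))
          (fun t => (B (ω t), C (ω t)))
        have h8 := prob_nonneg (hQ n) (fun ω => ((fun t => A (ω t)), fun t => C (ω t)))
          ((fun t => A (ω t)), fun t => C (ω t))
        gcongr)
      (fun ω hω => by
        rw [one_mul, prob_unit_prod _ (fun (ω : Fin n → Ω) t => C (ω t)),
          prob_unit_prod _ (fun (ω : Fin n → Ω) t => (B (ω t), C (ω t))), mul_comm])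
      (M := M) (K := 2 * M + 1) (by positivity) (by
        have h6 : (1 - 1 / (2 * a)) ^ M ≤ exp (-(1 / 2 * (2 : ℝ) ^ ((n : ℝ) * η))) := by
          refine one_sub_pow_le_exp (by linarith) (le_trans (le_of_eq ?_) hM)
          rw [ha, ← rpow_add (by norm_num)]
          congr 1; ring
        have h7 : exp (2 * (1 / 1) * M - (2 * M + 1)) < 1 / 2 := by
          have : 2 * (1 / 1) * (M : ℝ) - (2 * M + 1) = -1 := by ring
          rw [this, exp_neg, inv_lt_comm₀ (exp_pos _) (by norm_num)]
          linarith [exp_one_gt_d9]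
        have h8 := mul_le_mul_of_nonneg_left h6
          (by positivity : (0 : ℝ) ≤ (Fintype.card α : ℝ) ^ n)
        simp only [Fintype.card_pi_const, Fintype.card_unit, Nat.cast_pow, Nat.cast_one, one_mul]
        linarith)
      (by linarith) (δ := 1 / 4) (by norm_num) (by norm_num) u
    refine ⟨fun m t => (c m t).1, fun x hx => ?_⟩
    obtain ⟨m, hm, -⟩ := hc x hx
    obtain ⟨ω, hω, -, rfl, hω'⟩ := hm.exists (by norm_num)
    refine ⟨m, ?_⟩
    simp only [← hω']
    exact hω.2.2

end Asymptotics

/-! ### Superposition codebooks for long blocks -/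

section Superposition

variable {Ω 𝒲 σ β β' : Type*} [Fintype Ω] {q : Ω → ℝ}

theorem mutualInfo_mono_right (hq : ∀ ω, 0 ≤ q ω) (W : Ω → 𝒲) {V : Ω → β} {V' : Ω → β'}
    (h : ∀ ω ω', V ω = V ω' → V' ω = V' ω') : mutualInfo q W V' ≤ mutualInfo q W V := by
  have := entropy_sub_le_of_factor hq W h
  rw [mutualInfo_eq hq, mutualInfo_eq hq]
  linarith

theorem entropy_pair_factor (W : Ω → 𝒲) (y : 𝒲 → σ) (V : Ω → β) :
    entropy q (fun ω => (W ω, y (W ω), V ω)) = entropy q (fun ω => (W ω, V ω)) :=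
  entropy_congr fun ω ω' => by
    simp only [Prod.mk.injEq]
    exact ⟨fun h => ⟨h.1, h.2.2⟩, fun h => ⟨h.1, congrArg y h.1, h.2⟩⟩

theorem mutualInfo_sub_mono_right (hq : ∀ ω, 0 ≤ q ω) (W : Ω → 𝒲) (y : 𝒲 → σ)
    {V : Ω → β} {V' : Ω → β'} (h : ∀ ω ω', V ω = V ω' → V' ω = V' ω') :
    mutualInfo q W V' - mutualInfo q (fun ω => y (W ω)) V' ≤
      mutualInfo q W V - mutualInfo q (fun ω => y (W ω)) V := by
  have h1 := entropy_sub_le_of_factor hq W (B := fun ω => (y (W ω), V ω))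
    (C := fun ω => (y (W ω), V' ω)) fun ω ω' hω =>
      Prod.ext (Prod.mk.inj hω).1 (h _ _ (Prod.mk.inj hω).2)
  rw [entropy_pair_factor, entropy_pair_factor] at h1
  rw [mutualInfo_eq hq, mutualInfo_eq hq, mutualInfo_eq hq, mutualInfo_eq hq]
  linarith

theorem mutualInfo_const (hq : ∀ ω, 0 ≤ q ω) (hq1 : ∑ ω, q ω = 1) (W : Ω → 𝒲) {V : Ω → β} {v₀ : β}
    (h : ∀ ω, V ω = v₀) : mutualInfo q W V = 0 := by
  obtain rfl : V = fun _ => v₀ := funext h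
  rw [mutualInfo_eq hq, entropy_const hq1, entropy_congr (A := fun ω => (W ω, v₀)) (B := W)
    (by simp)]
  ring

theorem prod_range_rpow_sub (f : ℕ → ℝ) (c : ℝ) (n s : ℕ) :
    ∏ r ∈ range s, (2 : ℝ) ^ ((n : ℝ) * (f (r + 1) - f r + c)) =
      2 ^ ((n : ℝ) * (f s - f 0 + s * c)) := by
  rw [← rpow_sum_of_pos (by norm_num), ← Finset.mul_sum, Finset.sum_add_distrib,
    Finset.sum_range_sub]
  simp

/-- For long blocks there are sets of code words `C s`, and subsets `L s y` of words compatible with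
the side information `y`, such that, for most source blocks, some chain of words is jointly typical
with the source block. -/
theorem exists_superposition_codebooks [Fintype 𝒲] [Fintype σ] [Fintype β]
    (hq : ∀ ω, 0 ≤ q ω) (hq1 : ∑ ω, q ω = 1) (W : Ω → 𝒲) (y : 𝒲 → σ) {V : ℕ → Ω → β}
    {ρ : ℕ → β → β} (hρ : ∀ s ω, ρ s (V (s + 1) ω) = V s ω) {v₀ : β} (hV : ∀ ω, V 0 ω = v₀)
    {E : (n : ℕ) → (Fin n → Ω) → Prop}
    (hE : Tendsto (fun n => mass (fun ω : Fin n → Ω => ∏ t, q (ω t)) fun ω => ¬ E n ω) atTop (𝓝 0))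
    (S : ℕ) {η ν : ℝ} (hη : 0 < η) (hν : 0 < ν) :
    ∀ᶠ n : ℕ in atTop, ∃ (C : ℕ → Finset (Fin n → β)) (L : ℕ → (Fin n → σ) → Finset (Fin n → β))
      (good : (Fin n → 𝒲) → Prop),
      (∀ s ≤ S, ((C s).card : ℝ) ≤ (2 : ℝ) ^ ((n : ℝ) * (mutualInfo q W (V s) + S * (4 * η)))) ∧
      (∀ s ≤ S, ∀ z, ((L s z).card : ℝ) ≤ (2 : ℝ) ^ ((n : ℝ) * (mutualInfo q W (V s) -
        mutualInfo q (fun ω => y (W ω)) (V s) + S * (7 * η)))) ∧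
      (∀ s, ∀ v ∈ C (s + 1), (fun t => ρ s (v t)) ∈ C s) ∧
      (∀ s < S, ∀ z, ∀ v ∈ L (s + 1) z, (fun t => ρ s (v t)) ∈ L s z) ∧
      mass (fun ω : Fin n → Ω => ∏ t, q (ω t)) (fun ω => ¬ good fun t => W (ω t)) ≤ ν ∧
      ∀ w, good w → ∃ v, v ∈ C S ∧ v ∈ L S (fun t => y (w t)) ∧
        ∃ ω : Fin n → Ω, E n ω ∧ (fun t => W (ω t)) = w ∧ (fun t => V S (ω t)) = v := by
  classical
  set I : ℕ → ℝ := fun s => mutualInfo q W (V s) with hI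
  set J : ℕ → ℝ := fun s => mutualInfo q (fun ω => y (W ω)) (V s) with hJ
  have hfac : ∀ s ω ω', V (s + 1) ω = V (s + 1) ω' → V s ω = V s ω' := fun s ω ω' h => by
    rw [← hρ s ω, ← hρ s ω', h]
  have hΔI : ∀ s, 0 ≤ I (s + 1) - I s := fun s =>
    sub_nonneg.2 (mutualInfo_mono_right hq W (hfac s))
  have hΔ : ∀ s, 0 ≤ (I (s + 1) - I s) - (J (s + 1) - J s) := fun s => by
    have := mutualInfo_sub_mono_right hq W y (hfac s)
    simp only [hI, hJ]; linarith
  have hI0 : I 0 = 0 := mutualInfo_const hq hq1 W hV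
  have hJ0 : J 0 = 0 := mutualInfo_const hq hq1 (fun ω => y (W ω)) hV
  have hQ : ∀ n, ∀ ω : Fin n → Ω, 0 ≤ ∏ t, q (ω t) := fun n ω =>
    Finset.prod_nonneg fun t _ => hq _
  let T : (n : ℕ) → (Fin n → Ω) → Prop := fun n ω => 0 < ∏ t, q (ω t) ∧ E n ω ∧
    (∀ s : Fin (S + 1), |∑ t, infoDensity q W (V s) (ω t) - n * I s| ≤ n * η) ∧
    (∀ s : Fin (S + 1), |∑ t, infoDensity q (fun ω => y (W ω)) (V s) (ω t) - n * J s| ≤ n * η)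
  have hT : Tendsto (fun n => mass (fun ω : Fin n → Ω => ∏ t, q (ω t)) fun ω => ¬ T n ω)
      atTop (𝓝 0) := by
    refine tendsto_mass_mono hq (fun n ω hpos h => ?_) (tendsto_mass_or hq hE (tendsto_mass_or hq
      (tendsto_mass_exists hq fun s : Fin (S + 1) =>
        tendsto_mass_abs_sum hq hq1 (infoDensity q W (V s)) hη)
      (tendsto_mass_exists hq fun s : Fin (S + 1) =>
        tendsto_mass_abs_sum hq hq1 (infoDensity q (fun ω => y (W ω)) (V s)) hη)))
    by_contra hcon
    simp only [not_or, not_exists, not_not] at hcon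
    exact h ⟨hpos, hcon.1, hcon.2.1, hcon.2.2⟩
  set δ : ℝ := 1 / 2 ^ (S + 1) with hδ
  have hδ0 : 0 < δ := by positivity
  have hSδ : 2 ^ S * δ = 1 / 2 := by rw [hδ, pow_succ]; field_simp
  have hlik : ∀ᶠ n in atTop,
      mass (fun ω : Fin n → Ω => ∏ t, q (ω t)) (fun ω => ¬ T n ω) / δ < ν := by
    have h4 := hT.div_const δ
    rw [zero_div] at h4
    exact h4.eventually_lt_const hν
  have hw := (tendsto_pow_mul_exp_neg_two_rpow (Fintype.card 𝒲) (by positivity)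
    (c := 1 / 2) (by norm_num) hη).eventually_lt_const (by norm_num : (0 : ℝ) < 1 / 2)
  have hy := ((tendsto_pow_mul_exp_neg_two_rpow (Fintype.card σ) (by positivity)
    (c := 1) (by norm_num) hη).mul_const (exp 2)).eventually_lt_const
    (by norm_num : (0 : ℝ) * exp 2 < 1 / 2)
  filter_upwards [hlik, hw, hy, eventually_two_le_rpow hη] with n hlik hw hy hx
  set x : ℝ := (2 : ℝ) ^ ((n : ℝ) * η) with hxdef
  set a : ℕ → ℝ := fun s => (2 : ℝ) ^ ((n : ℝ) * (I (s + 1) - I s + 2 * η)) with ha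
  set b : ℕ → ℝ := fun s => (2 : ℝ) ^ ((n : ℝ) * (J (s + 1) - J s - 2 * η)) with hb
  set M : ℕ → ℕ := fun s => ⌈(2 : ℝ) ^ ((n : ℝ) * (I (s + 1) - I s + 3 * η))⌉₊ with hM
  set K : ℕ → ℝ := fun s =>
    (2 : ℝ) ^ ((n : ℝ) * ((I - J) (s + 1) - (I - J) s + 7 * η)) with hK
  have hone : ∀ z : ℝ, 0 ≤ z → (1 : ℝ) ≤ 2 ^ ((n : ℝ) * z) := fun z hz =>
    one_le_rpow (by norm_num) (by positivity)
  have ha1 : ∀ s, 1 ≤ a s := fun s => hone _ (by linarith [hΔI s])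
  have hM1 : ∀ s, a s * x ≤ M s := fun s => by
    refine le_trans (le_of_eq ?_) (Nat.le_ceil _)
    rw [ha, hxdef, ← rpow_add (by norm_num)]
    congr 1; ring
  have hM2 : ∀ s, (M s : ℝ) ≤ (2 : ℝ) ^ ((n : ℝ) * (I (s + 1) - I s + 4 * η)) := fun s => by
    refine (natCeil_le_two_mul (hone _ (by linarith [hΔI s]))).trans ?_
    have : (2 : ℝ) ^ ((n : ℝ) * (I (s + 1) - I s + 4 * η)) =
        x * 2 ^ ((n : ℝ) * (I (s + 1) - I s + 3 * η)) := by
      rw [hxdef, ← rpow_add (by norm_num)]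
      congr 1; ring
    rw [this]
    gcongr
  have hKM : ∀ s, 2 * (1 / b s) * M s - K s ≤ 2 - x := fun s => by
    set X : ℝ := 2 ^ ((n : ℝ) * ((I (s + 1) - I s) - (J (s + 1) - J s) + 6 * η)) with hX
    have hX1 : 1 ≤ X := hone _ (by linarith [hΔ s])
    have h1 : K s = x * X := by
      simp only [hK, hxdef, hX, Pi.sub_apply]
      rw [← rpow_add (by norm_num)]
      congr 1; ring
    have h2 : (1 / b s) * M s ≤ X := by
      have : X = (1 / b s) * (2 : ℝ) ^ ((n : ℝ) * (I (s + 1) - I s + 4 * η)) := by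
        rw [hX, hb, one_div, ← rpow_neg (by norm_num), ← rpow_add (by norm_num)]
        congr 1; ring
      rw [this]
      exact mul_le_mul_of_nonneg_left (hM2 s) (by positivity)
    rw [h1]
    nlinarith [mul_le_mul_of_nonneg_left hX1 (by linarith : 0 ≤ x - 2)]
  obtain ⟨C, L, hC, hL, hCρ, hLρ, hcov⟩ := exists_tree (hQ n) (fun ω t => W (ω t))
    (fun w t => y (w t)) (V := fun s ω t => V s (ω t)) (ρ := fun s v t => ρ s (v t))
    (fun s ω => funext fun t => hρ s (ω t)) (T n) S (a := a) (b := b)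
    (fun s => by linarith [ha1 s]) (fun s => by positivity)
    (fun s hs ω hω => by
      rw [prob_pi_pair_eq hq W (V (s + 1)) hω.1, prob_pi_pair_eq hq W (V s) hω.1]
      have h1 := (abs_le.1 (hω.2.2.1 ⟨s, by omega⟩)).1
      have h2 := (abs_le.1 (hω.2.2.1 ⟨s + 1, by omega⟩)).2
      have h3 : (2 : ℝ) ^ (∑ t, infoDensity q W (V (s + 1)) (ω t)) ≤
          a s * (2 : ℝ) ^ (∑ t, infoDensity q W (V s) (ω t)) := by
        rw [ha, ← rpow_add (by norm_num)]
        refine rpow_le_rpow_of_exponent_le (by norm_num) ?_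
        simp only at h1 h2
        linarith
      have h4 := prob_nonneg (hQ n) (fun ω t => V (s + 1) (ω t)) (fun t => V (s + 1) (ω t))
      have h5 := prob_nonneg (hQ n) (fun ω t => V s (ω t)) (fun t => V s (ω t))
      have h6 := prob_nonneg (hQ n) (fun ω t => W (ω t)) (fun t => W (ω t))
      have := mul_le_mul_of_nonneg_left h3 (mul_nonneg (mul_nonneg h6 h4) h5)
      linarith)
    (fun s hs ω hω => by
      rw [prob_pi_pair_eq hq (fun ω => y (W ω)) (V (s + 1)) hω.1,
        prob_pi_pair_eq hq (fun ω => y (W ω)) (V s) hω.1]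
      have h1 := (abs_le.1 (hω.2.2.2 ⟨s, by omega⟩)).2
      have h2 := (abs_le.1 (hω.2.2.2 ⟨s + 1, by omega⟩)).1
      have h3 : b s * (2 : ℝ) ^ (∑ t, infoDensity q (fun ω => y (W ω)) (V s) (ω t)) ≤
          (2 : ℝ) ^ (∑ t, infoDensity q (fun ω => y (W ω)) (V (s + 1)) (ω t)) := by
        rw [hb, ← rpow_add (by norm_num)]
        refine rpow_le_rpow_of_exponent_le (by norm_num) ?_
        simp only at h1 h2
        linarith
      have h4 := prob_nonneg (hQ n) (fun ω t => V (s + 1) (ω t)) (fun t => V (s + 1) (ω t))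
      have h5 := prob_nonneg (hQ n) (fun ω t => V s (ω t)) (fun t => V s (ω t))
      have h6 := prob_nonneg (hQ n) (fun ω t => y (W (ω t))) (fun t => y (W (ω t)))
      have := mul_le_mul_of_nonneg_left h3 (mul_nonneg (mul_nonneg h6 h4) h5)
      linarith)
    (M := M) (K := K) (fun s => by positivity)
    (fun s _ => by
      have h1 := one_sub_pow_le_exp (by linarith [ha1 s]) (hM1 s)
      have h2 : exp (2 * (1 / b s) * M s - K s) ≤ exp (-(1 * x)) * exp 2 := by
        rw [← exp_add, exp_le_exp]
        linarith [hKM s]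
      have h3 := mul_le_mul_of_nonneg_left h1
        (by positivity : (0 : ℝ) ≤ (Fintype.card 𝒲 : ℝ) ^ n)
      have h4 := mul_le_mul_of_nonneg_left h2
        (by positivity : (0 : ℝ) ≤ (Fintype.card σ : ℝ) ^ n)
      simp only [Fintype.card_pi_const, Nat.cast_pow]
      linarith)
    hδ0 (by rw [hSδ]; norm_num) (fun _ => v₀)
  refine ⟨C, L, fun w => Likely (fun ω : Fin n → Ω => ∏ t, q (ω t)) (fun ω t => W (ω t))
    (fun ω t => V 0 (ω t)) (T n) δ w (fun _ => v₀), fun s hs => ?_, fun s hs z => ?_, hCρ, hLρ,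
    ?_, fun w hw => ?_⟩
  · calc ((C s).card : ℝ) ≤ ∏ r ∈ range s, (M r : ℝ) := by exact_mod_cast hC s
      _ ≤ ∏ r ∈ range s, (2 : ℝ) ^ ((n : ℝ) * (I (r + 1) - I r + 4 * η)) :=
        Finset.prod_le_prod (fun _ _ => by positivity) fun r _ => hM2 r
      _ = 2 ^ ((n : ℝ) * (I s - I 0 + s * (4 * η))) := prod_range_rpow_sub I (4 * η) n s
      _ ≤ _ := by
        refine rpow_le_rpow_of_exponent_le (by norm_num) ?_
        rw [hI0, sub_zero]
        gcongr
  · calc ((L s z).card : ℝ) ≤ ∏ r ∈ range s, K r := hL s hs z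
      _ = 2 ^ ((n : ℝ) * ((I - J) s - (I - J) 0 + s * (7 * η))) :=
        prod_range_rpow_sub (I - J) (7 * η) n s
      _ ≤ _ := by
        refine rpow_le_rpow_of_exponent_le (by norm_num) ?_
        simp only [Pi.sub_apply, hI0, hJ0, sub_zero]
        gcongr
  · refine le_trans ?_ hlik.le
    refine le_trans (mass_mono (hQ n) fun ω _ h => ?_) (mass_not_likely_le (hQ n)
      (fun ω t => W (ω t)) (fun ω t => V 0 (ω t)) (T n) hδ0)
    simpa only [hV] using h
  · obtain ⟨v, h1, h2, h3⟩ := hcov w hw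
    obtain ⟨ω, hω, -, h4, h5⟩ := h3.exists (by rw [hSδ]; norm_num)
    exact ⟨v, h1, h2, ω, hω.2.1, h4, h5⟩

end Superposition

/-! ### The words that the users hold -/

section Words

variable {N m : ℕ} {𝒳 𝒴 : Type*} {𝒳h : Fin N → Type*}

/-- Erase the letters of all but the last `s` users. -/
def mask (s : ℕ) (v : ((i : Fin N) → Option (𝒳h i)) × Option (Fin m)) :
    ((i : Fin N) → Option (𝒳h i)) × Option (Fin m) :=
  (fun i => if N ≤ i + s then v.1 i else none, if 0 < s then v.2 else none)

theorem mask_mask {s s' : ℕ} (h : s ≤ s')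
    (v : ((i : Fin N) → Option (𝒳h i)) × Option (Fin m)) : mask s (mask s' v) = mask s v := by
  unfold mask
  ext1
  · funext i
    simp only
    split_ifs <;> first | rfl | omega
  · simp only
    split_ifs <;> first | rfl | omega

/-- The letters of the last `s` users (except the last one) and of the auxiliary variable. -/
def word (s : ℕ) (ω : Joint 𝒳 𝒴 𝒳h m) : ((i : Fin N) → Option (𝒳h i)) × Option (Fin m) :=
  mask s (fun i => if (i : ℕ) + 1 < N then some (Joint.Xhat i ω) else none, some (Joint.U ω))

theorem mask_word {s s' : ℕ} (h : s ≤ s') (ω : Joint 𝒳 𝒴 𝒳h m) :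
    mask s (word s' ω) = word s ω := mask_mask h _

theorem word_zero (ω : Joint 𝒳 𝒴 𝒳h m) : word 0 ω = (fun _ => none, none) := by
  unfold word mask
  ext1
  · funext i
    simp
  · simp

theorem word_eq_iff (i : Fin N) (ω ω' : Joint 𝒳 𝒴 𝒳h m) :
    word (N - i) ω = word (N - i) ω' ↔ Joint.tailU i ω = Joint.tailU i ω' := by
  have hi : 0 < N - (i : ℕ) := by omega
  simp only [word, mask, Joint.tailU, Prod.mk.injEq, hi, if_true, Option.some.injEq]
  refine and_congr ⟨fun h => funext fun j => ?_, fun h => funext fun j => ?_⟩ Iff.rfl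
  · have h1 := congrFun h j.1
    have h2 : (i : ℕ) ≤ (j.1 : ℕ) := j.2.1
    have h3 : N ≤ (j.1 : ℕ) + (N - i) := by omega
    simp only [if_pos h3, if_pos j.2.2] at h1
    exact Option.some.inj h1
  · by_cases h1 : N ≤ (j : ℕ) + (N - i)
    · by_cases h2 : (j : ℕ) + 1 < N
      · have h3 := congrFun h ⟨j, by rw [Fin.le_def]; omega, h2⟩
        simp only [if_pos h1, if_pos h2]
        exact congrArg some h3
      · simp only [if_neg h2]
    · simp only [if_neg h1]

end Words

theorem condMutualInfo_eq_sub {Ω α β γ : Type*} [Fintype Ω] {q : Ω → ℝ} (hq : ∀ ω, 0 ≤ q ω)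
    (A : Ω → α) (B : Ω → β) (C : Ω → γ) :
    condMutualInfo q A B C = mutualInfo q (fun ω => (A ω, C ω)) B - mutualInfo q C B := by
  rw [condMutualInfo_eq hq, mutualInfo_eq hq, mutualInfo_eq hq,
    entropy_congr (A := fun ω => (A ω, B ω, C ω)) (B := fun ω => ((A ω, C ω), B ω))
      (fun ω ω' => by simp only [Prod.mk.injEq]; tauto),
    entropy_congr (A := fun ω => (B ω, C ω)) (B := fun ω => (C ω, B ω))
      (fun ω ω' => by simp only [Prod.mk.injEq]; tauto)]
  ring

/-! ### Achievability -/

/-- If the distortion of a user is at most `a` on good source words, then its expected distortion is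
at most `a` plus the contribution of the other source words. -/
theorem Code.expDistortion_le {k l n : ℕ} {𝒳 𝒴 : Type*} [Fintype 𝒳] [Fintype 𝒴]
    {𝒳h : Fin (k + l) → Type*} {P : 𝒳 × 𝒴 → ℝ} {d : (i : Fin (k + l)) → 𝒳 → 𝒳h i → ℝ}
    {M : Fin (k + l + 1) → ℕ} (c : Code k l n 𝒳 𝒴 𝒳h M)
    (hn : 0 < n) {Ω : Type*} [Fintype Ω] {q : Ω → ℝ} (hq : ∀ ω, 0 ≤ q ω) (hq1 : ∑ ω, q ω = 1)
    (W : Ω → 𝒳 × 𝒴) (hP : ∀ x y, prob q W (x, y) = P (x, y)) (i : Fin (k + l)) {B a : ℝ}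
    (ha : 0 ≤ a) (hB : ∀ x z, d i x z ≤ B) (good : (Fin n → 𝒳 × 𝒴) → Prop)
    (hgood : ∀ w, good w → ∑ t, d i (w t).1
      (c.recon (fun t => (w t).1) (fun t => (w t).2) i t) ≤ n * a) :
    c.expDistortion P d i ≤ a + B * mass (fun ω : Fin n → Ω => ∏ t, q (ω t))
      (fun ω => ¬ good fun t => W (ω t)) := by
  classical
  have hn' : (0 : ℝ) < n := by exact_mod_cast hn
  unfold Code.expDistortion
  rw [sum_sum_eq_sum_pair]
  have hPQ : ∀ w : Fin n → 𝒳 × 𝒴, ∏ t, P ((w t).1, (w t).2) =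
      prob (fun ω : Fin n → Ω => ∏ t, q (ω t))
        (fun ω t => W (ω t)) w := by
    intro w
    rw [prob_pi W]
    exact Finset.prod_congr rfl fun t _ => (hP _ _).symm
  have hQ : ∀ ω : Fin n → Ω, 0 ≤ ∏ t, q (ω t) := fun ω =>
    Finset.prod_nonneg fun t _ => hq _
  have hbound : ∀ w : Fin n → 𝒳 × 𝒴, 1 / (n : ℝ) * ∑ t, d i (w t).1
      (c.recon (fun t => (w t).1) (fun t => (w t).2) i t) ≤
      a + B * if good w then 0 else 1 := by
    intro w
    rw [one_div, inv_mul_le_iff₀ hn']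
    by_cases hw : good w
    · simpa [hw] using hgood w hw
    · have h5 := Finset.sum_le_card_nsmul univ (fun t => d i (w t).1
        (c.recon (fun t => (w t).1) (fun t => (w t).2) i t)) B fun t _ => hB _ _
      simp only [Finset.card_univ, Fintype.card_fin, nsmul_eq_mul] at h5
      simp only [hw, if_false, mul_one]
      refine h5.trans (mul_le_mul_of_nonneg_left ?_ hn'.le)
      linarith
  calc _ ≤ ∑ w : Fin n → 𝒳 × 𝒴, prob (fun ω : Fin n → Ω => ∏ t, q (ω t))
        (fun ω t => W (ω t)) w *
        (a + B * if good w then 0 else 1) := by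
        refine Finset.sum_le_sum fun w _ => ?_
        rw [hPQ]
        exact mul_le_mul_of_nonneg_left (hbound w) (prob_nonneg hQ _ _)
    _ = a + B * mass (fun ω : Fin n → Ω => ∏ t, q (ω t))
        (fun ω => ¬ good fun t => W (ω t)) := by
        rw [sum_prob_mul _ _ fun w => a + B * if good w then 0 else 1]
        simp only [mul_add, Finset.sum_add_distrib, ← Finset.sum_mul, sum_pi_prod_eq_one hq1]
        unfold mass
        rw [Finset.mul_sum, one_mul]
        congr 1
        refine Finset.sum_congr rfl fun ω _ => ?_
        split_ifs <;> simp_all [mul_comm]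

section Achievability

variable {k l : ℕ} {𝒳 𝒴 : Type*} [Fintype 𝒳] [Fintype 𝒴]
    {𝒳h : Fin (k + l) → Type*} [∀ i, Fintype (𝒳h i)]
    {P : 𝒳 × 𝒴 → ℝ} {d : (i : Fin (k + l)) → 𝒳 → 𝒳h i → ℝ} {D : Fin (k + l) → ℝ}
    {R : Fin (k + l + 1) → ℝ}

theorem nonneg_of_mem_infoRegion (hl : 1 ≤ l) {m : ℕ} (h : R ∈ infoRegion P d D m)
    (i : Fin (k + l + 1)) : 0 ≤ R i := by
  classical
  obtain ⟨q, ⟨hq, hq1⟩, -, h1, h2, h3, -⟩ := h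
  induction i using Fin.lastCases with
  | last =>
    exact (condMutualInfo_nonneg_of_fintype hq _ _ _).trans
      (h3 ⟨k + l - 1, by omega⟩ (by simp only; omega))
  | cast i =>
    by_cases hi : (i : ℕ) < k
    · exact (condMutualInfo_nonneg_of_fintype hq _ _ _).trans (h1 i hi)
    · refine le_trans ?_ (h2 i (not_lt.1 hi))
      rw [mutualInfo_eq hq]
      linarith [entropy_prod_le hq hq1 (fun ω => (Joint.X ω, Joint.Y ω))
        (Joint.tailU (𝒳 := 𝒳) (𝒴 := 𝒴) (m := m) i)]

theorem achievable_of_mem_infoRegion (hl : 1 ≤ l) (hd : ∀ i x z, 0 ≤ d i x z) {m : ℕ}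
    (h : R ∈ infoRegion P d D m) {δ : ℝ} (hδ : 0 < δ) :
    Achievable P d D fun i => R i + δ := by
  classical
  have hR := nonneg_of_mem_infoRegion hl h
  obtain ⟨q, ⟨hq, hq1⟩, hXY, h1, h2, h3, h4⟩ := h
  intro ε hε
  let e : Fin (k + l) := ⟨k + l - 1, by omega⟩
  have he : (e : ℕ) + 1 = k + l := by simp only [e]; omega
  have hne : Nonempty (Joint 𝒳 𝒴 𝒳h m) := by
    by_contra h
    rw [not_nonempty_iff] at h
    simp at hq1
  obtain ⟨ω₀⟩ := hne
  obtain ⟨B, hB0, hB⟩ : ∃ B : ℝ, 0 ≤ B ∧ ∀ i x z, d i x z ≤ B := by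
    refine ⟨∑ i, ∑ x, ∑ z, d i x z, Finset.sum_nonneg fun i _ => Finset.sum_nonneg fun x _ =>
      Finset.sum_nonneg fun z _ => hd i x z, fun i x z => ?_⟩
    exact (Finset.single_le_sum (f := fun z => d i x z) (fun z _ => hd i x z) (mem_univ z)).trans
      ((Finset.single_le_sum (f := fun x => ∑ z, d i x z) (fun x _ => Finset.sum_nonneg fun z _ =>
        hd i x z) (mem_univ x)).trans (Finset.single_le_sum (f := fun i => ∑ x, ∑ z, d i x z)
        (fun i _ => Finset.sum_nonneg fun x _ => Finset.sum_nonneg fun z _ => hd i x z)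
        (mem_univ i)))
  have hD0 : ∀ i, 0 ≤ D i := fun i => (h4 i).trans' (Finset.sum_nonneg fun ω _ =>
    mul_nonneg (hq ω) (hd _ _ _))
  set N : ℝ := ((k + l : ℕ) : ℝ) with hN
  have hN1 : 1 ≤ N := by rw [hN]; exact_mod_cast (by omega : 1 ≤ k + l)
  obtain ⟨η, hη, hηε, hηδ⟩ : ∃ η : ℝ, 0 < η ∧ η ≤ ε / 2 ∧ N * (7 * η) ≤ δ := by
    refine ⟨min (ε / 2) (δ / (7 * N)), by positivity, min_le_left _ _, ?_⟩
    calc N * (7 * min (ε / 2) (δ / (7 * N))) ≤ N * (7 * (δ / (7 * N))) := by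
          gcongr; exact min_le_right _ _
      _ = δ := by field_simp
  obtain ⟨ν, hν, hνε⟩ : ∃ ν : ℝ, 0 < ν ∧ B * ν ≤ ε / 2 := by
    refine ⟨ε / 2 / (B + 1), by positivity, ?_⟩
    rw [mul_div_assoc', div_le_iff₀ (by positivity)]
    nlinarith
  obtain ⟨E, hE, hlast⟩ := exists_conditional_codebooks hq hq1 Joint.X (Joint.Xhat e) Joint.U
    (d e) (h4 e) hη
  have hEv : Tendsto (fun n => mass (fun ω : Fin n → Joint 𝒳 𝒴 𝒳h m => ∏ t, q (ω t)) fun ω =>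
      ¬ ((∀ i, ∑ t, d i (Joint.X (ω t)) (Joint.Xhat i (ω t)) ≤ n * (D i + η)) ∧
        E n (fun t => Joint.X (ω t)) (fun t => Joint.U (ω t)))) atTop (𝓝 0) := by
    refine tendsto_mass_mono hq (fun n ω _ h => ?_) (tendsto_mass_or hq hE
      (tendsto_mass_exists hq fun i => tendsto_mass_lt_sum hq hq1
        (fun ω => d i (Joint.X ω) (Joint.Xhat i ω)) (c := D i + η) (by linarith [h4 i])))
    by_contra hcon
    simp only [not_or, not_exists, not_not, not_lt] at hcon
    exact h ⟨hcon.2, hcon.1⟩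
  have hsup := exists_superposition_codebooks hq hq1 (fun ω => (Joint.X ω, Joint.Y ω)) Prod.snd
    (V := word) (ρ := mask) (fun s ω => mask_word (Nat.le_succ s) ω) word_zero hEv (k + l) hη hν
  obtain ⟨n₀, hn₀⟩ := eventually_atTop.1 (hlast.and (hsup.and
    ((eventually_ge_atTop 1).and (eventually_two_le_rpow hη))))
  refine ⟨n₀, fun n hn => ?_⟩
  obtain ⟨hlast, ⟨C, L, good, hC, hL, hCρ, hLρ, hgood, hcov⟩, hn1, htwo⟩ := hn₀ n hn
  have hn' : (0 : ℝ) < n := by exact_mod_cast hn1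
  let M : Fin (k + l + 1) → ℕ := fun i => ⌊(2 : ℝ) ^ ((n : ℝ) * (R i + δ))⌋₊
  have hM : ∀ i, 0 < M i := fun i => by
    rw [Nat.floor_pos]
    exact one_le_rpow (by norm_num) (mul_nonneg hn'.le (by linarith [hR i]))
  have hle : ∀ (i : Fin (k + l + 1)) (S : ℕ) (z : ℝ), (S : ℝ) ≤ (2 : ℝ) ^ ((n : ℝ) * z) →
      z ≤ R i + δ → S ≤ M i := fun i S z hS hz => by
    refine Nat.le_floor (hS.trans (rpow_le_rpow_of_exponent_le (by norm_num) ?_))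
    gcongr
  have hlevel : ∀ i : Fin (k + l), k + l - (i : ℕ) ≤ k + l := fun i => Nat.sub_le _ _
  have hLM : ∀ i : Fin (k + l), (i : ℕ) < k → ∀ y, (L (k + l - i) y).card ≤ M i.castSucc := by
    intro i hi y
    refine hle _ _ _ (hL _ (hlevel i) y) ?_
    have e1 : mutualInfo q (fun ω => (Joint.X ω, Joint.Y ω)) (word (k + l - i)) -
        mutualInfo q (fun ω => Joint.Y ω) (word (k + l - i)) =
        condMutualInfo q Joint.X (Joint.tailU i) Joint.Y := by
      rw [← condMutualInfo_eq_sub hq Joint.X (word (k + l - i)) Joint.Y]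
      exact condMutualInfo_congr q (fun _ _ => Iff.rfl) (word_eq_iff i) (fun _ _ => Iff.rfl)
    have := h1 i hi
    linarith
  have hCM : ∀ i : Fin (k + l), k ≤ (i : ℕ) → (C (k + l - i)).card ≤ M i.castSucc := by
    intro i hi
    refine hle _ _ _ (hC _ (hlevel i)) ?_
    have e1 : mutualInfo q (fun ω => (Joint.X ω, Joint.Y ω)) (word (k + l - i)) =
        mutualInfo q (fun ω => (Joint.X ω, Joint.Y ω)) (Joint.tailU i) :=
      mutualInfo_congr q (fun _ _ => Iff.rfl) (word_eq_iff i)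
    have := h2 i hi
    have : N * (4 * η) ≤ N * (7 * η) := by gcongr; norm_num
    linarith
  choose c hc using hlast (M (Fin.last (k + l))) (by
    have h5 := condMutualInfo_nonneg_of_fintype hq Joint.X (Joint.Xhat e) Joint.U
    have h6 := h3 e he
    have h7 : 1 * (7 * η) ≤ N * (7 * η) := by gcongr
    refine (Nat.le_ceil _).trans (Nat.cast_le.2 (hle _ _
      (condMutualInfo q Joint.X (Joint.Xhat e) Joint.U + 3 * η)
      ((natCeil_le_two_mul (one_le_rpow (by norm_num) (by positivity))).trans ?_)
      (by linarith)))
    refine (mul_le_mul_of_nonneg_right htwo (by positivity)).trans (le_of_eq ?_)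
    rw [← rpow_add (by norm_num)]
    congr 1; ring)
  choose! top htopC htopL htop using hcov
  let pair : (Fin n → 𝒳) → (Fin n → 𝒴) → Fin n → 𝒳 × 𝒴 := fun x y t => (x t, y t)
  let u₀ : Fin m := Joint.U ω₀
  let aux : (Fin n → ((i : Fin (k + l)) → Option (𝒳h i)) × Option (Fin m)) → Fin n → Fin m :=
    fun v t => (v t).2.getD u₀
  let g : ℕ → (Fin n → 𝒳) → (Fin n → 𝒴) →
      Fin n → ((i : Fin (k + l)) → Option (𝒳h i)) × Option (Fin m) :=
    fun i x y t => mask (k + l - i) (top (pair x y) t)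
  let sel : (Fin n → 𝒳) → (Fin n → 𝒴) → Fin (M (Fin.last (k + l))) := fun x y =>
    if h : E n x (aux (g e x y)) then (hc (aux (g e x y)) x h).choose else ⟨0, hM _⟩
  let recFn : (i : Fin (k + l)) → (Fin n → ((i : Fin (k + l)) → Option (𝒳h i)) × Option (Fin m)) →
      Option (Fin (M (Fin.last (k + l)))) → Fin n → 𝒳h i := fun i v o t =>
    if (i : ℕ) + 1 < k + l then ((v t).1 i).getD (Joint.Xhat i ω₀)
    else o.elim (Joint.Xhat i ω₀) fun j =>
      Function.update (fun i _ _ => Joint.Xhat i ω₀ :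
        (i : Fin (k + l)) → Fin (M (Fin.last (k + l))) → Fin n → 𝒳h i) e (c (aux v)) i j t
  obtain ⟨code, hcode⟩ := exists_code (n := n) (𝒳 := 𝒳) (𝒴 := 𝒴) (𝒳h := 𝒳h) hM (by omega)
    (fun i o => if (i : ℕ) < k then o.elim ∅ (L (k + l - i)) else C (k + l - i))
    (fun i o => by
      split_ifs with hi
      · cases o with
        | none => simp
        | some y => exact hLM i hi y
      · exact hCM i (not_lt.1 hi))
    (fun i v t => mask (k + l - (i + 1)) (v t)) g
    (fun i x y => funext fun t => (mask_mask (by omega) _).symm) sel recFn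
  have hmem : ∀ w, good w → ∀ s ≤ k + l, (fun t => mask s (top w t)) ∈ C s ∧
      (fun t => mask s (top w t)) ∈ L s (fun t => (w t).2) := by
    intro w hw s hs
    induction hs using Nat.decreasingInduction with
    | self =>
      obtain ⟨ω, -, -, hω⟩ := htop w hw
      have : (fun t => mask (k + l) (top w t)) = top w := by
        rw [← hω]
        exact funext fun t => mask_word le_rfl _
      rw [this]
      exact ⟨htopC w hw, htopL w hw⟩
    | of_succ s hs ih =>
      have h5 := hCρ s _ ih.1
      have h6 := hLρ s hs _ _ ih.2
      simp only [mask_mask (Nat.le_succ s)] at h5 h6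
      exact ⟨h5, h6⟩
  have hrecon : ∀ w, good w → ∀ i, ∑ t, d i (w t).1
      (code.recon (fun t => (w t).1) (fun t => (w t).2) i t) ≤ n * (D i + η) := by
    intro w hw i
    have hpair : pair (fun t => (w t).1) (fun t => (w t).2) = w := rfl
    rw [hcode _ _ (fun i => ?_) i]
    · obtain ⟨ω, ⟨hω1, hω2⟩, rfl, hω3⟩ := htop w hw
      by_cases hi : (i : ℕ) + 1 < k + l
      · refine le_trans (le_of_eq (Finset.sum_congr rfl fun t _ => ?_)) (hω1 i)
        simp only [recFn, if_pos hi, g, hpair, ← congrFun hω3 t, mask_word (hlevel i)]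
        have : k + l ≤ (i : ℕ) + (k + l - i) := by omega
        simp [word, mask, hi]
      · obtain rfl : i = e := Fin.ext (by omega)
        have hpos : 0 < k + l - (e : ℕ) := by omega
        have hu : aux (g e (fun t => Joint.X (ω t)) fun t => Joint.Y (ω t)) =
            fun t => Joint.U (ω t) := by
          funext t
          change (mask (k + l - (e : ℕ)) (top (fun t => (Joint.X (ω t), Joint.Y (ω t))) t)).2.getD
            u₀ = _
          rw [← congrFun hω3 t, mask_word (hlevel e)]
          simp [word, mask, hpos]
        have hx : E n (fun t => Joint.X (ω t))
            (aux (g e (fun t => Joint.X (ω t)) fun t => Joint.Y (ω t))) := by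
          rw [hu]; exact hω2
        have hchoice := (hc _ _ hx).choose_spec
        simp only [recFn, if_neg hi, directView, he, if_true, Option.elim, Function.update_self,
          sel, dif_pos hx]
        exact hchoice
    · simp only [g, hpair]
      have := hmem w hw _ (hlevel i)
      by_cases hi : (i : ℕ) < k
      · simp only [sideView, if_pos hi]
        exact this.2
      · simp only [if_neg hi]
        exact this.1
  refine ⟨M, code, fun i => Nat.floor_le (by positivity), fun i => ?_⟩
  refine (code.expDistortion_le hn1 hq hq1 (fun ω => (Joint.X ω, Joint.Y ω)) hXY i
    (by linarith [hD0 i]) (hB i) good fun w hw => hrecon w hw i).trans ?_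
  have := mul_le_mul_of_nonneg_left hgood hB0
  linarith

/-- The region is closed, jointly in the rates and the distortions. -/
theorem isClosed_exists_infoRegion (P : 𝒳 × 𝒴 → ℝ) (d : (i : Fin (k + l)) → 𝒳 → 𝒳h i → ℝ)
    (b : ℕ) : IsClosed {z : (Fin (k + l + 1) → ℝ) × (Fin (k + l) → ℝ) |
      ∃ m ≤ b, z.1 ∈ infoRegion P d z.2 m} := by
  have : {z : (Fin (k + l + 1) → ℝ) × (Fin (k + l) → ℝ) | ∃ m ≤ b, z.1 ∈ infoRegion P d z.2 m} =
      ⋃ m ∈ Set.Iic b, {z | z.1 ∈ infoRegion P d z.2 m} := by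
    ext z; simp
  rw [this]
  exact (Set.finite_Iic b).isClosed_biUnion fun m _ => isClosed_infoRegion_graph P d m

theorem achievableRegion_eq (hl : 1 ≤ l) (hP : P ∈ stdSimplex ℝ (𝒳 × 𝒴))
    (hd : ∀ i x z, 0 ≤ d i x z) :
    achievableRegion P d D = {R | ∃ m : ℕ, R ∈ infoRegion P d D m} := by
  set b := Fintype.card 𝒳 * Fintype.card 𝒴 * (∏ i, Fintype.card (𝒳h i)) + (k + l) with hb
  have hcl := isClosed_exists_infoRegion P d b
  have hcard : {R | ∃ m : ℕ, R ∈ infoRegion P d D m} = {R | ∃ m ≤ b, R ∈ infoRegion P d D m} :=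
    Set.ext fun R => ⟨fun ⟨_, h⟩ => exists_mem_infoRegion_le hl h, fun ⟨m, _, h⟩ => ⟨m, h⟩⟩
  refine Set.Subset.antisymm ?_ ?_
  · rw [hcard]
    refine closure_minimal (fun R hR => ?_)
      (hcl.preimage (f := fun R => (R, D)) (by fun_prop))
    have ht : Tendsto (fun j : ℕ => (R, fun i => D i + 1 / ((j : ℝ) + 1))) atTop
        (𝓝 (R, fun i => D i + 0)) :=
      tendsto_const_nhds.prodMk_nhds (tendsto_pi_nhds.2 fun i =>
        tendsto_const_nhds.add tendsto_one_div_add_atTop_nhds_zero_nat)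
    simp only [add_zero] at ht
    refine hcl.mem_of_tendsto ht (Eventually.of_forall fun j => ?_)
    obtain ⟨n₀, h⟩ := hR (1 / ((j : ℝ) + 1)) (by positivity)
    obtain ⟨M, c, hM, hc⟩ := h (max n₀ 1) (le_max_left _ _)
    obtain ⟨m, hm⟩ := c.exists_mem_infoRegion hP hl (by simp) hM hc
    exact exists_mem_infoRegion_le hl hm
  · rintro R ⟨m, hm⟩
    have ht : Tendsto (fun j : ℕ => fun i => R i + 1 / ((j : ℝ) + 1)) atTop
        (𝓝 fun i => R i + 0) :=
      tendsto_pi_nhds.2 fun i => tendsto_const_nhds.add tendsto_one_div_add_atTop_nhds_zero_nat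
    simp only [add_zero] at ht
    exact mem_closure_of_tendsto ht (Eventually.of_forall fun j =>
      achievable_of_mem_infoRegion hl hd hm (by positivity))

end Achievability

end TriangularNetwork

end

theorem theorem6 (k l : ℕ) (hl : 1 ≤ l)
    {𝒳 𝒴 : Type*} [Fintype 𝒳] [Fintype 𝒴]
    {𝒳h : Fin (k + l) → Type*} [∀ i, Fintype (𝒳h i)]
    (P : 𝒳 × 𝒴 → ℝ) (hP : P ∈ stdSimplex ℝ (𝒳 × 𝒴))
    (d : (i : Fin (k + l)) → 𝒳 → 𝒳h i → ℝ) (hd : ∀ i x z, 0 ≤ d i x z)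
    (D : Fin (k + l) → ℝ) :
    TriangularNetwork.achievableRegion P d D =
        {R | ∃ m : ℕ, R ∈ TriangularNetwork.infoRegion P d D m} ∧
    TriangularNetwork.achievableRegion P d D =
        {R | ∃ m : ℕ,
          m ≤ Fintype.card 𝒳 * Fintype.card 𝒴 * (∏ i, Fintype.card (𝒳h i)) + (k + l) ∧
          R ∈ TriangularNetwork.infoRegion P d D m} := by
  have hcard : {R | ∃ m : ℕ, R ∈ TriangularNetwork.infoRegion P d D m} = {R | ∃ m : ℕ,
      m ≤ Fintype.card 𝒳 * Fintype.card 𝒴 * (∏ i, Fintype.card (𝒳h i)) + (k + l) ∧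
      R ∈ TriangularNetwork.infoRegion P d D m} :=
    Set.ext fun R => ⟨fun ⟨_, h⟩ => TriangularNetwork.exists_mem_infoRegion_le hl h,
      fun ⟨m, _, h⟩ => ⟨m, h⟩⟩
  rw [← hcard, and_self]
  exact TriangularNetwork.achievableRegion_eq hl hP hd
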